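/- **Transseries.** Let $\mathcal G$ be a totally ordered abelian group, written multiplicatively (its order is also written $\mu_1\gg\mu_2$, read "$\mu_1$ is larger"); $\mu$ is small if $\mu\ll 1$ and large if $\mu\gg1$. $\mathcal S(\mathcal G)$ denotes the algebra of all formal sums $\sum_{\mathbf k\ge\mathbf k_0}c_{\mathbf k}\mu_1^{k_1}\cdots\mu_M^{k_M}$ with $M\in\mathbb N$, small $\mu_1,\dots,\mu_M\in\mathcal G$, $\mathbf k_0\in\mathbb Z^M$, $\mathbf k\in\mathbb Z^M$ and $c_{\mathbf k}\in\mathbb R$ (coefficients of equal products being added). A series is *large* (*small*) if all of its monomials are large (small). For $T\neq0$, $\mathrm{mag}(T)$ is the largest monomial of $T$, and $T>0$ means that its coefficient is positive; $\mathrm{mag}(0)=0$; $S\gg T$ means that $\mathrm{mag}(S)$ is larger than $\mathrm{mag}(T)$. Let $\mathcal G^{[0]}=\{x^{\sigma}:\sigma\in\mathbb R\}$ and $\mathcal T^{[n]}=\mathcal S(\mathcal G^{[n]})$, where $\mathcal G^{[n+1]}=\{x^{\sigma}e^{L}:\sigma\in\mathbb R,\ L\in\mathcal T^{[n]}\text{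 large or }0\}$, ordered by $x^{\sigma}e^{L}\gg1$ iff $L>0$, or $L=0$ and $\sigma>0$. Then $\mathcal T^{[n]}\subset\mathcal T^{[n+1]}$, with the level-$0$ monomials $x^\sigma$ included as such. Right composition with $\exp$ sends $x^\sigma e^{L}$ to $e^{\sigma x+L\circ\exp}$. With $L_0=x$, $L_{k+1}=\log L_k$, the space of transseries is $\mathcal T=\{f\circ L_k: k\in\mathbb N,\ f\in\bigcup_n\mathcal T^{[n]}\}$, where $f\circ L_k$ is identified with $(f\circ\exp)\circ L_{k+1}$. The derivative $\mathcal D T=T'$ acts term by term, with $(x^\sigma e^{L})'=(\sigma x^{-1}+L')x^\sigma e^{L}$ and $(f\circ L_k)'=(L_0L_1\cdots L_{k-1})^{-1}\,f'\circ L_k$. A transseries has *no constant term* if it is the sum of a large and a small one; $T(0)$ denotes $T$ minus its constant term. A linear $J:\mathcal T^{[n]}\to\mathcal T^{[n]}$ acting term by term is *asymptotically contractive* if any finitely many small monomials in $\mathcal G^{[n]}$ can be completed to finitely many small ones $\mu_1,\dots,\mu_M\in\mathcal G^{[n]}$ such that for all $\mathbf j\in\mathbb Z^M$ one has $J\boldsymbol\mu^{\mathbf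 j}=\sum_{\mathbf p\in\mathbb N^M,\ \mathbf p\ne0}c_{\mathbf j,\mathbf p}\,\boldsymbol\mu^{\mathbf j+\mathbf p}$ with real $c_{\mathbf j,\mathbf p}$. **Proposition.** There is a linear operator $\mathcal P:\mathcal T\to\mathcal T$ with the following properties, for all $S,T\in\mathcal T$. 1. $(\mathcal P T)'=T$, and $\mathcal P T$ has no constant term; $\mathcal P$ is the only map $\mathcal T\to\mathcal T$ with these two properties. Moreover $\mathcal P(T')=T(0)$. 2. $\mathcal P(S\,T')=(ST)(0)-\mathcal P(S'\,T)$. 3. $S\gg T$ implies $\mathcal P S\gg\mathcal P T$. 4. Let $T>0$. If $\mathcal P T\gg1$ then $\mathcal P T>0$; in particular $\mathcal P T>0$ whenever $T$ is not $\ll 1/x$. If $\mathcal P T\ll1$ then $-\mathcal P T>0$. 5. Let $n\ge1$ and let $L\in\mathcal T^{[n]}$ be large, with $L\notin\mathcal T^{[n-1]}$. Then $J\Delta=-\frac{L''}{(L')^2}\Delta+\frac{1}{L'}\Delta'$ defines an asymptotically contractive linear operator on $\mathcal T^{[n]}$, the equation $$\Delta=-\frac{L''}{(L')^2}+J\Delta$$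 has exactly one solution $\Delta\in\mathcal T^{[n]}$, this solution satisfies $\Delta\ll1$, and $$\mathcal P\,e^{-L}=-\frac{e^{-L}}{L'}\,(1+\Delta).$$ -/

import Mathlib

set_option linter.unusedSectionVars false

/-!
# The field of (real, general) transseries

Conventions.

* A group of transmonomials is a totally ordered abelian group, written *additively* through
  exponents and ordered *oppositely* to `≫`: the smaller the exponent, the larger the transmonomial.
  So `0` stands for the transmonomial `1`, `0 < γ` means that the transmonomial with exponent `γ`
  is `≪ 1`, and `single γ c : HahnSeries Γ ℝ` is `c` times that transmonomial.
* The exponent `(L, σ)` stands for `x ^ (-σ) * exp (-L)`.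
-/

noncomputable section

namespace Transseries

open HahnSeries

/-! ### Finitely generated (grid-based) series -/

section Grid

variable {Γ : Type} [AddCommGroup Γ] [LinearOrder Γ] [IsOrderedAddMonoid Γ]

/-- A set of exponents is a grid if it lies in `{∑ kᵢ μᵢ : k ≥ k₀}`, `k ∈ ℤ^M`, for finitely many
generators `μ₁, …, μ_M` that are all small transmonomials, and some `k₀ ∈ ℤ^M`.  -/
def IsGrid (s : Set Γ) : Prop :=
  ∃ (M : ℕ) (μ : Fin M → Γ) (k₀ : Fin M → ℤ), (∀ i, 0 < μ i) ∧
    ∀ γ ∈ s, ∃ k : Fin M → ℤ, k₀ ≤ k ∧ γ = ∑ i, k i • μ i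

theorem isGrid_of_fintype {s : Set Γ} {ι : Type} [Fintype ι] (μ : ι → Γ) (k₀ : ι → ℤ)
    (hμ : ∀ i, 0 < μ i) (hs : ∀ γ ∈ s, ∃ k : ι → ℤ, k₀ ≤ k ∧ γ = ∑ i, k i • μ i) :
    IsGrid s := by
  let e := Fintype.equivFin ι
  refine ⟨Fintype.card ι, μ ∘ e.symm, k₀ ∘ e.symm, fun i => hμ _, fun γ hγ => ?_⟩
  obtain ⟨k, hk, rfl⟩ := hs γ hγ
  exact ⟨k ∘ e.symm, fun i => hk _, (Equiv.sum_comp e.symm fun i => k i • μ i).symm⟩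

theorem isGrid_iff {s : Set Γ} : IsGrid s ↔
    ∃ (G : Finset Γ) (a : Γ), (∀ g ∈ G, 0 < g) ∧
      ∀ γ ∈ s, γ - a ∈ AddSubmonoid.closure (G : Set Γ) := by
  classical
  constructor
  · rintro ⟨M, μ, k₀, hμ, hs⟩
    refine ⟨Finset.univ.image μ, ∑ i, k₀ i • μ i, by simpa using hμ, fun γ hγ => ?_⟩
    obtain ⟨k, hk, rfl⟩ := hs γ hγ
    rw [← Finset.sum_sub_distrib]
    refine AddSubmonoid.sum_mem _ fun i _ => ?_
    rw [← sub_smul]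
    obtain ⟨n, hn⟩ := Int.eq_ofNat_of_zero_le (sub_nonneg.2 (hk i))
    rw [hn, natCast_zsmul]
    exact AddSubmonoid.nsmul_mem _ (AddSubmonoid.subset_closure (by simp)) n
  · rintro ⟨G, a, hG, hs⟩
    by_cases ha : a = 0
    · subst ha
      refine isGrid_of_fintype (ι := G) (fun g => g.1) 0 (fun g => hG g.1 g.2) fun γ hγ => ?_
      obtain ⟨f, hf⟩ := AddSubmonoid.mem_closure_finset'.1 (hs γ hγ)
      refine ⟨fun g => f g, fun g => by simp, ?_⟩
      simpa using hf
    · obtain ⟨b, n, hb, hab⟩ : ∃ (b : Γ) (n : ℤ), 0 < b ∧ a = n • b := by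
        rcases lt_or_gt_of_ne ha with h | h
        · exact ⟨-a, -1, by simpa using h, by simp⟩
        · exact ⟨a, 1, h, by simp⟩
      refine isGrid_of_fintype (ι := Option G) (fun g => g.elim b fun g => g.1)
        (fun g => g.elim n fun _ => 0) ?_ fun γ hγ => ?_
      · rintro (_ | g)
        · exact hb
        · exact hG g.1 g.2
      · obtain ⟨f, hf⟩ := AddSubmonoid.mem_closure_finset'.1 (hs γ hγ)
        refine ⟨fun g => g.elim n fun g => f g, ?_, ?_⟩
        · rintro (_ | g) <;> simp
        · simp only [Fintype.sum_option, Option.elim, ← hab]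
          rw [eq_comm, ← eq_sub_iff_add_eq', hf]
          simp

theorem IsGrid.subset {s t : Set Γ} (ht : IsGrid t) (h : s ⊆ t) : IsGrid s := by
  obtain ⟨M, μ, k₀, hμ, hs⟩ := ht
  exact ⟨M, μ, k₀, hμ, fun γ hγ => hs γ (h hγ)⟩

theorem isGrid_singleton (a : Γ) : IsGrid {a} :=
  isGrid_iff.2 ⟨∅, a, by simp, by simp⟩

theorem isGrid_empty : IsGrid (∅ : Set Γ) := (isGrid_singleton 0).subset (by simp)

theorem IsGrid.union {s t : Set Γ} (hs : IsGrid s) (ht : IsGrid t) : IsGrid (s ∪ t) := by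
  classical
  wlog hab : ∃ (G : Finset Γ) (a : Γ) (H : Finset Γ) (b : Γ), a ≤ b ∧
      ((∀ g ∈ G, 0 < g) ∧ ∀ γ ∈ s, γ - a ∈ AddSubmonoid.closure (G : Set Γ)) ∧
      ((∀ g ∈ H, 0 < g) ∧ ∀ γ ∈ t, γ - b ∈ AddSubmonoid.closure (H : Set Γ)) generalizing s t
  · obtain ⟨G, a, hG⟩ := isGrid_iff.1 hs
    obtain ⟨H, b, hH⟩ := isGrid_iff.1 ht
    rcases le_total a b with h | h
    · exact absurd ⟨G, a, H, b, h, hG, hH⟩ hab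
    · rw [Set.union_comm]
      exact this ht hs ⟨H, b, G, a, h, hH, hG⟩
  obtain ⟨G, a, H, b, h, ⟨hG, hs⟩, ⟨hH, ht⟩⟩ := hab
  rcases h.eq_or_lt with rfl | h
  · refine isGrid_iff.2 ⟨G ∪ H, a, ?_, ?_⟩
    · intro g hg
      rcases Finset.mem_union.1 hg with hg | hg
      exacts [hG g hg, hH g hg]
    · rintro γ (hγ | hγ)
      · exact AddSubmonoid.closure_mono (by simp) (hs γ hγ)
      · exact AddSubmonoid.closure_mono (by simp) (ht γ hγ)
  · refine isGrid_iff.2 ⟨insert (b - a) (G ∪ H), a, ?_, ?_⟩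
    · intro g hg
      rcases Finset.mem_insert.1 hg with rfl | hg
      · exact sub_pos.2 h
      rcases Finset.mem_union.1 hg with hg | hg
      exacts [hG g hg, hH g hg]
    · rintro γ (hγ | hγ)
      · exact AddSubmonoid.closure_mono (by intro x hx; simp at hx ⊢; tauto) (hs γ hγ)
      · have h1 := AddSubmonoid.closure_mono
          (show (H : Set Γ) ⊆ (insert (b - a) (G ∪ H) : Finset Γ) by
            intro x hx; simp at hx ⊢; tauto) (ht γ hγ)
        have h2 : b - a ∈ AddSubmonoid.closure ((insert (b - a) (G ∪ H) : Finset Γ) : Set Γ) :=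
          AddSubmonoid.subset_closure (by simp)
        simpa using AddSubmonoid.add_mem _ h1 h2

open Pointwise in
theorem IsGrid.add {s t : Set Γ} (hs : IsGrid s) (ht : IsGrid t) : IsGrid (s + t) := by
  classical
  obtain ⟨G, a, hG, hs⟩ := isGrid_iff.1 hs
  obtain ⟨H, b, hH, ht⟩ := isGrid_iff.1 ht
  refine isGrid_iff.2 ⟨G ∪ H, a + b, ?_, ?_⟩
  · intro g hg
    rcases Finset.mem_union.1 hg with hg | hg
    exacts [hG g hg, hH g hg]
  · rintro _ ⟨x, hx, y, hy, rfl⟩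
    have h1 := AddSubmonoid.closure_mono
      (show (G : Set Γ) ⊆ (G ∪ H : Finset Γ) by simp) (hs x hx)
    have h2 := AddSubmonoid.closure_mono
      (show (H : Set Γ) ⊆ (G ∪ H : Finset Γ) by simp) (ht y hy)
    show x + y - (a + b) ∈ _
    rw [add_sub_add_comm]
    exact AddSubmonoid.add_mem _ h1 h2

theorem IsGrid.isPWO {s : Set Γ} (hs : IsGrid s) : s.IsPWO := by
  obtain ⟨G, a, hG, hs⟩ := isGrid_iff.1 hs
  have h : (AddSubmonoid.closure (G : Set Γ) : Set Γ).IsPWO :=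
    Set.IsPWO.addSubmonoid_closure (fun x hx => (hG x hx).le) G.finite_toSet.isPWO
  refine (h.image_of_monotone (f := fun x => x + a) fun x y hxy => add_le_add_left hxy a).mono ?_
  exact fun γ hγ => ⟨γ - a, hs γ hγ, by simp⟩

theorem IsGrid.biUnion {ι : Type} (t : Finset ι) {s : ι → Set Γ} (hs : ∀ i, IsGrid (s i)) :
    IsGrid (⋃ i ∈ t, s i) := by
  classical
  induction t using Finset.induction_on with
  | empty => simpa using isGrid_empty
  | insert a t _ ih => rw [Finset.set_biUnion_insert]; exact (hs a).union ih

theorem IsGrid.image {Δ : Type} [AddCommGroup Δ] [LinearOrder Δ] [IsOrderedAddMonoid Δ]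
    {s : Set Γ} (hs : IsGrid s) (e : Γ →+ Δ) (he : StrictMono e) : IsGrid (e '' s) := by
  obtain ⟨M, μ, k₀, hμ, hs⟩ := hs
  refine ⟨M, e ∘ μ, k₀, fun i => by simpa using he (hμ i), ?_⟩
  rintro _ ⟨γ, hγ, rfl⟩
  obtain ⟨k, hk, rfl⟩ := hs γ hγ
  exact ⟨k, hk, by simp⟩

variable (Γ) in
/-- The algebra of the multiseries `∑_{k ≥ k₀} c_k μ^k` with finitely many generators `μᵢ ≪ 1`
in `Γ` and real coefficients, each in collected form (one coefficient per transmonomial). -/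
def gridSubalgebra : Subalgebra ℝ (HahnSeries Γ ℝ) where
  carrier := {f | IsGrid f.support}
  mul_mem' ha hb := (IsGrid.add ha hb).subset support_mul_subset
  add_mem' ha hb := (IsGrid.union ha hb).subset (support_add_subset _ _)
  algebraMap_mem' r := (isGrid_singleton (0 : Γ)).subset (by
    rw [HahnSeries.algebraMap_apply]; exact support_single_subset)

variable (Γ) in
/-- The type of finitely generated series over the transmonomial group `Γ`. -/
def Grid : Type := gridSubalgebra Γ

instance : CommRing (Grid Γ) := inferInstanceAs (CommRing (gridSubalgebra Γ))

instance : Algebra ℝ (Grid Γ) := inferInstanceAs (Algebra ℝ (gridSubalgebra Γ))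

/-- The underlying Hahn series. -/
def Grid.val (f : Grid Γ) : HahnSeries Γ ℝ := Subtype.val f

theorem Grid.isGrid (f : Grid Γ) : IsGrid f.val.support := Subtype.property f

def Grid.mk (f : HahnSeries Γ ℝ) (hf : IsGrid f.support) : Grid Γ := ⟨f, hf⟩

theorem Grid.ext {f g : Grid Γ} (h : f.val = g.val) : f = g := Subtype.ext h

def Grid.valHom : Grid Γ →ₐ[ℝ] HahnSeries Γ ℝ := (gridSubalgebra Γ).val

theorem single_mem_grid (γ : Γ) (r : ℝ) : single γ r ∈ gridSubalgebra Γ :=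
  (isGrid_singleton γ).subset support_single_subset

/-- A transmonomial as a series. -/
def monomial (γ : Γ) : Grid Γ := Grid.mk (single γ 1) (single_mem_grid γ 1)

variable (Γ) in
/-- The ordered group of large series: finitely generated, all of whose transmonomials are `≫ 1`
(`0` included). The order is the one for which a series is positive iff its dominant coefficient
is positive. -/
def Large : AddSubgroup (Lex (HahnSeries Γ ℝ)) where
  carrier := {L | ofLex L ∈ gridSubalgebra Γ ∧ ∀ γ ∈ (ofLex L).support, γ < 0}
  add_mem' {a b} ha hb := ⟨(gridSubalgebra Γ).add_mem ha.1 hb.1, fun γ hγ =>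
    (support_add_subset _ _ hγ).elim (ha.2 γ) (hb.2 γ)⟩
  zero_mem' := ⟨(gridSubalgebra Γ).zero_mem, by simp⟩
  neg_mem' {a} ha := ⟨(gridSubalgebra Γ).neg_mem ha.1, by simpa using ha.2⟩

/-- A large series as a series. -/
def largeToGrid : Large Γ →+ Grid Γ where
  toFun L := Grid.mk (ofLex L.1) L.2.1
  map_zero' := rfl
  map_add' _ _ := rfl

end Grid

/-! ### Term by term differentiation -/

section Deriv

variable {Γ : Type} [AddCommGroup Γ] [LinearOrder Γ] [IsOrderedAddMonoid Γ]

theorem exists_grid_of_hom (δ : Γ →+ Grid Γ) {s : Set Γ} (hs : IsGrid s) :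
    ∃ S : Set Γ, IsGrid S ∧ ∀ m ∈ s, (δ m).val.support ⊆ S := by
  obtain ⟨M, μ, k₀, -, hs⟩ := hs
  refine ⟨⋃ i ∈ (Finset.univ : Finset (Fin M)), (δ (μ i)).val.support,
    IsGrid.biUnion _ fun i => (δ (μ i)).isGrid, fun m hm γ hγ => ?_⟩
  obtain ⟨k, -, rfl⟩ := hs m hm
  by_contra hc
  simp only [Finset.mem_univ, Set.iUnion_true, Set.mem_iUnion, not_exists, mem_support,
    not_not] at hc
  let φ : Γ →+ ℝ := (coeff.addMonoidHom γ).comp ((Grid.valHom (Γ := Γ)).toLinearMap.toAddMonoidHom.comp δ)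
  have hφ : ∀ i, φ (μ i) = 0 := hc
  exact hγ (show φ (∑ i, k i • μ i) = 0 by simp [hφ])

open Pointwise in
/-- If `δ γ` is the logarithmic derivative of the transmonomial `γ`, these are the derivatives
`f_γ * γ * δ γ` of the terms of `f`; they form a summable family. -/
def derivFamily (δ : Γ →+ Grid Γ) (f : Grid Γ) : SummableFamily Γ ℝ Γ where
  toFun m := f.val.coeff m • (single m 1 * (δ m).val)
  isPWO_iUnion_support' := by
    obtain ⟨S, hS, h⟩ := exists_grid_of_hom δ f.isGrid
    refine (IsGrid.add f.isGrid hS).isPWO.mono (Set.iUnion_subset fun m γ hγ => ?_)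
    by_cases hm : f.val.coeff m = 0
    · simp [hm] at hγ
    · obtain ⟨a, ha, b, hb, rfl⟩ := support_mul_subset (support_smul_subset _ _ hγ)
      obtain rfl : a = m := by simpa using support_single_subset ha
      exact ⟨a, hm, b, h a hm hb, rfl⟩
  finite_co_support' g := by
    obtain ⟨S, hS, h⟩ := exists_grid_of_hom δ f.isGrid
    refine ((Set.AddAntidiagonal.finite_of_isPWO f.val.isPWO_support hS.isPWO g).image
      Prod.fst).subset fun m hm => ?_
    have hm' : f.val.coeff m ≠ 0 := fun h0 => by simp [h0] at hm
    obtain ⟨a, ha, b, hb, rfl⟩ := support_mul_subset (support_smul_subset _ _ hm)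
    obtain rfl : a = m := by simpa using support_single_subset ha
    exact ⟨(a, b), ⟨hm', h a hm' hb, rfl⟩, rfl⟩

open Pointwise in
/-- Term by term differentiation, given the logarithmic derivatives `δ` of the transmonomials. -/
def deriv (δ : Γ →+ Grid Γ) : Grid Γ →ₗ[ℝ] Grid Γ where
  toFun f := Grid.mk (derivFamily δ f).hsum <| by
    obtain ⟨S, hS, h⟩ := exists_grid_of_hom δ f.isGrid
    refine (IsGrid.add f.isGrid hS).subset (SummableFamily.support_hsum_subset.trans
      (Set.iUnion_subset fun m γ hγ => ?_))
    by_cases hm : f.val.coeff m = 0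
    · simp [derivFamily, hm] at hγ
    · obtain ⟨a, ha, b, hb, rfl⟩ := support_mul_subset (support_smul_subset _ _ hγ)
      obtain rfl : a = m := by simpa using support_single_subset ha
      exact ⟨a, hm, b, h a hm hb, rfl⟩
  map_add' f g := by
    apply Grid.ext
    show _ = (derivFamily δ f).hsum + (derivFamily δ g).hsum
    rw [← SummableFamily.hsum_add]
    refine congrArg SummableFamily.hsum (SummableFamily.ext fun m => ?_)
    rw [SummableFamily.add_apply]
    exact add_smul (f.val.coeff m) (g.val.coeff m) (single m 1 * (δ m).val)
  map_smul' r f := by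
    apply Grid.ext
    show _ = r • (derivFamily δ f).hsum
    ext g
    show (derivFamily δ (r • f)).hsum.coeff g = r • (derivFamily δ f).hsum.coeff g
    rw [SummableFamily.coeff_hsum, SummableFamily.coeff_hsum, smul_finsum]
    refine finsum_congr fun m => ?_
    exact mul_assoc r (f.val.coeff m) ((single m 1 * (δ m).val).coeff g)

end Deriv

/-- A totally ordered abelian group. -/
structure OrdGroup where
  carrier : Type
  [grp : AddCommGroup carrier]
  [lin : LinearOrder carrier]
  [ord : IsOrderedAddMonoid carrier]

instance : CoeSort OrdGroup Type := ⟨OrdGroup.carrier⟩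

attribute [instance] OrdGroup.grp OrdGroup.lin OrdGroup.ord

/-- Strictly increasing homomorphisms. -/
structure Emb (A B : OrdGroup) extends A →+ B where
  strictMono' : StrictMono toFun

namespace Emb

variable {A B C : OrdGroup}

instance : FunLike (Emb A B) A B where
  coe e := e.toFun
  coe_injective e e' h := by
    obtain ⟨e, _⟩ := e
    obtain ⟨e', _⟩ := e'
    congr
    exact DFunLike.coe_injective h

instance : AddMonoidHomClass (Emb A B) A B where
  map_add e := e.map_add'
  map_zero e := e.map_zero'

theorem strictMono (e : Emb A B) : StrictMono e := e.strictMono'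

/-- A homomorphism that preserves positivity is strictly increasing. -/
def ofPos (e : A →+ B) (h : ∀ a, 0 < a → 0 < e a) : Emb A B :=
  ⟨e, fun a b hab => by
    have := h (b - a) (sub_pos.2 hab)
    rwa [map_sub, sub_pos] at this⟩

@[simp] theorem ofPos_apply (e : A →+ B) (h : ∀ a, 0 < a → 0 < e a) (a : A) :
    ofPos e h a = e a := rfl

def refl (A : OrdGroup) : Emb A A := ⟨AddMonoidHom.id A, strictMono_id⟩

def comp (g : Emb B C) (f : Emb A B) : Emb A C :=
  ⟨g.toAddMonoidHom.comp f.toAddMonoidHom, g.strictMono.comp f.strictMono⟩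

@[simp] theorem comp_apply (g : Emb B C) (f : Emb A B) (a : A) : g.comp f a = g (f a) := rfl

def toOrderEmb (e : Emb A B) : A ↪o B := OrderEmbedding.ofStrictMono e e.strictMono

@[simp] theorem toOrderEmb_apply (e : Emb A B) (a : A) : e.toOrderEmb a = e a := rfl

/-- Replacing transmonomials through `e`, on Hahn series. -/
def mapAlg (e : Emb A B) : HahnSeries A ℝ →ₐ[ℝ] HahnSeries B ℝ :=
  embDomainAlgHom e.toAddMonoidHom e.strictMono.injective fun _ _ => e.strictMono.le_iff_le

theorem mapAlg_apply (e : Emb A B) (f : HahnSeries A ℝ) :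
    e.mapAlg f = embDomain e.toOrderEmb f := rfl

@[simp] theorem mapAlg_single (e : Emb A B) (a : A) (r : ℝ) :
    e.mapAlg (single a r) = single (e a) r := embDomain_single

theorem support_mapAlg_subset (e : Emb A B) (f : HahnSeries A ℝ) :
    (e.mapAlg f).support ⊆ e '' f.support := support_embDomain_subset

@[simp] theorem mapAlg_coeff (e : Emb A B) (f : HahnSeries A ℝ) (a : A) :
    (e.mapAlg f).coeff (e a) = f.coeff a := embDomain_coeff (f := e.toOrderEmb)

theorem mapAlg_coeff_of_notMem (e : Emb A B) (f : HahnSeries A ℝ) {b : B}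
    (hb : b ∉ Set.range e) : (e.mapAlg f).coeff b = 0 :=
  embDomain_of_notMem_range (f := e.toOrderEmb) hb

theorem mapAlg_comp (g : Emb B C) (f : Emb A B) (s : HahnSeries A ℝ) :
    (g.comp f).mapAlg s = g.mapAlg (f.mapAlg s) := by
  ext c
  by_cases hc : c ∈ Set.range (g.comp f)
  · obtain ⟨a, rfl⟩ := hc
    rw [mapAlg_coeff, comp_apply, mapAlg_coeff, mapAlg_coeff]
  · rw [mapAlg_coeff_of_notMem _ _ hc]
    by_cases hc' : c ∈ Set.range g
    · obtain ⟨b, rfl⟩ := hc'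
      rw [mapAlg_coeff, mapAlg_coeff_of_notMem]
      rintro ⟨a, rfl⟩
      exact hc ⟨a, rfl⟩
    · rw [mapAlg_coeff_of_notMem _ _ hc']

theorem mapAlg_mem_grid (e : Emb A B) {f : HahnSeries A ℝ} (hf : f ∈ gridSubalgebra A) :
    e.mapAlg f ∈ gridSubalgebra B :=
  (IsGrid.image hf e.toAddMonoidHom e.strictMono).subset (e.support_mapAlg_subset f)

/-- Replacing transmonomials through `e`, on finitely generated series. -/
def mapGrid (e : Emb A B) : Grid A →ₐ[ℝ] Grid B :=
  (e.mapAlg.comp (gridSubalgebra A).val).codRestrict (gridSubalgebra B) fun f => e.mapAlg_mem_grid f.2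

@[simp] theorem val_mapGrid (e : Emb A B) (f : Grid A) :
    (e.mapGrid f).val = e.mapAlg f.val := rfl

@[simp] theorem mapGrid_monomial (e : Emb A B) (a : A) :
    e.mapGrid (monomial a) = monomial (e a) := Grid.ext (mapAlg_single e a 1)

theorem mapGrid_comp (g : Emb B C) (f : Emb A B) (s : Grid A) :
    (g.comp f).mapGrid s = g.mapGrid (f.mapGrid s) := Grid.ext (mapAlg_comp g f _)

/-- Replacing transmonomials through `e`, on large series. -/
def mapLarge (e : Emb A B) : Large A →+ Large B where
  toFun L := ⟨toLex (e.mapAlg (ofLex L.1)), e.mapAlg_mem_grid L.2.1, fun γ hγ => by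
    obtain ⟨a, ha, rfl⟩ := e.support_mapAlg_subset _ hγ
    simpa using e.strictMono (L.2.2 a ha)⟩
  map_zero' := Subtype.ext (map_zero e.mapAlg)
  map_add' a b := Subtype.ext (map_add e.mapAlg _ _)

theorem mapLarge_pos (e : Emb A B) {L : Large A} (hL : 0 < L) : 0 < e.mapLarge L := by
  have := (embDomainOrderEmbedding (R := ℝ) e.toOrderEmb).strictMono
    (show (0 : Lex (HahnSeries A ℝ)) < L.1 from hL)
  have h0 : embDomainOrderEmbedding (R := ℝ) e.toOrderEmb 0 = 0 := embDomain_zero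
  rw [h0] at this
  exact this

theorem toGrid_mapLarge (e : Emb A B) (L : Large A) :
    largeToGrid (e.mapLarge L) = e.mapGrid (largeToGrid L) := rfl

theorem mapLarge_comp (g : Emb B C) (f : Emb A B) (L : Large A) :
    (g.comp f).mapLarge L = g.mapLarge (f.mapLarge L) :=
  Subtype.ext (mapAlg_comp g f _)

end Emb

def Emb.mapFamily {A B : OrdGroup} {α : Type} (e : Emb A B) (F : SummableFamily A ℝ α) :
    SummableFamily B ℝ α where
  toFun i := e.mapAlg (F i)
  isPWO_iUnion_support' := by
    refine (F.isPWO_iUnion_support.image_of_monotone e.strictMono.monotone).mono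
      (Set.iUnion_subset fun i b hb => ?_)
    obtain ⟨a, ha, rfl⟩ := e.support_mapAlg_subset _ hb
    exact ⟨a, Set.mem_iUnion.2 ⟨i, ha⟩, rfl⟩
  finite_co_support' b := by
    by_cases hb : b ∈ Set.range e
    · obtain ⟨a, rfl⟩ := hb
      simp only [e.mapAlg_coeff]
      exact F.finite_co_support a
    · simp [e.mapAlg_coeff_of_notMem _ hb]

theorem Emb.mapAlg_hsum {A B : OrdGroup} {α : Type} (e : Emb A B) (F : SummableFamily A ℝ α) :
    e.mapAlg F.hsum = (e.mapFamily F).hsum := by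
  ext b
  rw [SummableFamily.coeff_hsum]
  by_cases hb : b ∈ Set.range e
  · obtain ⟨a, rfl⟩ := hb
    rw [mapAlg_coeff, SummableFamily.coeff_hsum]
    exact finsum_congr fun i => (e.mapAlg_coeff (F i) a).symm
  · rw [mapAlg_coeff_of_notMem _ _ hb, eq_comm]
    exact finsum_eq_zero_of_forall_eq_zero fun i => e.mapAlg_coeff_of_notMem (F i) hb

theorem deriv_mapGrid {A B : OrdGroup} (e : Emb A B) (δA : A →+ Grid A) (δB : B →+ Grid B)
    (u : Grid B) (h : ∀ a, δB (e a) = u * e.mapGrid (δA a)) (f : Grid A) :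
    deriv δB (e.mapGrid f) = u * e.mapGrid (deriv δA f) := by
  apply Grid.ext
  show (derivFamily δB (e.mapGrid f)).hsum = u.val * e.mapAlg (derivFamily δA f).hsum
  rw [e.mapAlg_hsum, ← SummableFamily.hsum_smul,
    ← SummableFamily.hsum_embDomain (f := e.toOrderEmb.toEmbedding)]
  refine congrArg SummableFamily.hsum (SummableFamily.ext fun b => ?_)
  by_cases hb : b ∈ Set.range e
  · obtain ⟨a, rfl⟩ := hb
    refine Eq.trans ?_ (SummableFamily.embDomain_image _ e.toOrderEmb.toEmbedding).symm
    show (e.mapAlg f.val).coeff (e a) • (single (e a) 1 * (δB (e a)).val) =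
      u.val * e.mapAlg (f.val.coeff a • (single a 1 * (δA a).val))
    rw [h, e.mapAlg_coeff, map_smul, map_mul, e.mapAlg_single]
    have hc : ∀ (r : ℝ) (y : HahnSeries B ℝ), C r * y = r • y := fun _ _ => C_mul_eq_smul
    have h1 := mul_left_comm u.val (C (f.val.coeff a)) (single (e a) 1 * e.mapAlg (δA a).val)
    rw [hc, hc, mul_left_comm u.val] at h1
    exact h1.symm
  · rw [SummableFamily.embDomain_of_notMem_range _ _ hb]
    ext g
    show (e.mapAlg f.val).coeff b * (single b 1 * (δB b).val).coeff g = 0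
    rw [e.mapAlg_coeff_of_notMem _ hb, zero_mul]

/-! ### Levels -/

/-- The transmonomials `x ^ (-σ) * exp (-L)`, `L` a large series over `A`: `(L, σ)` with the
lexicographic order. -/
def OrdGroup.exp (A : OrdGroup) : OrdGroup := ⟨Large A ×ₗ ℝ⟩

section Exp
variable {A B : OrdGroup}

/-- The transmonomial `x ^ (-σ) * exp (-L)`. -/
def expMk (L : Large A) (σ : ℝ) : A.exp := toLex (L, σ)

/-- `L` in `x ^ (-σ) * exp (-L)`. -/
def lpart : A.exp →+ Large A where
  toFun m := (ofLex m).1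
  map_zero' := rfl
  map_add' _ _ := rfl

/-- `σ` in `x ^ (-σ) * exp (-L)`. -/
def spart : A.exp →+ ℝ where
  toFun m := (ofLex m).2
  map_zero' := rfl
  map_add' _ _ := rfl

theorem expMk_add (L L' : Large A) (σ σ' : ℝ) :
    expMk (L + L') (σ + σ') = expMk L σ + expMk L' σ' := rfl

@[simp] theorem lpart_mk (L : Large A) (σ : ℝ) : lpart (expMk L σ) = L := rfl
@[simp] theorem spart_mk (L : Large A) (σ : ℝ) : spart (expMk L σ) = σ := rfl

theorem exp_pos_iff {m : A.exp} : 0 < m ↔ 0 < lpart m ∨ lpart m = 0 ∧ 0 < spart m := by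
  rw [eq_comm (b := (0 : Large A))]
  exact Prod.Lex.lt_iff (x := (0 : Large A ×ₗ ℝ)) (y := m)

/-- Level zero: the transmonomials `x ^ (-σ)`. -/
def baseGroup : OrdGroup := ⟨ℝ⟩

/-- `x ^ (-σ)`. -/
def baseMk (σ : ℝ) : baseGroup := σ

/-- `σ` in `x ^ (-σ)`. -/
def baseVal : baseGroup →+ ℝ where
  toFun σ := σ
  map_zero' := rfl
  map_add' _ _ := rfl

@[simp] theorem baseVal_mk (σ : ℝ) : baseVal (baseMk σ) = σ := rfl

theorem baseVal_pos {m : baseGroup} : 0 < baseVal m ↔ 0 < m := Iff.rfl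

/-- `σ` times the large transmonomial `γ`. -/
def smulLarge (γ : A) (hγ : γ < 0) : ℝ →+ Large A where
  toFun σ := ⟨toLex (single γ σ), single_mem_grid γ σ, fun γ' h => by
    obtain rfl : γ' = γ := by simpa using support_single_subset h
    exact hγ⟩
  map_zero' := Subtype.ext (single_eq_zero)
  map_add' a b := Subtype.ext (single_add γ a b)

theorem smulLarge_pos (γ : A) (hγ : γ < 0) {σ : ℝ} (hσ : 0 < σ) :
    0 < smulLarge γ hγ σ := by
  refine (HahnSeries.lt_iff _ _).2 ⟨γ, fun j hj => ?_, ?_⟩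
  · show 0 = (single γ σ).coeff j
    rw [coeff_single_of_ne hj.ne]
  · show 0 < (single γ σ).coeff γ
    rwa [coeff_single_same]

theorem mapLarge_smulLarge (e : Emb A B) (γ : A) (hγ : γ < 0) (γ' : B) (hγ' : γ' < 0)
    (h : e γ = γ') (σ : ℝ) : e.mapLarge (smulLarge γ hγ σ) = smulLarge γ' hγ' σ := by
  subst h
  refine Subtype.ext ?_
  show toLex (e.mapAlg (single γ σ)) = toLex (single (e γ) σ)
  rw [Emb.mapAlg_single]

/-- The transmonomial `x`. -/
def baseX : baseGroup := baseMk (-1)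

theorem baseX_neg : baseX < 0 := neg_one_lt_zero (R := ℝ)

/-- The transmonomial `x`. -/
def expX (A : OrdGroup) : A.exp := expMk 0 (-1)

@[simp] theorem lpart_expX : lpart (expX A) = 0 := rfl
@[simp] theorem spart_expX : spart (expX A) = -1 := rfl

theorem lt_expX {m : A.exp} (hs : spart m = 0) (hm : m < 0) : m < expX A := by
  rw [← sub_pos] at hm ⊢
  rw [zero_sub] at hm
  rcases exp_pos_iff.1 hm with h | ⟨-, h⟩
  · refine exp_pos_iff.2 (Or.inl ?_)
    rwa [map_sub, lpart_expX, zero_sub, ← map_neg]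
  · rw [map_neg, hs] at h
    simp at h

theorem expX_neg (A : OrdGroup) : expX A < 0 := by
  rw [← neg_pos, exp_pos_iff, map_neg, map_neg]
  simp

/-! Inclusions of a level into the next one -/

/-- `x ^ (-σ) ↦ x ^ (-σ) * exp 0`. -/
def baseIncl : Emb baseGroup baseGroup.exp :=
  Emb.ofPos
    { toFun := fun m => expMk 0 (baseVal m)
      map_zero' := rfl
      map_add' := fun a b => by rw [← expMk_add, map_add, add_zero] }
    fun _ h => exp_pos_iff.2 (Or.inr ⟨rfl, h⟩)

/-- `x ^ (-σ) * exp (-L) ↦ x ^ (-σ) * exp (-(e L))`. -/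
def Emb.exp (e : Emb A B) : Emb A.exp B.exp :=
  Emb.ofPos
    { toFun := fun m => expMk (e.mapLarge (lpart m)) (spart m)
      map_zero' := by simp; rfl
      map_add' := fun a b => by
        simp only [map_add, expMk_add] }
    fun m hm => by
      rcases exp_pos_iff.1 hm with h | ⟨h, h'⟩
      · exact exp_pos_iff.2 (Or.inl (e.mapLarge_pos h))
      · exact exp_pos_iff.2 (Or.inr ⟨by simp [h], h'⟩)

theorem baseIncl_apply (m : baseGroup) : baseIncl m = expMk 0 (baseVal m) := rfl

theorem Emb.exp_apply (e : Emb A B) (m : A.exp) :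
    e.exp m = expMk (e.mapLarge (lpart m)) (spart m) := rfl

theorem baseIncl_X : baseIncl baseX = expX baseGroup := rfl

theorem Emb.exp_X (e : Emb A B) : e.exp (expX A) = expX B := by
  rw [Emb.exp_apply, lpart_expX, map_zero]
  rfl

/-! Composition with `exp` -/

/-- `x ^ (-σ) ∘ exp = exp (-σ x)`. -/
def baseUp : Emb baseGroup baseGroup.exp :=
  Emb.ofPos
    { toFun := fun m => expMk (smulLarge baseX baseX_neg (baseVal m)) 0
      map_zero' := by rw [map_zero, map_zero]; rfl
      map_add' := fun a b => by rw [← expMk_add, add_zero, map_add, map_add] }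
    fun _ h => exp_pos_iff.2 (Or.inl (smulLarge_pos _ baseX_neg h))

theorem upStep_pos (e : Emb A B.exp) (he : ∀ a, spart (e a) = 0) (m : A.exp) (hm : 0 < m) :
    0 < smulLarge (expX B) (expX_neg B) (spart m) + e.mapLarge (lpart m) := by
  rcases exp_pos_iff.1 hm with h | ⟨h, h'⟩
  · obtain ⟨γ, h1, h2⟩ :=
      (HahnSeries.lt_iff _ _).1 (show (0 : Lex (HahnSeries A ℝ)) < (lpart m).1 from h)
    have hγ : γ < 0 := (lpart m).2.2 γ (ne_of_gt h2)
    have hx : e γ < expX B := lt_expX (he γ) (by simpa using e.strictMono hγ)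
    refine (HahnSeries.lt_iff _ _).2 ⟨e γ, fun j hj => ?_, ?_⟩
    · show 0 = (single (expX B) (spart m)).coeff j + (e.mapAlg (ofLex (lpart m).1)).coeff j
      rw [coeff_single_of_ne (hj.trans hx).ne, zero_add]
      by_cases hr : j ∈ Set.range e
      · obtain ⟨a, rfl⟩ := hr
        rw [e.mapAlg_coeff]
        exact h1 a (e.strictMono.lt_iff_lt.1 hj)
      · rw [e.mapAlg_coeff_of_notMem _ hr]
    · show 0 < (single (expX B) (spart m)).coeff (e γ) +
        (e.mapAlg (ofLex (lpart m).1)).coeff (e γ)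
      rw [coeff_single_of_ne hx.ne, zero_add, e.mapAlg_coeff]
      exact h2
  · rw [h, map_zero, add_zero]
    exact smulLarge_pos _ _ h'

/-- `(x ^ (-σ) * exp (-L)) ∘ exp = exp (-(σ x + L ∘ exp))`, where `e` is composition with `exp` on
the transmonomials of `L`.  -/
def upStep (e : Emb A B.exp) (he : ∀ a, spart (e a) = 0) : Emb A.exp B.exp.exp :=
  Emb.ofPos
    { toFun := fun m =>
        expMk (smulLarge (expX B) (expX_neg B) (spart m) + e.mapLarge (lpart m)) 0
      map_zero' := by simp only [map_zero, add_zero]; rfl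
      map_add' := fun a b => by
        rw [← expMk_add, map_add, map_add, map_add, map_add, add_add_add_comm, add_zero] }
    fun m hm => exp_pos_iff.2 (Or.inl (upStep_pos e he m hm))

theorem baseUp_apply (m : baseGroup) :
    baseUp m = expMk (smulLarge baseX baseX_neg (baseVal m)) 0 := rfl

theorem upStep_apply (e : Emb A B.exp) (he : ∀ a, spart (e a) = 0) (m : A.exp) :
    upStep e he m =
      expMk (smulLarge (expX B) (expX_neg B) (spart m) + e.mapLarge (lpart m)) 0 := rfl

theorem baseUp_incl (h : ∀ a, spart (baseUp a) = 0) (m : baseGroup) :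
    upStep baseUp h (baseIncl m) = baseIncl.exp (baseUp m) := by
  rw [baseIncl_apply, upStep_apply, baseUp_apply, Emb.exp_apply, lpart_mk, spart_mk, lpart_mk,
    spart_mk, map_zero, add_zero, mapLarge_smulLarge baseIncl _ _ _ (expX_neg _) baseIncl_X]

theorem upStep_incl (i : Emb A B) (i' : Emb A.exp B.exp) (u : Emb A A.exp)
    (u' : Emb B B.exp) (hu hu') (hx : i'  (expX A) = expX B)
    (h : ∀ m, u' (i m) = i' (u m)) (m : A.exp) :
    upStep u' hu' (i.exp m) = i'.exp (upStep u hu m) := by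
  have h' : u'.comp i = i'.comp u := DFunLike.ext _ _ h
  rw [Emb.exp_apply, upStep_apply, upStep_apply, Emb.exp_apply, lpart_mk, spart_mk, lpart_mk,
    spart_mk, map_add, mapLarge_smulLarge i' _ _ _ (expX_neg _) hx, ← Emb.mapLarge_comp,
    ← Emb.mapLarge_comp, h']

/-! Logarithmic derivatives -/

theorem deriv_monomial (δ : A →+ Grid A) (a : A) :
    deriv δ (monomial a) = monomial a * δ a := by
  refine Grid.ext ?_
  show (derivFamily δ (monomial a)).hsum = single a 1 * (δ a).val
  rw [← SummableFamily.hsum_single a (single a 1 * (δ a).val)]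
  refine congrArg SummableFamily.hsum (SummableFamily.ext fun b => ?_)
  ext g
  show (single a (1 : ℝ)).coeff b * (single b 1 * (δ b).val).coeff g =
    ((Pi.single a (single a 1 * (δ a).val) : A → HahnSeries A ℝ) b).coeff g
  by_cases h : b = a
  · subst h
    simp
  · rw [coeff_single_of_ne h, zero_mul, Pi.single_eq_of_ne h, coeff_zero]

theorem monomial_add (a b : A) : monomial (a + b) = monomial a * monomial b :=
  Grid.ext (by
    show single (a + b) (1 : ℝ) = single a 1 * single b 1
    rw [single_mul_single, mul_one])

theorem monomial_zero : monomial (0 : A) = 1 := rfl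

theorem largeToGrid_smulLarge (γ : A) (hγ : γ < 0) (σ : ℝ) :
    largeToGrid (smulLarge γ hγ σ) = σ • monomial γ := by
  refine Grid.ext ?_
  show single γ σ = σ • single γ (1 : ℝ)
  ext g
  by_cases h : g = γ
  · subst h; simp
  · simp [coeff_single_of_ne h]

/-- `(x ^ (-σ))' / x ^ (-σ) = -σ x⁻¹`. -/
def dlogBase : baseGroup →+ Grid baseGroup where
  toFun m := -(baseVal m • monomial (-baseX))
  map_zero' := by rw [map_zero, zero_smul, neg_zero]
  map_add' a b := by rw [map_add, add_smul, neg_add]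

/-- `(x ^ (-σ) * exp (-L))' / (x ^ (-σ) * exp (-L)) = -σ x⁻¹ - L'`. -/
def dlogStep (i : Emb A A.exp) (δ : A →+ Grid A) : A.exp →+ Grid A.exp where
  toFun m := -(spart m • monomial (-expX A) + i.mapGrid (deriv δ (largeToGrid (lpart m))))
  map_zero' := by simp only [map_zero, zero_smul, add_zero, neg_zero]
  map_add' a b := by
    simp only [map_add, add_smul]
    abel

theorem dlogBase_apply (m : baseGroup) : dlogBase m = -(baseVal m • monomial (-baseX)) := rfl

theorem dlogStep_apply (i : Emb A A.exp) (δ : A →+ Grid A) (m : A.exp) : dlogStep i δ m =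
    -(spart m • monomial (-expX A) + i.mapGrid (deriv δ (largeToGrid (lpart m)))) := rfl

theorem dlogBase_X : dlogBase baseX = monomial (-baseX) := by
  rw [dlogBase_apply, show baseVal baseX = -1 from rfl, neg_one_smul, neg_neg]

theorem dlogStep_X (i : Emb A A.exp) (δ : A →+ Grid A) :
    dlogStep i δ (expX A) = monomial (-expX A) := by
  rw [dlogStep_apply, lpart_expX, spart_expX, neg_one_smul]
  simp only [map_zero, add_zero, neg_neg]

theorem deriv_smulLarge (δ : A →+ Grid A) (x : A) (hx : x < 0) (h : δ x = monomial (-x)) (σ : ℝ) :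
    deriv δ (largeToGrid (smulLarge x hx σ)) = σ • 1 := by
  rw [largeToGrid_smulLarge, map_smul, deriv_monomial, h, ← monomial_add, add_neg_cancel,
    monomial_zero]

theorem dlogBase_incl (m : baseGroup) :
    dlogStep baseIncl dlogBase (baseIncl m) = baseIncl.mapGrid (dlogBase m) := by
  rw [baseIncl_apply, dlogStep_apply, dlogBase_apply, lpart_mk, spart_mk]
  simp only [map_zero, add_zero, map_neg, map_smul, Emb.mapGrid_monomial, baseIncl_X]

theorem dlogStep_incl (i : Emb A A.exp) (δ : A →+ Grid A) (δ' : A.exp →+ Grid A.exp)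
    (h : ∀ m, δ' (i m) = i.mapGrid (δ m)) (m : A.exp) :
    dlogStep i.exp δ' (i.exp m) = i.exp.mapGrid (dlogStep i δ m) := by
  have h1 := deriv_mapGrid i δ δ' 1 (fun a => by rw [one_mul, h a])
  rw [Emb.exp_apply, dlogStep_apply, dlogStep_apply, lpart_mk, spart_mk, Emb.toGrid_mapLarge, h1,
    one_mul]
  simp only [map_neg, map_add, map_smul, Emb.mapGrid_monomial, Emb.exp_X]

theorem dlogBase_up (m : baseGroup) : dlogStep baseIncl dlogBase (baseUp m) =
    monomial (baseUp baseX) * baseUp.mapGrid (dlogBase m) := by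
  have h : baseUp m = expMk (smulLarge baseX baseX_neg (baseVal m)) 0 := baseUp_apply m
  rw [h, dlogStep_apply, lpart_mk, spart_mk, deriv_smulLarge _ _ _ dlogBase_X, dlogBase_apply]
  simp only [map_neg, map_smul, Emb.mapGrid_monomial, mul_neg, mul_smul_comm, map_one, zero_smul,
    zero_add]
  rw [← monomial_add, add_neg_cancel, monomial_zero]

theorem dlogStep_up (i : Emb A A.exp) (δ : A →+ Grid A) (δ' : A.exp →+ Grid A.exp)
    (u : Emb A A.exp) (u' : Emb A.exp A.exp.exp) (x : A) (hu)
    (hδ : δ' (expX A) = monomial (-expX A)) (hix : i x = expX A)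
    (hi : ∀ m, u' (i m) = i.exp (u m)) (hu' : u' = upStep u hu)
    (h : ∀ m, δ' (u m) = monomial (u x) * u.mapGrid (δ m)) (m : A.exp) :
    dlogStep i.exp δ' (u' m) = monomial (u' (expX A)) * u'.mapGrid (dlogStep i δ m) := by
  have h1 := deriv_mapGrid u δ δ' _ h
  have h2 : u'.comp i = i.exp.comp u := DFunLike.ext _ _ hi
  have h3 : i.exp.mapGrid (u.mapGrid (deriv δ (largeToGrid (lpart m)))) =
      u'.mapGrid (i.mapGrid (deriv δ (largeToGrid (lpart m)))) := by
    rw [← Emb.mapGrid_comp, ← h2, Emb.mapGrid_comp]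
  have h4 : u' m =
      expMk (smulLarge (expX A) (expX_neg A) (spart m) + u.mapLarge (lpart m)) 0 := by
    rw [hu', upStep_apply]
  rw [h4, dlogStep_apply, dlogStep_apply, lpart_mk, spart_mk]
  simp only [map_add, map_neg, map_smul, map_mul, deriv_smulLarge _ _ _ hδ, Emb.toGrid_mapLarge,
    h1, h3, Emb.mapGrid_monomial, ← hi, hix, map_one, zero_smul, zero_add]
  rw [mul_neg, mul_add, mul_smul_comm, ← monomial_add, add_neg_cancel, monomial_zero]

end Exp

/-- The transmonomials of level at most `n`. `Grid (Mon n)` is the space of log-free transseries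
of level at most `n`.  -/
def Mon : ℕ → OrdGroup
  | 0 => baseGroup
  | n + 1 => (Mon n).exp

/-- The transmonomial `x`. -/
def xMon : ∀ n, Mon n
  | 0 => baseX
  | n + 1 => expX (Mon n)

/-- The natural embedding of level `n` into level `n + 1`. -/
def incl : ∀ n, Emb (Mon n) (Mon (n + 1))
  | 0 => baseIncl
  | n + 1 => (incl n).exp

/-- Right composition with `exp`; no power of `x` is left as a factor. -/
def upAux : ∀ n, {e : Emb (Mon n) (Mon n).exp // ∀ m, spart (e m) = 0}
  | 0 => ⟨baseUp, fun _ => rfl⟩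
  | n + 1 => ⟨upStep (upAux n).1 (upAux n).2, fun _ => rfl⟩

/-- Right composition with `exp`, from level `n` to level `n + 1`. -/
def up (n : ℕ) : Emb (Mon n) (Mon (n + 1)) := (upAux n).1

/-- The logarithmic derivative `m' / m` of a transmonomial `m` of level at most `n`. -/
def dlog : ∀ n, Mon n →+ Grid (Mon n)
  | 0 => dlogBase
  | n + 1 => dlogStep (incl n) (dlog n)

theorem incl_xMon : ∀ n, incl n (xMon n) = xMon (n + 1)
  | 0 => baseIncl_X
  | n + 1 => (incl n).exp_X

theorem up_incl : ∀ n (m : Mon n), up (n + 1) (incl n m) = incl (n + 1) (up n m)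
  | 0 => baseUp_incl fun _ => rfl
  | n + 1 => upStep_incl (incl n) (incl (n + 1)) (up n) (up (n + 1)) (upAux n).2 (upAux (n + 1)).2
      (incl n).exp_X (up_incl n)

theorem dlog_xMon : ∀ n, dlog n (xMon n) = monomial (-xMon n)
  | 0 => dlogBase_X
  | n + 1 => dlogStep_X (incl n) (dlog n)

theorem dlog_incl : ∀ n (m : Mon n), dlog (n + 1) (incl n m) = (incl n).mapGrid (dlog n m)
  | 0 => dlogBase_incl
  | n + 1 => dlogStep_incl (incl n) (dlog n) (dlog (n + 1)) (dlog_incl n)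

theorem dlog_up : ∀ n (m : Mon n), dlog (n + 1) (up n m) =
    monomial (up n (xMon n)) * (up n).mapGrid (dlog n m)
  | 0 => dlogBase_up
  | n + 1 => dlogStep_up (incl n) (dlog n) (dlog (n + 1)) (up n) (up (n + 1)) (xMon n) (upAux n).2
      (dlog_xMon (n + 1)) (incl_xMon n) (up_incl n) rfl (dlog_up n)


/-! ### Increasing unions -/

section SeqLim

variable {A : ℕ → OrdGroup} (f : ∀ n, Emb (A n) (A (n + 1)))

/-- The composed maps `A i → A j`. -/
def seqMap (i j : ℕ) (h : i ≤ j) : Emb (A i) (A j) :=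
  Nat.leRecOn h (fun {k} g => (f k).comp g) (Emb.refl (A i))

theorem seqMap_self (i : ℕ) (a : A i) : seqMap f i i le_rfl a = a := by
  rw [seqMap, Nat.leRecOn_self]; rfl

theorem seqMap_succ (i j : ℕ) (h : i ≤ j) (a : A i) :
    seqMap f i (j + 1) (h.trans j.le_succ) a = f j (seqMap f i j h a) := by
  rw [seqMap, Nat.leRecOn_succ h]; rfl

instance seqMap_directed : DirectedSystem (fun n => A n) (fun i j h => seqMap f i j h) where
  map_self i a := seqMap_self f i a
  map_map k j i hij hjk a := by
    induction k, hjk using Nat.le_induction with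
    | base => exact seqMap_self f j _
    | succ k hk ih => rw [seqMap_succ f j k hk, ih, ← seqMap_succ f i k]

/-- The inductive limit of a chain of ordered groups. -/
def SeqLim : Type := DirectLimit (fun n => A n) (seqMap f)

namespace SeqLim

instance : AddCommGroup (SeqLim f) :=
  inferInstanceAs (AddCommGroup (DirectLimit (fun n => A n) (seqMap f)))

/-- The canonical map of the `n`-th group. -/
def mk (n : ℕ) : A n →+ SeqLim f where
  toFun a := (⟦⟨n, a⟩⟧ : DirectLimit (fun n => A n) (seqMap f))
  map_zero' := (DirectLimit.zero_def (f := seqMap f) n).symm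
  map_add' a b := (DirectLimit.add_def (f := seqMap f) n a b).symm

theorem mk_succ (n : ℕ) (a : A n) : mk f (n + 1) (f n a) = mk f n a := by
  have := DirectLimit.mk_apply (f := seqMap f) n (n + 1) a n.le_succ
  rw [seqMap_succ f n n le_rfl, seqMap_self] at this
  exact this

theorem mk_seqMap (i j : ℕ) (h : i ≤ j) (a : A i) : mk f j (seqMap f i j h a) = mk f i a :=
  DirectLimit.mk_apply (f := seqMap f) (F := fun n => A n) i j a h

theorem mk_injective (n : ℕ) : Function.Injective (mk f n) :=
  DirectLimit.mk_injective (f := seqMap f) (fun i j h => (seqMap f i j h).strictMono.injective) n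

theorem exists_mk (x : SeqLim f) : ∃ n a, x = mk f n a :=
  DirectLimit.exists_eq_mk (seqMap f) x

theorem exists_mk₂ (x y : SeqLim f) : ∃ n a b, x = mk f n a ∧ y = mk f n b :=
  DirectLimit.exists_eq_mk₂ (seqMap f) x y

theorem exists_mk₃ (x y z : SeqLim f) : ∃ n a b c, x = mk f n a ∧ y = mk f n b ∧ z = mk f n c :=
  DirectLimit.exists_eq_mk₃ (seqMap f) x y z

instance : LE (SeqLim f) := ⟨fun x y => ∃ n a b, x = mk f n a ∧ y = mk f n b ∧ a ≤ b⟩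

theorem mk_le_mk (n : ℕ) (a b : A n) : mk f n a ≤ mk f n b ↔ a ≤ b := by
  constructor
  · rintro ⟨m, a', b', ha, hb, h⟩
    rw [← mk_seqMap f n (max n m) (le_max_left _ _),
      ← mk_seqMap f m (max n m) (le_max_right _ _)] at ha hb
    rw [← (seqMap f n (max n m) (le_max_left _ _)).strictMono.le_iff_le, mk_injective f _ ha,
      mk_injective f _ hb]
    exact (seqMap f m (max n m) (le_max_right _ _)).strictMono.monotone h
  · exact fun h => ⟨n, a, b, rfl, rfl, h⟩

instance : LinearOrder (SeqLim f) where
  le_refl x := by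
    obtain ⟨n, a, rfl⟩ := exists_mk f x
    exact (mk_le_mk f n a a).2 le_rfl
  le_trans x y z := by
    obtain ⟨n, a, b, c, rfl, rfl, rfl⟩ := exists_mk₃ f x y z
    simp only [mk_le_mk]
    exact le_trans
  le_antisymm x y := by
    obtain ⟨n, a, b, rfl, rfl⟩ := exists_mk₂ f x y
    simp only [mk_le_mk]
    exact fun h h' => congrArg _ (le_antisymm h h')
  le_total x y := by
    obtain ⟨n, a, b, rfl, rfl⟩ := exists_mk₂ f x y
    simp only [mk_le_mk]
    exact le_total a b
  toDecidableLE := Classical.decRel _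

instance : IsOrderedAddMonoid (SeqLim f) where
  add_le_add_left x y h z := by
    obtain ⟨n, a, b, c, rfl, rfl, rfl⟩ := exists_mk₃ f x y z
    rw [← map_add, ← map_add, mk_le_mk]
    exact add_le_add_left ((mk_le_mk f n a b).1 h) c

theorem mk_strictMono (n : ℕ) : StrictMono (mk f n) := fun a b h =>
  lt_of_le_of_ne ((mk_le_mk f n a b).2 h.le) fun h' => h.ne (mk_injective f n h')

/-- The universal property. -/
def lift {C : Type} [AddCommGroup C] (g : ∀ n, A n →+ C) (hg : ∀ n a, g (n + 1) (f n a) = g n a) :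
    SeqLim f →+ C :=
  have hg' : ∀ i j h (a : A i), g i a = g j (seqMap f i j h a) := fun i j h a => by
    induction j, h using Nat.le_induction with
    | base => rw [seqMap_self]
    | succ k hk ih => rw [seqMap_succ f i k hk, hg, ih]
  { toFun := DirectLimit.lift (seqMap f) (fun n a => g n a) hg'
    map_zero' := by
      rw [← map_zero (mk f 0)]
      exact map_zero (g 0)
    map_add' := fun x y => by
      obtain ⟨n, a, b, rfl, rfl⟩ := exists_mk₂ f x y
      rw [← map_add]
      exact map_add (g n) a b }

theorem lift_mk {C : Type} [AddCommGroup C] (g : ∀ n, A n →+ C) (hg) (n : ℕ) (a : A n) :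
    lift f g hg (mk f n a) = g n a := rfl

end SeqLim

/-- The inductive limit of a chain of ordered groups, as an ordered group. -/
def seqLim : OrdGroup := ⟨SeqLim f⟩

/-- The canonical embedding of the `n`-th group. -/
def toSeqLim (n : ℕ) : Emb (A n) (seqLim f) := ⟨SeqLim.mk f n, SeqLim.mk_strictMono f n⟩

theorem toSeqLim_succ (n : ℕ) (a : A n) : toSeqLim f (n + 1) (f n a) = toSeqLim f n a :=
  SeqLim.mk_succ f n a

theorem exists_toSeqLim (x : seqLim f) : ∃ n a, x = toSeqLim f n a := SeqLim.exists_mk f x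

/-- The universal property. -/
def seqLimLift {C : Type} [AddCommGroup C] (g : ∀ n, A n →+ C)
    (hg : ∀ n a, g (n + 1) (f n a) = g n a) : seqLim f →+ C := SeqLim.lift f g hg

theorem seqLimLift_mk {C : Type} [AddCommGroup C] (g : ∀ n, A n →+ C) (hg) (n : ℕ) (a : A n) :
    seqLimLift f g hg (toSeqLim f n a) = g n a := rfl

end SeqLim

/-! ### Log-free transseries -/

/-- The log-free transmonomials: the union of all levels. -/
def LogFree : OrdGroup := seqLim incl

/-- A transmonomial of level at most `n` as a log-free transmonomial. -/
def ofLevel (n : ℕ) : Emb (Mon n) LogFree := toSeqLim incl n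

theorem ofLevel_succ (n : ℕ) (m : Mon n) : ofLevel (n + 1) (incl n m) = ofLevel n m :=
  toSeqLim_succ incl n m

theorem ofLevel_succ' (n : ℕ) : (ofLevel (n + 1)).comp (incl n) = ofLevel n :=
  DFunLike.ext _ _ (ofLevel_succ n)

/-- The transmonomial `x`. -/
def logFreeX : LogFree := ofLevel 0 (xMon 0)

theorem ofLevel_xMon (n : ℕ) : ofLevel n (xMon n) = logFreeX := by
  induction n with
  | zero => rfl
  | succ n ih => rw [← incl_xMon, ofLevel_succ, ih]

/-- Right composition with `exp`, as a homomorphism. -/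
def logFreeUpHom : LogFree →+ LogFree :=
  seqLimLift incl (fun n => (ofLevel (n + 1)).toAddMonoidHom.comp (up n).toAddMonoidHom)
    fun n m => by
      show ofLevel (n + 2) (up (n + 1) (incl n m)) = ofLevel (n + 1) (up n m)
      rw [up_incl]
      exact ofLevel_succ (n + 1) _

theorem logFreeUpHom_ofLevel (n : ℕ) (m : Mon n) :
    logFreeUpHom (ofLevel n m) = ofLevel (n + 1) (up n m) := rfl

/-- Right composition with `exp` on log-free transmonomials. -/
def logFreeUp : Emb LogFree LogFree :=
  Emb.ofPos logFreeUpHom fun x hx => by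
    obtain ⟨n, m, rfl⟩ := exists_toSeqLim incl x
    have hm : 0 < m := by
      rw [← (toSeqLim incl n).strictMono.lt_iff_lt, map_zero]
      exact hx
    have := ((ofLevel (n + 1)).comp (up n)).strictMono hm
    rw [map_zero] at this
    exact this

theorem logFreeUp_ofLevel (n : ℕ) (m : Mon n) :
    logFreeUp (ofLevel n m) = ofLevel (n + 1) (up n m) := rfl

/-- The logarithmic derivative of a log-free transmonomial. -/
def dlogLogFree : LogFree →+ Grid LogFree :=
  seqLimLift incl
    (fun n => ((ofLevel n).mapGrid : Grid (Mon n) →+ Grid LogFree).comp (dlog n))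
    fun n m => by
      show (ofLevel (n + 1)).mapGrid (dlog (n + 1) (incl n m)) = (ofLevel n).mapGrid (dlog n m)
      rw [dlog_incl, ← Emb.mapGrid_comp, ofLevel_succ']

theorem dlogLogFree_ofLevel (n : ℕ) (m : Mon n) :
    dlogLogFree (ofLevel n m) = (ofLevel n).mapGrid (dlog n m) := rfl

theorem dlogLogFree_up (m : LogFree) : dlogLogFree (logFreeUp m) =
    monomial (logFreeUp logFreeX) * logFreeUp.mapGrid (dlogLogFree m) := by
  obtain ⟨n, m, rfl⟩ := exists_toSeqLim incl m
  have h : logFreeUp.comp (ofLevel n) = (ofLevel (n + 1)).comp (up n) :=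
    DFunLike.ext _ _ (logFreeUp_ofLevel n)
  show dlogLogFree (logFreeUp (ofLevel n m)) =
    _ * logFreeUp.mapGrid (dlogLogFree (ofLevel n m))
  rw [logFreeUp_ofLevel, dlogLogFree_ofLevel, dlogLogFree_ofLevel, dlog_up, map_mul,
    ← Emb.mapGrid_comp, ← Emb.mapGrid_comp, h, Emb.mapGrid_monomial, ← logFreeUp_ofLevel,
    ofLevel_xMon]

/-! ### General transseries -/

/-- The general transmonomials `m ∘ L_k`, `m` log-free and `L_k` the `k`-times iterated logarithm,
where `m ∘ L_k` is identified with `(m ∘ exp) ∘ L_{k+1}`.  -/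
def MonGroup : OrdGroup := seqLim (A := fun _ => LogFree) fun _ => logFreeUp

/-- `m ↦ m ∘ L_k`. -/
def compLog (k : ℕ) : Emb LogFree MonGroup := toSeqLim (A := fun _ => LogFree) (fun _ => logFreeUp) k

theorem compLog_succ (k : ℕ) (m : LogFree) : compLog (k + 1) (logFreeUp m) = compLog k m :=
  toSeqLim_succ (A := fun _ => LogFree) (fun _ => logFreeUp) k m

/-- The transmonomial `L_k`; in particular `L_0 = x`. -/
def logMon (k : ℕ) : MonGroup := compLog k logFreeX

/-- The logarithmic derivative
`(m ∘ L_k)' / (m ∘ L_k) = (L_0 L_1 ⋯ L_{k-1})⁻¹ * (m' / m) ∘ L_k`.  -/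
def dlogMon : MonGroup →+ Grid MonGroup :=
  seqLimLift (A := fun _ => LogFree) (fun _ => logFreeUp)
    (fun k => (AddMonoidHom.mulLeft (monomial (-∑ j ∈ Finset.range k, logMon j))).comp
      (((compLog k).mapGrid : Grid LogFree →+ Grid MonGroup).comp dlogLogFree))
    fun k m => by
      have h : (compLog (k + 1)).comp logFreeUp = compLog k :=
        DFunLike.ext _ _ (compLog_succ k)
      show monomial (-∑ j ∈ Finset.range (k + 1), logMon j) *
          (compLog (k + 1)).mapGrid (dlogLogFree (logFreeUp m)) =
        monomial (-∑ j ∈ Finset.range k, logMon j) * (compLog k).mapGrid (dlogLogFree m)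
      rw [dlogLogFree_up, map_mul, ← Emb.mapGrid_comp, h, Emb.mapGrid_monomial, compLog_succ,
        ← mul_assoc, ← monomial_add, Finset.sum_range_succ, neg_add, add_assoc, logMon,
        neg_add_cancel, add_zero]

/-- The algebra of general transseries. -/
abbrev TSeries : Type := Grid MonGroup

/-- Differentiation of transseries. -/
def D : TSeries →ₗ[ℝ] TSeries := deriv dlogMon

theorem exists_toSeqLim_fin {A : ℕ → OrdGroup} (f : ∀ n, Emb (A n) (A (n + 1))) {M : ℕ}
    (μ : Fin M → seqLim f) : ∃ n, ∃ a : Fin M → A n, ∀ i, μ i = toSeqLim f n (a i) := by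
  choose n a h using fun i => exists_toSeqLim f (μ i)
  have hn : ∀ i, n i ≤ Finset.univ.sup n := fun i => Finset.le_sup (Finset.mem_univ i)
  refine ⟨Finset.univ.sup n, fun i => seqMap f (n i) _ (hn i) (a i), fun i => ?_⟩
  rw [h i]
  exact (SeqLim.mk_seqMap f _ _ (hn i) (a i)).symm

theorem exists_mapGrid_toSeqLim {A : ℕ → OrdGroup} (f : ∀ n, Emb (A n) (A (n + 1)))
    (s : Grid (seqLim f)) : ∃ n, ∃ t : Grid (A n), s = (toSeqLim f n).mapGrid t := by
  obtain ⟨M, μ, k₀, hμ, hs⟩ := s.isGrid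
  obtain ⟨n, a, ha⟩ := exists_toSeqLim_fin f μ
  obtain rfl : μ = fun i => toSeqLim f n (a i) := funext ha
  let e := toSeqLim f n
  have hgrid : IsGrid (Function.support fun m : A n => s.val.coeff (e m)) := by
    refine ⟨M, a, k₀, fun i => ?_, fun m hm => ?_⟩
    · rw [← e.strictMono.lt_iff_lt, map_zero]
      exact hμ i
    · obtain ⟨k, hk, h⟩ := hs (e m) hm
      refine ⟨k, hk, e.strictMono.injective ?_⟩
      rw [h, map_sum]
      simp only [map_zsmul, e]
  let t : HahnSeries (A n) ℝ := ⟨fun m => s.val.coeff (e m), hgrid.isPWO⟩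
  refine ⟨n, Grid.mk t hgrid, Grid.ext ?_⟩
  ext γ
  rw [Emb.val_mapGrid]
  by_cases hγ : γ ∈ Set.range e
  · obtain ⟨m, rfl⟩ := hγ
    exact (e.mapAlg_coeff t m).symm
  · rw [show ((toSeqLim f n).mapAlg (Grid.mk t hgrid).val).coeff γ = 0 from
      e.mapAlg_coeff_of_notMem t hγ]
    by_contra h0
    obtain ⟨k, -, h⟩ := hs γ h0
    refine hγ ⟨∑ i, k i • a i, ?_⟩
    rw [h, map_sum]
    simp only [map_zsmul, e]

/-- The log-free transseries `f` of level at most `n` as a transseries. -/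
def ofLevelSeries (n : ℕ) : Grid (Mon n) →ₐ[ℝ] TSeries :=
  ((compLog 0).comp (ofLevel n)).mapGrid

/-- Differentiation of log-free transseries of level at most `n`. -/
def levelD (n : ℕ) : Grid (Mon n) →ₗ[ℝ] Grid (Mon n) := deriv (dlog n)

theorem D_ofLevelSeries (n : ℕ) (f : Grid (Mon n)) :
    D (ofLevelSeries n f) = ofLevelSeries n (levelD n f) := by
  have h := deriv_mapGrid ((compLog 0).comp (ofLevel n)) (dlog n) dlogMon 1 (fun m => ?_) f
  · rw [one_mul] at h
    exact h
  · rw [Emb.mapGrid_comp]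
    show monomial (-∑ j ∈ Finset.range 0, logMon j) *
      (compLog 0).mapGrid ((ofLevel n).mapGrid (dlog n m)) = _
    rw [Finset.sum_range_zero, neg_zero]
    rfl

/-- A linear operator `J` is asymptotically contractive: any finitely many small transmonomials can
be completed to finitely many small transmonomials `μ₁, …, μ_M` such that, with
`μ^j = ∏ μᵢ ^ jᵢ` for `j ∈ ℤ^M`, every `J (μ^j)` has the form `∑_{p > 0} c_{j,p} μ^{j + p}`
(`p ∈ ℕ^M`, `p ≠ 0`); and `J` acts term by term, that is, for every `f = ∑ f_m m` and every
transmonomial `γ`, the coefficient of `γ` in `J f` is the sum, with finitely many nonzero terms, of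
the coefficients of `γ` in the series `f_m J m`.  -/
def IsContractive {A : OrdGroup} (J : Grid A →ₗ[ℝ] Grid A) : Prop :=
  (∀ (N : ℕ) (ν : Fin N → A), (∀ i, 0 < ν i) →
    ∃ (M : ℕ) (μ : Fin M → A), (∀ i, 0 < μ i) ∧ Set.range ν ⊆ Set.range μ ∧
      ∀ j : Fin M → ℤ, ∀ γ ∈ (J (monomial (∑ i, j i • μ i))).val.support,
        ∃ p : Fin M → ℕ, p ≠ 0 ∧ γ = ∑ i, (j i + p i) • μ i) ∧
  ∀ (f : Grid A) (γ : A),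
    (Function.support fun m => f.val.coeff m * (J (monomial m)).val.coeff γ).Finite ∧
    (J f).val.coeff γ = ∑ᶠ m, f.val.coeff m * (J (monomial m)).val.coeff γ

/-- Every transseries is `f ∘ L_k` for a log-free transseries `f` of some finite level `n`. -/
theorem exists_eq_comp_log (S : TSeries) : ∃ (k n : ℕ) (f : Grid (Mon n)),
    S = ((compLog k).comp (ofLevel n)).mapGrid f := by
  obtain ⟨k, t, rfl⟩ := exists_mapGrid_toSeqLim (A := fun _ => LogFree) (fun _ => logFreeUp) S
  obtain ⟨n, f, rfl⟩ := exists_mapGrid_toSeqLim incl t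
  exact ⟨k, n, f, (Emb.mapGrid_comp _ _ f).symm⟩

/-- `S ≫ T`: the dominant transmonomial of `S` is larger than that of `T` (which is `0` if
`T = 0`). -/
def Dominates (S T : TSeries) : Prop := S.val.orderTop < T.val.orderTop

/-- `T > 0`: the coefficient of the dominant term is positive. -/
def Pos (T : TSeries) : Prop := 0 < T.val.leadingCoeff

/-- All transmonomials of `T` are `≫ 1`. -/
def IsLarge (T : TSeries) : Prop := ∀ γ ∈ T.val.support, γ < 0

/-- All transmonomials of `T` are `≪ 1`. -/
def IsSmall (T : TSeries) : Prop := ∀ γ ∈ T.val.support, 0 < γ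

/-- `T` has no constant term: it is the sum of a large and a small transseries. -/
def NoConst (T : TSeries) : Prop := ∃ L s, IsLarge L ∧ IsSmall s ∧ T = L + s

/-- `T` without its constant term. -/
def dropConst (T : TSeries) : TSeries := T - algebraMap ℝ TSeries (T.val.coeff 0)

/-- The transseries `1 / x`. -/
def xInv : TSeries := monomial (-logMon 0)

/-- The transmonomial `exp (-L)`, for a large log-free transseries `L` of level at most `n`. -/
def expNeg (n : ℕ) (L : Large (Mon n)) : TSeries :=
  monomial (compLog 0 (ofLevel (n + 1) (expMk L 0 : (Mon n).exp)))

end Transseries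

end

noncomputable section

namespace Transseries

open HahnSeries

/-! ### Coefficients and term by term operators -/

section Termwise

variable {Γ : Type} [AddCommGroup Γ] [LinearOrder Γ] [IsOrderedAddMonoid Γ]

/-! Write `ψ m` for the exponent of the dominant monomial of `m'/m` (`dord`). Everything about
order, sign and uniqueness follows from one fact: on nonzero exponents `m ↦ m + ψ m`, the exponent
of `m'`, is strictly increasing (`IsAsym.add_dord_lt`). Hence the dominant term of a series without
constant term determines the dominant term of its derivative. So `D` is injective on such series,
preserves and reflects `≫`, and changes the sign of the dominant coefficient according to whether
the dominant monomial is large or small. The monotonicity comes from the inequality `ψ b < a + ψ a`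
for `a > 0`, `b ≠ 0`. On each log-free level it is proved by separating the two sides by `1/x`, by
induction on the level (`levelAsym`), and it survives composition with logarithms.

Surjectivity of `D` is the harder half. On a fixed level consider `x d/dx`, for which the
logarithmic derivative of every `m ≠ 1` is at least of size `1`. If `c v` is the dominant term of
this logarithmic derivative, then `m / (c v)` is a primitive of `m` up to smaller terms. Iterating
this correction is a fixed point problem whose kernel strictly raises exponents, solved by
well-founded recursion. The solution is again grid-based because the work stays inside a finitely
generated group `Λ` of monomials that is stable under logarithmic differentiation (`dlogClosable`),
on which `v` takes only finitely many values (`finite_dord`), so that all corrections lie in one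
grid. The monomial `1` is the only obstruction: it leaves a multiple of `1/x`, whose primitive is
the next logarithm (`exists_D_eq`).

For `e^{-L}` with `L` of exact level `n + 1`, the dominant monomial of `L` exceeds all monomials of
level `n`, whereas logarithmic derivatives of level `n + 1` have dominant monomials of level `n`.
Thus `L'` dominates all of them, so `f ↦ f'/L' - (L''/(L')²) f` strictly raises exponents and is
contractive. Its fixed point `Δ` is exactly what makes `-e^{-L}(1 + Δ)/L'` a primitive. -/

@[simp] theorem Grid.val_add (f g : Grid Γ) : (f + g).val = f.val + g.val := rfl
@[simp] theorem Grid.val_sub (f g : Grid Γ) : (f - g).val = f.val - g.val := rfl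
@[simp] theorem Grid.val_neg (f : Grid Γ) : (-f).val = -f.val := rfl
@[simp] theorem Grid.val_mul (f g : Grid Γ) : (f * g).val = f.val * g.val := rfl
@[simp] theorem Grid.val_smul (r : ℝ) (f : Grid Γ) : (r • f).val = r • f.val := rfl
@[simp] theorem Grid.val_zero : (0 : Grid Γ).val = 0 := rfl
@[simp] theorem Grid.val_one : (1 : Grid Γ).val = 1 := rfl
@[simp] theorem Grid.val_mk (f : HahnSeries Γ ℝ) (hf : IsGrid f.support) :
    (Grid.mk f hf).val = f := rfl
@[simp] theorem val_monomial (γ : Γ) : (monomial γ).val = single γ 1 := rfl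

theorem Grid.val_algebraMap (r : ℝ) : (algebraMap ℝ (Grid Γ) r).val = single 0 r := by
  rw [Algebra.algebraMap_eq_smul_one]
  show r • (1 : HahnSeries Γ ℝ) = single 0 r
  ext γ
  rcases eq_or_ne γ 0 with rfl | h
  · simp
  · simp [h, coeff_one]

theorem Grid.val_eq_zero {f : Grid Γ} : f.val = 0 ↔ f = 0 :=
  ⟨fun h => Grid.ext h, fun h => by rw [h]; rfl⟩

theorem Grid.val_ne_zero {f : Grid Γ} : f.val ≠ 0 ↔ f ≠ 0 := Grid.val_eq_zero.not

theorem coeff_monomial_mul (γ τ : Γ) (f : Grid Γ) :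
    (monomial γ * f).val.coeff τ = f.val.coeff (τ - γ) := by
  rw [Grid.val_mul, val_monomial, coeff_single_mul, one_mul]

theorem support_monomial_mul {γ τ : Γ} {f : Grid Γ} :
    τ ∈ (monomial γ * f).val.support ↔ τ - γ ∈ f.val.support := by
  rw [mem_support, mem_support, coeff_monomial_mul]

/-- The family of the terms of a series. -/
def termFamily (f : HahnSeries Γ ℝ) : SummableFamily Γ ℝ Γ where
  toFun m := single m (f.coeff m)
  isPWO_iUnion_support' := by
    refine f.isPWO_support.mono (Set.iUnion_subset fun m γ hγ => ?_)
    obtain rfl := eq_of_mem_support_single hγ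
    rw [mem_support, coeff_single_same] at hγ
    exact hγ
  finite_co_support' g := (Set.finite_singleton g).subset fun m hm => by
    by_contra h
    exact hm (coeff_single_of_ne (Ne.symm h))

theorem termFamily_apply (f : HahnSeries Γ ℝ) (m : Γ) :
    termFamily f m = single m (f.coeff m) := rfl

theorem hsum_termFamily (f : HahnSeries Γ ℝ) : (termFamily f).hsum = f := by
  ext g
  rw [SummableFamily.coeff_hsum, finsum_eq_single _ g, termFamily_apply, coeff_single_same]
  intro m hm
  exact coeff_single_of_ne hm.symm

theorem coeff_derivFamily (δ : Γ →+ Grid Γ) (f : Grid Γ) (m τ : Γ) :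
    (derivFamily δ f m).coeff τ = f.val.coeff m * (δ m).val.coeff (τ - m) := by
  show (f.val.coeff m • (single m 1 * (δ m).val)).coeff τ = _
  rw [coeff_smul, coeff_single_mul, one_mul, smul_eq_mul]

theorem deriv_coeff_finite (δ : Γ →+ Grid Γ) (f : Grid Γ) (τ : Γ) :
    (Function.support fun m => f.val.coeff m * (δ m).val.coeff (τ - m)).Finite := by
  have : {m | (derivFamily δ f m).coeff τ ≠ 0}.Finite := (derivFamily δ f).finite_co_support τ
  simp only [coeff_derivFamily] at this
  exact this

theorem deriv_coeff (δ : Γ →+ Grid Γ) (f : Grid Γ) (τ : Γ) :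
    (deriv δ f).val.coeff τ = ∑ᶠ m, f.val.coeff m * (δ m).val.coeff (τ - m) := by
  show (derivFamily δ f).hsum.coeff τ = _
  rw [SummableFamily.coeff_hsum]
  exact finsum_congr fun m => coeff_derivFamily δ f m τ

/-- A linear operator acts term by term. -/
def IsTermwise (J : Grid Γ →ₗ[ℝ] Grid Γ) : Prop :=
  ∀ f, ∃ s : SummableFamily Γ ℝ Γ, (∀ m, s m = f.val.coeff m • (J (monomial m)).val) ∧
    s.hsum = (J f).val

theorem IsTermwise.coeff {J : Grid Γ →ₗ[ℝ] Grid Γ} (hJ : IsTermwise J) (f : Grid Γ) (γ : Γ) :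
    (Function.support fun m => f.val.coeff m * (J (monomial m)).val.coeff γ).Finite ∧
    (J f).val.coeff γ = ∑ᶠ m, f.val.coeff m * (J (monomial m)).val.coeff γ := by
  obtain ⟨s, hs, h⟩ := hJ f
  constructor
  · have : {m | (s m).coeff γ ≠ 0}.Finite := s.finite_co_support γ
    simp only [hs, coeff_smul, smul_eq_mul] at this
    exact this
  · rw [← h, SummableFamily.coeff_hsum]
    exact finsum_congr fun m => by rw [hs, coeff_smul, smul_eq_mul]

theorem isTermwise_id : IsTermwise (LinearMap.id : Grid Γ →ₗ[ℝ] Grid Γ) := fun f =>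
  ⟨termFamily f.val, fun m => by
    rw [termFamily_apply, LinearMap.id_apply, val_monomial]
    ext g
    rw [coeff_smul, coeff_single, coeff_single]
    split_ifs <;> simp,
    hsum_termFamily f.val⟩

theorem IsTermwise.mul_left {J : Grid Γ →ₗ[ℝ] Grid Γ} (hJ : IsTermwise J) (a : Grid Γ) :
    IsTermwise ((LinearMap.mulLeft ℝ a).comp J) := fun f => by
  obtain ⟨s, hs, h⟩ := hJ f
  refine ⟨a.val • s, fun m => ?_, ?_⟩
  · rw [SummableFamily.smul_apply, hs, LinearMap.comp_apply, LinearMap.mulLeft_apply,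
      Grid.val_mul]
    show a.val * _ = _
    rw [← C_mul_eq_smul, ← C_mul_eq_smul, mul_left_comm]
  · rw [SummableFamily.hsum_smul, h]
    rfl

theorem IsTermwise.sub {J K : Grid Γ →ₗ[ℝ] Grid Γ} (hJ : IsTermwise J) (hK : IsTermwise K) :
    IsTermwise (J - K) := fun f => by
  obtain ⟨s, hs, h⟩ := hJ f
  obtain ⟨t, ht, h'⟩ := hK f
  refine ⟨s - t, fun m => ?_, ?_⟩
  · rw [SummableFamily.sub_apply, hs, ht, LinearMap.sub_apply, Grid.val_sub, smul_sub]
  · rw [SummableFamily.hsum_sub, h, h', LinearMap.sub_apply, Grid.val_sub]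

end Termwise

/-! ### The Leibniz rule for term by term derivations -/

section Leibniz

variable {A : OrdGroup}

theorem isTermwise_deriv (δ : A →+ Grid A) : IsTermwise (deriv δ) := fun f =>
  ⟨derivFamily δ f, fun m => by rw [deriv_monomial]; rfl, rfl⟩

/-- On a pair of monomials the product rule is the additivity of `δ`. The rest is a rearrangement of
a summable family indexed by pairs of monomials. -/
theorem deriv_mul (δ : A →+ Grid A) (f g : Grid A) :
    deriv δ (f * g) = deriv δ f * g + f * deriv δ g := by
  apply Grid.ext
  let F := (derivFamily δ f).mul (termFamily g.val) + (termFamily f.val).mul (derivFamily δ g)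
  have hF : F.hsum = (deriv δ f * g + f * deriv δ g).val := by
    rw [SummableFamily.hsum_add, SummableFamily.hsum_mul, SummableFamily.hsum_mul,
      hsum_termFamily, hsum_termFamily]
    rfl
  rw [← hF]
  have hFc : ∀ z τ, (F z).coeff τ =
      f.val.coeff z.1 * g.val.coeff z.2 * (δ (z.1 + z.2)).val.coeff (τ - (z.1 + z.2)) := by
    intro z τ
    show ((derivFamily δ f z.1) * (termFamily g.val z.2) +
      (termFamily f.val z.1) * (derivFamily δ g z.2)).coeff τ = _
    rw [coeff_add, termFamily_apply, termFamily_apply, coeff_mul_single, coeff_single_mul,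
      coeff_derivFamily, coeff_derivFamily, map_add, Grid.val_add, coeff_add, sub_add_eq_sub_sub,
      sub_right_comm τ z.1 z.2]
    ring
  ext τ
  rw [deriv_coeff, SummableFamily.coeff_hsum]
  have hfin : {z | (F z).coeff τ ≠ 0}.Finite := F.finite_co_support τ
  set Z := hfin.toFinset with hZ
  rw [finsum_eq_sum_of_support_subset (s := Z) _ (by
      intro z hz
      rw [hZ, Set.Finite.coe_toFinset]
      exact hz),
    ← Finset.sum_fiberwise_of_maps_to (t := Z.image fun z => z.1 + z.2)
      (g := fun z => z.1 + z.2) fun z hz => Finset.mem_image_of_mem _ hz]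
  -- Collecting the pairs according to their product monomial `m` turns the double sum into the
  -- derivative of `f * g`.
  have key : ∀ m, (f * g).val.coeff m * (δ m).val.coeff (τ - m) =
      ∑ z ∈ Z with z.1 + z.2 = m, (F z).coeff τ := by
    intro m
    have h1 : ∑ z ∈ Z with z.1 + z.2 = m, (F z).coeff τ =
        (∑ z ∈ Z with z.1 + z.2 = m, f.val.coeff z.1 * g.val.coeff z.2) *
          (δ m).val.coeff (τ - m) := by
      rw [Finset.sum_mul]
      refine Finset.sum_congr rfl fun z hz => ?_
      rw [hFc, (Finset.mem_filter.1 hz).2]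
    rw [h1]
    -- `Z` omits the pairs whose term vanishes at `τ`. If the common weight is nonzero, the filtered
    -- set is exactly the antidiagonal over the two supports; otherwise both sides are zero.
    by_cases h0 : (δ m).val.coeff (τ - m) = 0
    · rw [h0, mul_zero, mul_zero]
    · congr 1
      rw [Grid.val_mul, coeff_mul]
      refine Finset.sum_congr ?_ fun _ _ => rfl
      ext z
      simp only [Finset.mem_antidiagonal, Finset.mem_filter, hZ, Set.Finite.mem_toFinset,
        hFc, mem_support]
      constructor
      · rintro ⟨ha, hb, rfl⟩
        exact ⟨mul_ne_zero (mul_ne_zero ha hb) h0, rfl⟩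
      · rintro ⟨h, rfl⟩
        exact ⟨left_ne_zero_of_mul (left_ne_zero_of_mul h),
          right_ne_zero_of_mul (left_ne_zero_of_mul h), rfl⟩
  simp only [key]
  refine finsum_eq_sum_of_support_subset _ fun m hm => ?_
  obtain ⟨z, hz, -⟩ := Finset.exists_ne_zero_of_sum_ne_zero hm
  exact Finset.mem_coe.2 (Finset.mem_image.2
    ⟨z, (Finset.mem_filter.1 hz).1, (Finset.mem_filter.1 hz).2⟩)

theorem deriv_one (δ : A →+ Grid A) : deriv δ 1 = 0 := by
  rw [← monomial_zero, deriv_monomial, map_zero, mul_zero]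

theorem deriv_algebraMap (δ : A →+ Grid A) (r : ℝ) : deriv δ (algebraMap ℝ (Grid A) r) = 0 := by
  rw [Algebra.algebraMap_eq_smul_one, map_smul, deriv_one, smul_zero]

/-- A bound for the support of a derivative. -/
theorem support_deriv {δ : A →+ Grid A} {f : Grid A} {τ : A}
    (h : τ ∈ (deriv δ f).val.support) :
    ∃ m ∈ f.val.support, τ - m ∈ (δ m).val.support := by
  rw [mem_support, deriv_coeff] at h
  obtain ⟨m, hm⟩ : ∃ m, f.val.coeff m * (δ m).val.coeff (τ - m) ≠ 0 := by
    by_contra! h'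
    exact h (finsum_eq_zero_of_forall_eq_zero h')
  exact ⟨m, left_ne_zero_of_mul hm, right_ne_zero_of_mul hm⟩

end Leibniz

/-! ### Constant terms -/

theorem coeff_dropConst (T : TSeries) (γ : MonGroup) :
    (dropConst T).val.coeff γ = if γ = 0 then 0 else T.val.coeff γ := by
  rw [dropConst, Grid.val_sub, coeff_sub, Grid.val_algebraMap]
  split_ifs with h
  · rw [h, coeff_single_same, sub_self]
  · rw [coeff_single_of_ne h, sub_zero]

/-- The large part is the truncation to exponents below `0`; its support is part of that of `T`, so
it is still a grid. -/
theorem noConst_iff {T : TSeries} : NoConst T ↔ T.val.coeff 0 = 0 := by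
  constructor
  · rintro ⟨L, s, hL, hs, rfl⟩
    have h1 : L.val.coeff 0 = 0 := by
      by_contra h
      exact lt_irrefl _ (hL 0 h)
    have h2 : s.val.coeff 0 = 0 := by
      by_contra h
      exact lt_irrefl _ (hs 0 h)
    rw [Grid.val_add, coeff_add, h1, h2, add_zero]
  · intro h
    classical
    let l : HahnSeries MonGroup ℝ := truncLT 0 T.val
    have hl : l.support ⊆ T.val.support := by
      intro γ hγ
      rw [mem_support] at hγ ⊢
      simp only [l, HahnSeries.coeff_truncLT] at hγ
      split_ifs at hγ with h0
      · exact hγ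
      · exact absurd rfl hγ
    have hl0 : ∀ γ, l.coeff γ = if γ < 0 then T.val.coeff γ else 0 := fun γ => by
      simp [l, HahnSeries.coeff_truncLT]
    refine ⟨Grid.mk l (T.isGrid.subset hl), T - Grid.mk l (T.isGrid.subset hl), ?_, ?_, ?_⟩
    · intro γ hγ
      by_contra h0
      exact hγ (by rw [Grid.val_mk, hl0, if_neg h0])
    · intro γ hγ
      rw [mem_support, Grid.val_sub, Grid.val_mk, coeff_sub, hl0] at hγ
      split_ifs at hγ with h0
      · simp at hγ
      · refine lt_of_le_of_ne (not_lt.1 h0) ?_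
        rintro rfl
        simp [h] at hγ
    · abel

theorem noConst_dropConst (T : TSeries) : NoConst (dropConst T) := by
  rw [noConst_iff, coeff_dropConst, if_pos rfl]

theorem D_dropConst (T : TSeries) : D (dropConst T) = D T := by
  rw [dropConst, map_sub, D, deriv_algebraMap, sub_zero]

/-! ### Asymptotic couples -/

section Asymptotic

variable {A B : OrdGroup}

/-- The exponent of the dominant transmonomial of the logarithmic derivative of `m`. -/
def dord (δ : A →+ Grid A) (m : A) : A := (δ m).val.order

/-- The asymptotic properties of a logarithmic derivative. -/
structure IsAsym (δ : A →+ Grid A) : Prop where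
  leadingCoeff_neg : ∀ m, 0 < m → (δ m).val.leadingCoeff < 0
  dord_lt : ∀ a b, 0 < a → b ≠ 0 → dord δ b < a + dord δ a

theorem dord_neg (δ : A →+ Grid A) (m : A) : dord δ (-m) = dord δ m := by
  rw [dord, map_neg, Grid.val_neg, order_neg, dord]

theorem leadingCoeff_dlog_neg (δ : A →+ Grid A) (m : A) :
    (δ (-m)).val.leadingCoeff = -(δ m).val.leadingCoeff := by
  rw [map_neg, Grid.val_neg, leadingCoeff_neg]

theorem val_ne_zero_of_leadingCoeff_neg {δ : A →+ Grid A}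
    (h : ∀ m, 0 < m → (δ m).val.leadingCoeff < 0) {m : A} (hm : m ≠ 0) : (δ m).val ≠ 0 := by
  rcases lt_or_gt_of_ne hm with h0 | h0
  · have := h (-m) (neg_pos.2 h0)
    rw [leadingCoeff_dlog_neg] at this
    rw [← leadingCoeff_ne_zero]
    intro h1
    simp [h1] at this
  · exact leadingCoeff_ne_zero.1 (h m h0).ne

namespace IsAsym

variable {δ : A →+ Grid A}

theorem val_ne_zero (hδ : IsAsym δ) {m : A} (hm : m ≠ 0) : (δ m).val ≠ 0 :=
  val_ne_zero_of_leadingCoeff_neg hδ.leadingCoeff_neg hm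

theorem leadingCoeff_pos (hδ : IsAsym δ) {m : A} (hm : m < 0) :
    0 < (δ m).val.leadingCoeff := by
  have := hδ.leadingCoeff_neg (-m) (neg_pos.2 hm)
  rw [leadingCoeff_dlog_neg] at this
  linarith

theorem min_dord_le (hδ : IsAsym δ) {a b : A} (hab : a + b ≠ 0) :
    min (dord δ a) (dord δ b) ≤ dord δ (a + b) := by
  have h := hδ.val_ne_zero hab
  rw [map_add, Grid.val_add] at h
  rw [dord, dord, dord, map_add, Grid.val_add]
  exact min_order_le_order_add h

/-- Only `ψ b < ψ a` needs work. Then the valuation inequality for `b = a + (b - a)` forces `ψ (b -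
a) ≤ ψ b`, and the axiom `ψ a < (b - a) + ψ (b - a)` closes the gap. -/
theorem add_dord_lt (hδ : IsAsym δ) {a b : A} (ha : a ≠ 0) (hb : b ≠ 0) (hab : a < b) :
    a + dord δ a < b + dord δ b := by
  rcases le_or_gt (dord δ a) (dord δ b) with h | h
  · exact add_lt_add_of_lt_of_le hab h
  · have h1 := hδ.min_dord_le (a := a) (b := b - a) (by rwa [add_sub_cancel])
    rw [add_sub_cancel] at h1
    have h2 : dord δ (b - a) ≤ dord δ b := by
      rcases min_le_iff.1 h1 with h2 | h2
      · exact absurd h2 (not_le.2 h)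
      · exact h2
    have h3 := hδ.dord_lt (b - a) a (sub_pos.2 hab) ha
    calc a + dord δ a < a + (b - a + dord δ (b - a)) := add_lt_add_right h3 a
      _ = b + dord δ (b - a) := by abel
      _ ≤ b + dord δ b := add_le_add_right h2 b

theorem add_dord_lt_iff (hδ : IsAsym δ) {a b : A} (ha : a ≠ 0) (hb : b ≠ 0) :
    a + dord δ a < b + dord δ b ↔ a < b := by
  refine ⟨fun h => ?_, hδ.add_dord_lt ha hb⟩
  by_contra h1
  rcases (not_lt.1 h1).eq_or_lt with rfl | h2
  · exact lt_irrefl _ h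
  · exact lt_asymm h (hδ.add_dord_lt hb ha h2)

theorem dord_le_of_term_ne_zero {f : Grid A} {τ m : A}
    (hm : f.val.coeff m * (δ m).val.coeff (τ - m) ≠ 0) :
    f.val.coeff m ≠ 0 ∧ m ≠ 0 ∧ m + dord δ m ≤ τ := by
  refine ⟨left_ne_zero_of_mul hm, ?_, ?_⟩
  · rintro rfl
    simp at hm
  · have := order_le_of_coeff_ne_zero (right_ne_zero_of_mul hm)
    rw [add_comm]
    exact le_sub_iff_add_le.1 this

/-- The derivative of a term with monomial `m` begins at `m + ψ m`, which increases with `m`. So the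
derivative of the dominant term comes first and nothing cancels it. The coefficient at `0` must
vanish because a dominant constant would be annihilated. -/
theorem coeff_deriv_of_lt (hδ : IsAsym δ) {f : Grid A} (hf : f ≠ 0) (h0 : f.val.coeff 0 = 0)
    {τ : A} (hτ : τ < f.val.order + dord δ f.val.order) : (deriv δ f).val.coeff τ = 0 := by
  rw [deriv_coeff]
  refine finsum_eq_zero_of_forall_eq_zero fun m => ?_
  by_contra hm
  obtain ⟨h1, h2, h3⟩ := dord_le_of_term_ne_zero hm
  have ha : f.val.order ≠ 0 := fun h => by
    rw [← h, coeff_order_eq_zero, Grid.val_eq_zero] at h0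
    exact hf h0
  rcases (order_le_of_coeff_ne_zero h1).eq_or_lt with h4 | h4
  · rw [h4] at hτ
    exact absurd h3 (not_le.2 hτ)
  · exact absurd (h3.trans_lt hτ) (not_lt.2 (hδ.add_dord_lt ha h2 h4).le)

theorem order_ne_zero {f : Grid A} (hf : f ≠ 0) (h0 : f.val.coeff 0 = 0) : f.val.order ≠ 0 :=
  fun h => by
    rw [← h, coeff_order_eq_zero, Grid.val_eq_zero] at h0
    exact hf h0

theorem coeff_deriv_order (hδ : IsAsym δ) {f : Grid A} (hf : f ≠ 0) (h0 : f.val.coeff 0 = 0) :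
    (deriv δ f).val.coeff (f.val.order + dord δ f.val.order) =
      f.val.leadingCoeff * (δ f.val.order).val.leadingCoeff := by
  rw [deriv_coeff, finsum_eq_single _ f.val.order, add_sub_cancel_left, leadingCoeff_eq,
    leadingCoeff_eq, dord]
  intro m hne
  by_contra hm
  obtain ⟨h1, h2, h3⟩ := dord_le_of_term_ne_zero hm
  have h4 := (order_le_of_coeff_ne_zero h1).lt_of_ne hne.symm
  exact absurd h3 (not_le.2 (hδ.add_dord_lt (order_ne_zero hf h0) h2 h4))

theorem deriv_ne_zero (hδ : IsAsym δ) {f : Grid A} (hf : f ≠ 0) (h0 : f.val.coeff 0 = 0) :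
    deriv δ f ≠ 0 := by
  intro h
  have h1 := hδ.coeff_deriv_order hf h0
  rw [h, Grid.val_zero, coeff_zero] at h1
  exact mul_ne_zero (leadingCoeff_ne_zero.2 (Grid.val_ne_zero.2 hf))
    (leadingCoeff_ne_zero.2 (hδ.val_ne_zero (order_ne_zero hf h0))) h1.symm

theorem order_deriv (hδ : IsAsym δ) {f : Grid A} (hf : f ≠ 0) (h0 : f.val.coeff 0 = 0) :
    (deriv δ f).val.order = f.val.order + dord δ f.val.order := by
  apply le_antisymm
  · apply order_le_of_coeff_ne_zero
    rw [hδ.coeff_deriv_order hf h0]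
    exact mul_ne_zero (leadingCoeff_ne_zero.2 (Grid.val_ne_zero.2 hf))
      (leadingCoeff_ne_zero.2 (hδ.val_ne_zero (order_ne_zero hf h0)))
  · by_contra h
    have h1 := hδ.coeff_deriv_of_lt hf h0 (not_le.1 h)
    rw [coeff_order_eq_zero, Grid.val_eq_zero] at h1
    exact hδ.deriv_ne_zero hf h0 h1

theorem leadingCoeff_deriv (hδ : IsAsym δ) {f : Grid A} (hf : f ≠ 0) (h0 : f.val.coeff 0 = 0) :
    (deriv δ f).val.leadingCoeff = f.val.leadingCoeff * (δ f.val.order).val.leadingCoeff := by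
  rw [leadingCoeff_eq, hδ.order_deriv hf h0, hδ.coeff_deriv_order hf h0]

end IsAsym

/-! Embeddings -/

theorem Emb.order_mapAlg (e : Emb A B) {f : HahnSeries A ℝ} (hf : f ≠ 0) :
    (e.mapAlg f).order = e f.order := by
  have h1 : (e.mapAlg f).coeff (e f.order) ≠ 0 := by
    rw [e.mapAlg_coeff]
    exact coeff_order_eq_zero.not.2 hf
  apply le_antisymm (order_le_of_coeff_ne_zero h1)
  have h2 : (e.mapAlg f).coeff (e.mapAlg f).order ≠ 0 :=
    coeff_order_eq_zero.not.2 (ne_zero_of_coeff_ne_zero h1)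
  obtain ⟨a, ha, h⟩ := e.support_mapAlg_subset f h2
  rw [← h]
  exact e.strictMono.monotone (order_le_of_coeff_ne_zero ha)

theorem Emb.leadingCoeff_mapAlg (e : Emb A B) (f : HahnSeries A ℝ) :
    (e.mapAlg f).leadingCoeff = f.leadingCoeff := by
  by_cases hf : f = 0
  · rw [hf, map_zero, leadingCoeff_zero, leadingCoeff_zero]
  · rw [leadingCoeff_eq, e.order_mapAlg hf, e.mapAlg_coeff, leadingCoeff_eq]

theorem Emb.mapAlg_ne_zero (e : Emb A B) {f : HahnSeries A ℝ} (hf : f ≠ 0) : e.mapAlg f ≠ 0 := by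
  rwa [← leadingCoeff_ne_zero, e.leadingCoeff_mapAlg, leadingCoeff_ne_zero]

theorem Emb.eq_zero_iff (e : Emb A B) {a : A} : e a = 0 ↔ a = 0 := by
  rw [← map_zero e, e.strictMono.injective.eq_iff]

theorem Emb.pos_iff (e : Emb A B) {a : A} : 0 < e a ↔ 0 < a := by
  rw [← map_zero e, e.strictMono.lt_iff_lt]

theorem order_monomial_mul (c : A) {f : Grid A} (hf : f ≠ 0) :
    (monomial c * f).val.order = c + f.val.order := by
  rw [Grid.val_mul, val_monomial, order_mul (single_ne_zero one_ne_zero) (Grid.val_ne_zero.2 hf),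
    order_single one_ne_zero]

theorem leadingCoeff_monomial_mul (c : A) (f : Grid A) :
    (monomial c * f).val.leadingCoeff = f.val.leadingCoeff := by
  rw [Grid.val_mul, val_monomial, leadingCoeff_mul, leadingCoeff_of_single, one_mul]

/-- The asymptotic properties transfer to a group each two of whose elements come from a group that
has them. -/
theorem IsAsym.of_local {δ : B →+ Grid B}
    (h : ∀ a b : B, ∃ (A : OrdGroup) (e : Emb A B) (δA : A →+ Grid A) (c : B) (a' b' : A),
      IsAsym δA ∧ (∀ m, δ (e m) = monomial c * e.mapGrid (δA m)) ∧ e a' = a ∧ e b' = b) :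
    IsAsym δ := by
  constructor
  · intro m hm
    obtain ⟨A, e, δA, c, m, -, hA, he, rfl, -⟩ := h m m
    rw [he, leadingCoeff_monomial_mul, Emb.val_mapGrid, e.leadingCoeff_mapAlg]
    exact hA.leadingCoeff_neg _ (e.pos_iff.1 hm)
  · intro a b ha hb
    obtain ⟨A, e, δA, c, a, b, hA, he, rfl, rfl⟩ := h a b
    have hb' : b ≠ 0 := fun h => hb (e.eq_zero_iff.2 h)
    have ha' : 0 < a := e.pos_iff.1 ha
    have hord : ∀ m : A, m ≠ 0 → dord δ (e m) = c + e (dord δA m) := by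
      intro m hm
      have h1 := hA.val_ne_zero hm
      rw [dord, he, order_monomial_mul _ ((Grid.val_ne_zero (f := e.mapGrid (δA m))).1
        (e.mapAlg_ne_zero h1)), Emb.val_mapGrid, e.order_mapAlg h1, dord]
    -- The factor `monomial c` shifts both sides of the inequality by the same `c`.
    rw [hord b hb', hord a ha'.ne', add_left_comm, ← map_add]
    exact add_lt_add_right (e.strictMono (hA.dord_lt a b ha' hb')) c

end Asymptotic

/-! ### Asymptotics of the levels -/

section LevelAsym

variable {A : OrdGroup}

/-- The asymptotic properties of the logarithmic derivative on a group of log-free transmonomials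
in which `x` is the transmonomial of the independent variable. -/
structure LevelAsym (x : A) (δ : A →+ Grid A) : Prop where
  leadingCoeff_neg : ∀ m, 0 < m → (δ m).val.leadingCoeff < 0
  dord_le : ∀ m, m ≠ 0 → dord δ m ≤ -x
  lt_add_dord : ∀ a, 0 < a → -x < a + dord δ a

theorem LevelAsym.isAsym {x : A} {δ : A →+ Grid A} (h : LevelAsym x δ) : IsAsym δ :=
  ⟨h.leadingCoeff_neg, fun a b ha hb => (h.dord_le b hb).trans_lt (h.lt_add_dord a ha)⟩

/-- For a large monomial `d` this says `d'/d ≪ d/x`. It controls the iteration of `ψ`, both in the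
induction on levels and in integration. -/
theorem LevelAsym.dord_dord {x : A} {δ : A →+ Grid A} (h : LevelAsym x δ) {d : A} (hd : d < 0) :
    d - x < dord δ d := by
  have := h.lt_add_dord (-d) (neg_pos.2 hd)
  rw [dord_neg] at this
  have h2 := add_lt_add_right this d
  rwa [add_neg_cancel_left, ← sub_eq_add_neg] at h2

theorem leadingCoeff_neg_smul_single (a : A) (r : ℝ) :
    (-(r • single a (1 : ℝ))).leadingCoeff = -r := by
  have : r • single a (1 : ℝ) = single a r := by
    ext g
    rw [coeff_smul, coeff_single, coeff_single]
    split_ifs <;> simp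
  rw [this, leadingCoeff_neg, leadingCoeff_of_single]

theorem order_neg_smul_single (a : A) {r : ℝ} (hr : r ≠ 0) :
    (-(r • single a (1 : ℝ))).order = a := by
  have : r • single a (1 : ℝ) = single a r := by
    ext g
    rw [coeff_smul, coeff_single, coeff_single]
    split_ifs <;> simp
  rw [this, order_neg, order_single hr]

theorem levelAsym_base : LevelAsym baseX dlogBase where
  leadingCoeff_neg m hm := by
    have h : (dlogBase m).val = -(baseVal m • single (-baseX) (1 : ℝ)) := rfl
    rw [h, leadingCoeff_neg_smul_single]
    exact neg_neg_of_pos (baseVal_pos.2 hm)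
  dord_le m hm := by
    have h : (dlogBase m).val = -(baseVal m • single (-baseX) (1 : ℝ)) := rfl
    have h0 : baseVal m ≠ 0 := hm
    rw [dord, h, order_neg_smul_single _ h0]
  lt_add_dord m hm := by
    have h : (dlogBase m).val = -(baseVal m • single (-baseX) (1 : ℝ)) := rfl
    have h0 : baseVal m ≠ 0 := hm.ne'
    rw [dord, h, order_neg_smul_single _ h0]
    exact lt_add_of_pos_left _ hm

theorem Large.coeff_zero (L : Large A) : (largeToGrid L).val.coeff 0 = 0 := by
  by_contra h
  exact lt_irrefl _ (L.2.2 0 h)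

theorem largeToGrid_ne_zero {L : Large A} (hL : L ≠ 0) : largeToGrid L ≠ 0 := fun h =>
  hL (Subtype.ext (Grid.val_eq_zero.2 h))

theorem Large.order_neg {L : Large A} (hL : L ≠ 0) : (largeToGrid L).val.order < 0 :=
  L.2.2 _ (coeff_order_eq_zero.not.2 (Grid.val_ne_zero.2 (largeToGrid_ne_zero hL)))

theorem Large.pos_iff {L : Large A} : 0 < L ↔ 0 < (largeToGrid L).val.leadingCoeff :=
  (leadingCoeff_pos_iff (x := L.1)).symm

variable {x : A} {δ : A →+ Grid A} {i : Emb A A.exp}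

theorem dlogStep_val (m : A.exp) : (dlogStep i δ m).val =
    -(spart m • single (-expX A) 1 + i.mapAlg (deriv δ (largeToGrid (lpart m))).val) := rfl

theorem dlogStep_val_of_lpart_eq_zero {m : A.exp} (hm : lpart m = 0) :
    (dlogStep i δ m).val = -(spart m • single (-expX A) (1 : ℝ)) := by
  rw [dlogStep_val, hm, map_zero, map_zero, Grid.val_zero, map_zero, add_zero]

/-- In `σ x⁻¹ + L'` the summand `L'` dominates: if `ℓ` is the leading exponent of `L`, then `ℓ + ψ ℓ
< ψ ℓ ≤ -x`. -/
theorem order_dlogStep_aux (hδ : LevelAsym x δ) (hx : i x = expX A) {m : A.exp}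
    (hm : lpart m ≠ 0) :
    (spart m • single (-expX A) (1 : ℝ) +
      i.mapAlg (deriv δ (largeToGrid (lpart m))).val).orderTop =
      (i.mapAlg (deriv δ (largeToGrid (lpart m))).val).orderTop ∧
    (spart m • single (-expX A) (1 : ℝ) +
      i.mapAlg (deriv δ (largeToGrid (lpart m))).val).leadingCoeff =
      (i.mapAlg (deriv δ (largeToGrid (lpart m))).val).leadingCoeff := by
  have h0 := Large.coeff_zero (lpart m)
  have hne := largeToGrid_ne_zero hm
  have hd := Grid.val_ne_zero.2 (hδ.isAsym.deriv_ne_zero hne h0)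
  have hlt : (i.mapAlg (deriv δ (largeToGrid (lpart m))).val).orderTop <
      (spart m • single (-expX A) (1 : ℝ)).orderTop := by
    refine lt_of_lt_of_le ?_ (orderTop_le_orderTop_smul _ _)
    rw [orderTop_single one_ne_zero, ← order_eq_orderTop_of_ne_zero (i.mapAlg_ne_zero hd),
      i.order_mapAlg hd, WithTop.coe_lt_coe, hδ.isAsym.order_deriv hne h0, ← hx, ← map_neg]
    apply i.strictMono
    have h1 := Large.order_neg hm
    calc _ < dord δ (largeToGrid (lpart m)).val.order := add_lt_of_neg_left _ h1
      _ ≤ -x := hδ.dord_le _ h1.ne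
  exact ⟨orderTop_add_eq_right hlt, leadingCoeff_add_eq_right hlt⟩

theorem dord_dlogStep (hδ : LevelAsym x δ) (hx : i x = expX A) {m : A.exp}
    (hm : lpart m ≠ 0) : dord (dlogStep i δ) m =
      i ((largeToGrid (lpart m)).val.order + dord δ (largeToGrid (lpart m)).val.order) := by
  have h0 := Large.coeff_zero (lpart m)
  have hne := largeToGrid_ne_zero hm
  have hd := Grid.val_ne_zero.2 (hδ.isAsym.deriv_ne_zero hne h0)
  have h := (order_dlogStep_aux hδ hx hm).1
  have hs : spart m • single (-expX A) (1 : ℝ) +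
      i.mapAlg (deriv δ (largeToGrid (lpart m))).val ≠ 0 := by
    rw [← orderTop_ne_top, h, orderTop_ne_top]
    exact i.mapAlg_ne_zero hd
  rw [← order_eq_orderTop_of_ne_zero hs,
    ← order_eq_orderTop_of_ne_zero (i.mapAlg_ne_zero hd), WithTop.coe_inj] at h
  rw [dord, dlogStep_val, HahnSeries.order_neg, h, i.order_mapAlg hd, hδ.isAsym.order_deriv hne h0]

theorem leadingCoeff_dlogStep (hδ : LevelAsym x δ) (hx : i x = expX A) {m : A.exp}
    (hm : lpart m ≠ 0) : (dlogStep i δ m).val.leadingCoeff =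
      -((largeToGrid (lpart m)).val.leadingCoeff *
        (δ (largeToGrid (lpart m)).val.order).val.leadingCoeff) := by
  rw [dlogStep_val, leadingCoeff_neg, (order_dlogStep_aux hδ hx hm).2, i.leadingCoeff_mapAlg,
    hδ.isAsym.leadingCoeff_deriv (largeToGrid_ne_zero hm) (Large.coeff_zero _)]

theorem dord_dlogStep_of_lpart_eq_zero {m : A.exp} (hm : lpart m = 0) (hm0 : m ≠ 0) :
    dord (dlogStep i δ) m = -expX A := by
  have hs : spart m ≠ 0 := fun h => hm0 (Prod.ext (x := ofLex m) (y := 0) hm h)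
  rw [dord, dlogStep_val_of_lpart_eq_zero hm, order_neg_smul_single _ hs]

theorem dord_of_mapGrid {B : OrdGroup} (e : Emb A B) {δB : B →+ Grid B}
    (he : ∀ a, δB (e a) = e.mapGrid (δ a)) {a : A} (ha : (δ a).val ≠ 0) :
    dord δB (e a) = e (dord δ a) := by
  rw [dord, he, Emb.val_mapGrid, e.order_mapAlg ha, dord]

/-- Up to sign and a power of `x`, `K = lpart (i b)` is the logarithm of `b`. If `K ≠ 0`, then `K'`
and `b'/b` have the same dominant monomial. So a comparison of `L'` with `b'/b`, where `L` has
leading exponent `ℓ`, integrates to one of `L` with `K`, by monotonicity of `m ↦ m + ψ m`. -/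
theorem orderTop_lpart_lt (hδ : LevelAsym x δ) (hx : i x = expX A)
    (hi : ∀ a, dlogStep i δ (i a) = i.mapGrid (δ a)) {ℓ : A} (hℓ : ℓ < 0) {b : A}
    (hb : b ≠ 0 → ℓ + dord δ ℓ < dord δ b) :
    (ℓ : WithTop A) < (largeToGrid (lpart (i b))).val.orderTop := by
  by_cases hK : lpart (i b) = 0
  · rw [hK, map_zero, Grid.val_zero, orderTop_zero]
    exact WithTop.coe_lt_top _
  · have hb0 : b ≠ 0 := by
      rintro rfl
      exact hK (by rw [map_zero, map_zero])
    have h1 := dord_of_mapGrid i hi (hδ.isAsym.val_ne_zero hb0)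
    rw [dord_dlogStep hδ hx hK] at h1
    have h2 := hb hb0
    rw [← i.strictMono.injective h1] at h2
    rw [← order_eq_orderTop_of_ne_zero (Grid.val_ne_zero.2 (largeToGrid_ne_zero hK)),
      WithTop.coe_lt_coe]
    exact (hδ.isAsym.add_dord_lt_iff hℓ.ne (Large.order_neg hK).ne).1 h2

theorem levelAsym_step (hδ : LevelAsym x δ) (hx : i x = expX A)
    (hi : ∀ a, dlogStep i δ (i a) = i.mapGrid (δ a)) : LevelAsym (expX A) (dlogStep i δ) where
  leadingCoeff_neg m hm := by
    rcases exp_pos_iff.1 hm with h | ⟨h, h'⟩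
    · rw [leadingCoeff_dlogStep hδ hx h.ne', neg_lt_zero]
      exact mul_pos (Large.pos_iff.1 h) (hδ.isAsym.leadingCoeff_pos (Large.order_neg h.ne'))
    · rw [dlogStep_val_of_lpart_eq_zero h, leadingCoeff_neg_smul_single, neg_lt_zero]
      exact h'
  dord_le m hm := by
    by_cases h : lpart m = 0
    · rw [dord_dlogStep_of_lpart_eq_zero h hm]
    · rw [dord_dlogStep hδ hx h, ← hx, ← map_neg]
      apply i.strictMono.monotone
      have h1 := Large.order_neg h
      exact (add_lt_of_neg_left _ h1).le.trans (hδ.dord_le _ h1.ne)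
  lt_add_dord m hm := by
    rcases exp_pos_iff.1 hm with h | ⟨h, h'⟩
    · rw [dord_dlogStep hδ hx h.ne']
      set ℓ := (largeToGrid (lpart m)).val.order with hℓ
      have hneg : ℓ < 0 := Large.order_neg h.ne'
      rw [← sub_pos, ← hx, sub_neg_eq_add, add_assoc, ← map_add, add_assoc, map_add]
      refine exp_pos_iff.2 (Or.inl ?_)
      -- The claim is that `e^{-L}` times the monomials `ℓ`, `ψ ℓ` and `x` is still small. It
      -- suffices that `L` dominates the logarithms of `ℓ` and of `ψ ℓ + x`, so that `L` alone
      -- decides the sign.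
      have h1 := orderTop_lpart_lt hδ hx hi hneg (b := ℓ) fun _ => add_lt_of_neg_left _ hneg
      have h2 := orderTop_lpart_lt hδ hx hi hneg (b := dord δ ℓ + x) fun h0 => by
        have h3 : dord δ ℓ + x < 0 :=
          lt_of_le_of_ne (by simpa using add_le_add_left (hδ.dord_le ℓ hneg.ne) x) h0
        have h4 := hδ.dord_dord h3
        rw [add_sub_cancel_right] at h4
        exact (add_lt_of_neg_left _ hneg).trans h4
      rw [Large.pos_iff, map_add, map_add, map_add, map_add, Grid.val_add, Grid.val_add,
        leadingCoeff_add_eq_left]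
      · exact Large.pos_iff.1 h
      · rw [← order_eq_orderTop_of_ne_zero (Grid.val_ne_zero.2 (largeToGrid_ne_zero h.ne'))]
        exact (lt_min h1 h2).trans_le min_orderTop_le_orderTop_add
    · have h0 : m ≠ 0 := hm.ne'
      rw [dord_dlogStep_of_lpart_eq_zero h h0]
      exact lt_add_of_pos_left _ hm

end LevelAsym

theorem levelAsym : ∀ n, LevelAsym (xMon n) (dlog n)
  | 0 => levelAsym_base
  | n + 1 => levelAsym_step (levelAsym n) (incl_xMon n) (dlog_incl n)

theorem xMon_neg : ∀ n, xMon n < 0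
  | 0 => baseX_neg
  | n + 1 => expX_neg (Mon n)

/-- The transmonomial `m ∘ L_k`, for a log-free transmonomial of level at most `n`. -/
def levelEmb (k n : ℕ) : Emb (Mon n) MonGroup := (compLog k).comp (ofLevel n)

theorem dlogMon_compLog (k : ℕ) (m : LogFree) : dlogMon (compLog k m) =
    monomial (-∑ j ∈ Finset.range k, logMon j) * (compLog k).mapGrid (dlogLogFree m) := rfl

theorem dlogMon_levelEmb (k n : ℕ) (m : Mon n) : dlogMon (levelEmb k n m) =
    monomial (-∑ j ∈ Finset.range k, logMon j) * (levelEmb k n).mapGrid (dlog n m) := by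
  rw [levelEmb, Emb.mapGrid_comp, ← dlogLogFree_ofLevel, ← dlogMon_compLog]
  rfl

theorem exists_levelEmb (a b : MonGroup) :
    ∃ (k n : ℕ) (a' b' : Mon n), levelEmb k n a' = a ∧ levelEmb k n b' = b := by
  obtain ⟨k, c, hc⟩ := exists_toSeqLim_fin (A := fun _ => LogFree) (fun _ => logFreeUp) ![a, b]
  obtain ⟨n, d, hd⟩ := exists_toSeqLim_fin incl c
  exact ⟨k, n, d 0, d 1, ((hc 0).trans (congrArg (compLog k) (hd 0))).symm,
    ((hc 1).trans (congrArg (compLog k) (hd 1))).symm⟩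

/-- Two monomials can be written as `m ∘ L_k` with a common `k` and a common level. The separation
by `1/x` in `LevelAsym` fails once logarithms are present (`log x` has logarithmic derivative `≪
1/x`), so only the shift-invariant `IsAsym` is transferred. -/
theorem isAsym_dlogMon : IsAsym dlogMon :=
  IsAsym.of_local fun a b => by
    obtain ⟨k, n, a', b', ha, hb⟩ := exists_levelEmb a b
    exact ⟨Mon n, levelEmb k n, dlog n, _, a', b', (levelAsym n).isAsym, dlogMon_levelEmb k n,
      ha, hb⟩

/-! ### Generators of grids -/

/-- Dickson's lemma: `ℕ^M` is well quasi-ordered, so the antichain of minimal elements is finite and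
every element lies above one of them. -/
theorem exists_finset_minimal {M : ℕ} (K : Set (Fin M → ℕ)) :
    ∃ T : Finset (Fin M → ℕ), (T : Set (Fin M → ℕ)) ⊆ K ∧ ∀ p ∈ K, ∃ q ∈ T, q ≤ p := by
  have hfin : {p | Minimal (· ∈ K) p}.Finite :=
    (setOfPred_minimal_antichain (· ∈ K)).finite_of_partiallyWellOrderedOn (Set.isPWO_of_wellQuasiOrderedLE _)
  refine ⟨hfin.toFinset, fun p hp => ?_, fun p hp => ?_⟩
  · exact (hfin.mem_toFinset.1 (Finset.mem_coe.1 hp)).1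
  · obtain ⟨q, hq, h⟩ := (Set.isPWO_of_wellQuasiOrderedLE K).exists_le_minimal hp
    exact ⟨q, hfin.mem_toFinset.2 h, hq⟩

section Generators

variable {Γ : Type} [AddCommGroup Γ] [LinearOrder Γ] [IsOrderedAddMonoid Γ]

/-- A grid contained in a subgroup has its generators and its base points in the subgroup. -/
theorem IsGrid.exists_generators {S : Set Γ} (hS : IsGrid S) {Λ : AddSubgroup Γ}
    (hΛ : S ⊆ Λ) : ∃ B G : Finset Γ, (B : Set Γ) ⊆ S ∧ (G : Set Γ) ⊆ Λ ∧ (∀ g ∈ G, 0 < g) ∧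
      ∀ s ∈ S, ∃ b ∈ B, s - b ∈ AddSubmonoid.closure (G : Set Γ) := by
  classical
  obtain ⟨M, μ, k₀, hμ, hS⟩ := hS
  let w : (Fin M → ℕ) → Γ := fun p => ∑ i, p i • μ i
  let a : Γ := ∑ i, k₀ i • μ i
  have hw : ∀ p q, w (p + q) = w p + w q := fun p q => by
    simp only [w, Pi.add_apply, add_smul, Finset.sum_add_distrib]
  -- The given generators `μ i` need not lie in `Λ`. Minimal multi-indices replace them: those that
  -- hit `S` give base points, and the minimal nonzero ones with `w p ∈ Λ` give generators.
  -- Subtracting minimal ones repeatedly reaches every element of `Λ` of the form `w p`.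
  obtain ⟨T, hT, hT'⟩ := exists_finset_minimal {p | a + w p ∈ S}
  obtain ⟨U, hU, hU'⟩ := exists_finset_minimal {p | p ≠ 0 ∧ w p ∈ Λ}
  have hclosure : ∀ p, w p ∈ Λ → w p ∈ AddSubmonoid.closure ((U.image w : Finset Γ) : Set Γ) := by
    intro p
    induction p using WellFoundedLT.induction with
    | _ p ih =>
      intro hp
      by_cases h0 : p = 0
      · have : w p = 0 := by simp [w, h0]
        rw [this]
        exact AddSubmonoid.zero_mem _
      · obtain ⟨q, hq, hqp⟩ := hU' p ⟨h0, hp⟩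
        obtain ⟨hq0, hqΛ⟩ := hU hq
        have hpq : q + (p - q) = p := add_tsub_cancel_of_le hqp
        have h1 : w p = w q + w (p - q) := by rw [← hw, hpq]
        have h2 : w (p - q) ∈ Λ := by
          have := Λ.sub_mem hp hqΛ
          rwa [h1, add_sub_cancel_left] at this
        rw [h1]
        refine AddSubmonoid.add_mem _ (AddSubmonoid.subset_closure ?_) (ih _ ?_ h2)
        · exact Finset.mem_coe.2 (Finset.mem_image_of_mem w hq)
        · refine lt_of_le_of_ne tsub_le_self fun h => hq0 ?_
          rw [h] at hpq
          simpa using hpq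
  refine ⟨T.image fun p => a + w p, U.image w, ?_, ?_, ?_, ?_⟩
  · intro b hb
    obtain ⟨p, hp, rfl⟩ := Finset.mem_image.1 (Finset.mem_coe.1 hb)
    exact hT hp
  · intro b hb
    obtain ⟨p, hp, rfl⟩ := Finset.mem_image.1 (Finset.mem_coe.1 hb)
    exact (hU hp).2
  · intro b hb
    obtain ⟨p, hp, rfl⟩ := Finset.mem_image.1 hb
    obtain ⟨i, hi⟩ := Function.ne_iff.1 (hU hp).1
    refine Finset.sum_pos' (fun i _ => nsmul_nonneg (hμ i).le _) ⟨i, Finset.mem_univ i, ?_⟩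
    exact nsmul_pos (hμ i) hi
  · intro s hs
    obtain ⟨k, hk, rfl⟩ := hS s hs
    obtain ⟨p, hp⟩ : ∃ p : Fin M → ℕ, ∀ i, k i = k₀ i + p i :=
      ⟨fun i => (k i - k₀ i).toNat, fun i => by
        have := hk i
        rw [Int.toNat_of_nonneg (sub_nonneg.2 this)]
        ring⟩
    have h1 : ∑ i, k i • μ i = a + w p := by
      simp only [a, w, ← Finset.sum_add_distrib]
      refine Finset.sum_congr rfl fun i _ => ?_
      rw [hp, add_smul, natCast_zsmul]
    rw [h1] at hs ⊢
    obtain ⟨q, hq, hqp⟩ := hT' p hs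
    have hpq : q + (p - q) = p := add_tsub_cancel_of_le hqp
    have h2 : a + w p - (a + w q) = w (p - q) := by
      rw [add_sub_add_left_eq_sub, sub_eq_iff_eq_add, ← hw, add_comm, hpq]
    refine ⟨a + w q, Finset.mem_image_of_mem _ hq, ?_⟩
    rw [h2]
    apply hclosure
    rw [← h2]
    exact Λ.sub_mem (hΛ hs) (hΛ (hT hq))

/-- A grid of small transmonomials in a subgroup is generated by finitely many small transmonomials
of the subgroup. -/
theorem IsGrid.exists_pos_generators {S : Set Γ} (hS : IsGrid S) {Λ : AddSubgroup Γ}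
    (hΛ : S ⊆ Λ) (hpos : ∀ s ∈ S, 0 < s) : ∃ G : Finset Γ, (G : Set Γ) ⊆ Λ ∧ (∀ g ∈ G, 0 < g) ∧
      S ⊆ AddSubmonoid.closure (G : Set Γ) := by
  classical
  obtain ⟨B, G, hB, hG, hG', h⟩ := hS.exists_generators hΛ
  refine ⟨B ∪ G, ?_, ?_, fun s hs => ?_⟩
  · rw [Finset.coe_union]
    exact Set.union_subset (hB.trans hΛ) hG
  · intro g hg
    rcases Finset.mem_union.1 hg with hg | hg
    exacts [hpos g (hB hg), hG' g hg]
  · obtain ⟨b, hb, h⟩ := h s hs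
    rw [← sub_add_cancel s b]
    refine AddSubmonoid.add_mem _ (AddSubmonoid.closure_mono ?_ h)
      (AddSubmonoid.subset_closure ?_)
    · simp
    · simp [hb]

theorem isGrid_closure {G : Finset Γ} (hG : ∀ g ∈ G, 0 < g) :
    IsGrid (AddSubmonoid.closure (G : Set Γ) : Set Γ) :=
  isGrid_iff.2 ⟨G, 0, hG, fun γ hγ => by rwa [sub_zero]⟩

theorem IsGrid.translate {S : Set Γ} (hS : IsGrid S) (a : Γ) : IsGrid {γ | γ - a ∈ S} := by
  refine (hS.add (isGrid_singleton a)).subset fun γ hγ => ?_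
  exact ⟨γ - a, hγ, a, rfl, sub_add_cancel γ a⟩

theorem IsGrid.exists_subset_closure {S : Set Γ} (hS : IsGrid S) :
    ∃ F : Finset Γ, S ⊆ AddSubgroup.closure (F : Set Γ) := by
  classical
  obtain ⟨G, a, -, hS⟩ := isGrid_iff.1 hS
  refine ⟨insert a G, fun s hs => ?_⟩
  have h1 : ∀ γ ∈ AddSubmonoid.closure (G : Set Γ),
      γ ∈ AddSubgroup.closure ((insert a G : Finset Γ) : Set Γ) := fun γ hγ =>
    (AddSubmonoid.closure_le (S := (AddSubgroup.closure _).toAddSubmonoid)).2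
      (fun g hg => AddSubgroup.subset_closure (by simp [Finset.mem_coe.1 hg])) hγ
  rw [← sub_add_cancel s a]
  exact AddSubgroup.add_mem _ (h1 _ (hS s hs)) (AddSubgroup.subset_closure (by simp))

theorem Grid.exists_subset_closure (f : Grid Γ) :
    ∃ F : Finset Γ, f.val.support ⊆ AddSubgroup.closure (F : Set Γ) :=
  f.isGrid.exists_subset_closure

/-- The inverse of a series. -/
theorem Grid.exists_inv {f : Grid Γ} (hf : f ≠ 0) {Λ : AddSubgroup Γ}
    (hΛ : f.val.support ⊆ Λ) : ∃ g : Grid Γ, f * g = 1 ∧ g.val.support ⊆ Λ := by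
  have hf' := Grid.val_ne_zero.2 hf
  set a := f.val.order with ha
  have haΛ : a ∈ Λ := hΛ (coeff_order_eq_zero.not.2 hf')
  set c := f.val.coeff a with hc
  have hc0 : c ≠ 0 := coeff_order_eq_zero.not.2 hf'
  -- Factoring out the dominant term leaves `1 - ε` with `ε` small. The inverse is the geometric
  -- series in `ε`, supported in the monoid generated by finitely many small monomials.
  let ε : Grid Γ := 1 - c⁻¹ • (monomial (-a) * f)
  have hε : ∀ γ, ε.val.coeff γ = (if γ = 0 then 1 else 0) - c⁻¹ * f.val.coeff (γ + a) := by
    intro γ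
    rw [Grid.val_sub, coeff_sub, Grid.val_one, coeff_one, Grid.val_smul, coeff_smul,
      coeff_monomial_mul, sub_neg_eq_add, smul_eq_mul]
    split_ifs <;> rfl
  have hεΛ : ε.val.support ⊆ Λ := by
    intro γ hγ
    rw [mem_support, hε] at hγ
    split_ifs at hγ with h
    · rw [h]
      exact Λ.zero_mem
    · rw [zero_sub, neg_ne_zero] at hγ
      have := Λ.sub_mem (hΛ (right_ne_zero_of_mul hγ)) haΛ
      rwa [add_sub_cancel_right] at this
  have hεpos : ∀ γ ∈ ε.val.support, 0 < γ := by
    intro γ hγ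
    rw [mem_support, hε] at hγ
    by_contra h
    rcases (not_lt.1 h).eq_or_lt with rfl | h
    · rw [if_pos rfl, zero_add, inv_mul_cancel₀ hc0, sub_self] at hγ
      exact hγ rfl
    · rw [if_neg h.ne, coeff_eq_zero_of_lt_order (add_lt_of_neg_left a h), mul_zero,
        sub_zero] at hγ
      exact hγ rfl
  have hεtop : 0 < ε.val.orderTop := by
    by_cases h : ε.val = 0
    · rw [h, orderTop_zero]
      exact WithTop.coe_lt_top _
    · exact zero_lt_orderTop_of_order (hεpos _ (coeff_order_eq_zero.not.2 h))
  obtain ⟨G, hGΛ, hG, hεG⟩ := ε.isGrid.exists_pos_generators hεΛ hεpos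
  set h := (SummableFamily.powers ε.val).hsum with hh
  have hsupp : h.support ⊆ AddSubmonoid.closure (G : Set Γ) := by
    intro γ hγ
    obtain ⟨n, hn⟩ := Set.mem_iUnion.1 (SummableFamily.support_hsum_subset hγ)
    rw [SummableFamily.powers_of_orderTop_pos hεtop] at hn
    exact (AddSubmonoid.closure_le.2 hεG) (SummableFamily.support_pow_subset_closure _ n hn)
  have hinv : (1 - ε.val) * h = 1 := SummableFamily.one_sub_self_mul_hsum_powers hεtop
  let g₀ : Grid Γ := Grid.mk h ((isGrid_closure hG).subset hsupp)
  refine ⟨c⁻¹ • (monomial (-a) * g₀), ?_, ?_⟩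
  · have h1 : (1 - ε) * g₀ = 1 := Grid.ext hinv
    rw [← h1, show 1 - ε = c⁻¹ • (monomial (-a) * f) from sub_sub_cancel _ _, mul_smul_comm,
      smul_mul_assoc]
    congr 1
    ring
  · intro γ hγ
    rw [Grid.val_smul] at hγ
    have h1 := support_monomial_mul.1 (support_smul_subset _ _ hγ)
    rw [sub_neg_eq_add] at h1
    have h2 : γ + a ∈ Λ :=
      (AddSubmonoid.closure_le (S := Λ.toAddSubmonoid)).2 hGΛ (hsupp h1)
    have := Λ.sub_mem h2 haΛ
    rwa [add_sub_cancel_right] at this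

/-- A finite-dimensional space of series has finitely many orders. -/
theorem finite_orders_span (s : Finset (HahnSeries Γ ℝ)) :
    {γ | ∃ w ∈ Submodule.span ℝ (s : Set (HahnSeries Γ ℝ)), w ≠ 0 ∧ w.order = γ}.Finite := by
  classical
  induction s using Finset.induction_on with
  | empty =>
    refine Set.finite_empty.subset ?_
    rintro γ ⟨w, hw, h0, -⟩
    rw [Finset.coe_empty, Submodule.span_empty, Submodule.mem_bot] at hw
    exact h0 hw
  | insert y s _ ih =>
    rw [Finset.coe_insert]
    set O := {γ | ∃ w ∈ Submodule.span ℝ (s : Set (HahnSeries Γ ℝ)), w ≠ 0 ∧ w.order = γ}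
    set X := {γ | ∃ w ∈ Submodule.span ℝ (insert y (s : Set (HahnSeries Γ ℝ))),
      w ≠ 0 ∧ w.order = γ}
    -- Adjoining one vector adds at most one order. If two new orders `p < q` occurred, subtracting
    -- a multiple of the series of order `q` would eliminate `y` without touching the leading term
    -- at `p`, so `p` would be an old order.
    have key : ∀ p ∈ X \ O, ∀ q ∈ X \ O, ¬ p < q := by
      rintro p ⟨⟨w, hw, hw0, rfl⟩, hpO⟩ q ⟨⟨w', hw', hw0', rfl⟩, hqO⟩ hlt
      obtain ⟨a, z, hz, rfl⟩ := Submodule.mem_span_insert.1 hw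
      obtain ⟨b, z', hz', rfl⟩ := Submodule.mem_span_insert.1 hw'
      have hb : b ≠ 0 := by
        rintro rfl
        rw [zero_smul, zero_add] at hqO hw0'
        exact hqO ⟨z', hz', hw0', rfl⟩
      set W := a • y + z with hW
      set W' := b • y + z' with hW'
      have hu : W - (a / b) • W' = z - (a / b) • z' := by
        rw [hW, hW', smul_add, smul_smul, div_mul_cancel₀ a hb]
        abel
      have hcoeff : ∀ γ, γ < W'.order → (W - (a / b) • W').coeff γ = W.coeff γ := by
        intro γ hγ
        rw [coeff_sub, coeff_smul, coeff_eq_zero_of_lt_order hγ, smul_zero, sub_zero]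
      have h1 : (W - (a / b) • W').coeff W.order ≠ 0 := by
        rw [hcoeff _ hlt]
        exact coeff_order_eq_zero.not.2 hw0
      refine hpO ⟨W - (a / b) • W', ?_, ne_zero_of_coeff_ne_zero h1, ?_⟩
      · rw [hu]
        exact Submodule.sub_mem _ hz (Submodule.smul_mem _ _ hz')
      · apply le_antisymm (order_le_of_coeff_ne_zero h1)
        by_contra hc
        have h2 := not_le.1 hc
        have h3 := hcoeff _ (h2.trans hlt)
        rw [coeff_eq_zero_of_lt_order h2, coeff_order_eq_zero] at h3
        exact ne_zero_of_coeff_ne_zero h1 h3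
    have hsub : (X \ O).Subsingleton := fun p hp q hq =>
      le_antisymm (not_lt.1 (key q hq p hp)) (not_lt.1 (key p hp q hq))
    refine (ih.union hsub.finite).subset fun γ hγ => ?_
    by_cases h : γ ∈ O
    exacts [Or.inl h, Or.inr ⟨hγ, h⟩]

/-- A fixed point equation whose kernel strictly increases exponents has a solution supported in
each well ordered set that is stable under the kernel and contains the data. -/
theorem exists_kernel_fixpoint {S : Set Γ} (hS : S.IsPWO) (f : Γ → ℝ) (hf : ∀ τ, τ ∉ S → f τ = 0)
    (k : Γ → Γ → ℝ) (hk : ∀ m ∈ S, ∀ τ, k m τ ≠ 0 → m < τ ∧ τ ∈ S) :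
    ∃ h : Γ → ℝ, (∀ τ, τ ∉ S → h τ = 0) ∧ ∀ τ, h τ = f τ + ∑ᶠ m, h m * k m τ := by
  classical
  have hwf : WellFounded fun a b : S => a.1 < b.1 := hS.isWF
  -- The value at `τ` uses only values at smaller exponents of the well ordered set `S`. No
  -- finiteness is needed here: the recursion and the equation contain the same `finsum`.
  let F : ∀ τ : S, (∀ m : S, m.1 < τ.1 → ℝ) → ℝ := fun τ rec =>
    f τ + ∑ᶠ m : Γ, if hm : ∃ h : m ∈ S, m < τ.1 then rec ⟨m, hm.1⟩ hm.2 * k m τ else 0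
  let h : Γ → ℝ := fun τ => if hτ : τ ∈ S then hwf.fix F ⟨τ, hτ⟩ else 0
  have h0 : ∀ τ, τ ∉ S → h τ = 0 := fun τ hτ => dif_neg hτ
  refine ⟨h, h0, fun τ => ?_⟩
  by_cases hτ : τ ∈ S
  · have h1 : h τ = F ⟨τ, hτ⟩ fun m _ => hwf.fix F m := by
      simp only [h, dif_pos hτ]
      exact hwf.fix_eq F ⟨τ, hτ⟩
    rw [h1]
    refine congrArg (f τ + ·) (finsum_congr fun m => ?_)
    by_cases hm : ∃ h : m ∈ S, m < τ
    · rw [dif_pos hm]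
      simp only [h, dif_pos hm.1]
    · rw [dif_neg hm]
      by_cases hmS : m ∈ S
      · have : k m τ = 0 := by
          by_contra hne
          exact hm ⟨hmS, (hk m hmS τ hne).1⟩
        rw [this, mul_zero]
      · rw [h0 m hmS, zero_mul]
  · rw [h0 τ hτ, hf τ hτ, zero_add, eq_comm]
    refine finsum_eq_zero_of_forall_eq_zero fun m => ?_
    by_cases hmS : m ∈ S
    · have : k m τ = 0 := by
        by_contra hne
        exact hτ (hk m hmS τ hne).2
      rw [this, mul_zero]
    · rw [h0 m hmS, zero_mul]

end Generators

/-! Restriction along an embedding -/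

section Restrict

variable {A B : OrdGroup}

/-- Generators of the image grid may lie outside the range of `e`. Taking `Λ` to be the range in
`IsGrid.exists_generators` yields generators and base points that can be pulled back. -/
theorem IsGrid.of_image (e : Emb A B) {s : Set A} (hs : IsGrid (e '' s)) : IsGrid s := by
  classical
  obtain ⟨T, G, hT, hG, hpos, h⟩ := hs.exists_generators
    (Λ := (e.toAddMonoidHom).range) (by
      rintro _ ⟨a, -, rfl⟩
      exact ⟨a, rfl⟩)
  let G' : Finset A := G.preimage e e.strictMono.injective.injOn
  let T' : Finset A := T.preimage e e.strictMono.injective.injOn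
  have hG' : ∀ g ∈ G', 0 < g := fun g hg => e.pos_iff.1 (hpos _ (Finset.mem_preimage.1 hg))
  have himg : e.toAddMonoidHom '' (G' : Set A) = G := by
    rw [Finset.coe_preimage]
    exact Set.image_preimage_eq_of_subset hG
  have hcl : AddSubmonoid.closure (G : Set B) =
      (AddSubmonoid.closure (G' : Set A)).map e.toAddMonoidHom := by
    rw [AddMonoidHom.map_mclosure, himg]
  refine (IsGrid.biUnion T' fun b => (isGrid_closure hG').translate b).subset fun a ha => ?_
  obtain ⟨b, hb, hab⟩ := h (e a) ⟨a, ha, rfl⟩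
  obtain ⟨b, -, rfl⟩ := hT hb
  rw [hcl] at hab
  obtain ⟨c, hc, hab⟩ := hab
  have : c = a - b := e.strictMono.injective (hab.trans (map_sub e a b).symm)
  subst this
  exact Set.mem_biUnion (s := (T' : Set A)) (Finset.mem_coe.2 (Finset.mem_preimage.2 hb)) hc

/-- A series whose transmonomials come from a smaller group comes from that group. -/
theorem exists_mapGrid_of_support_subset (e : Emb A B) (f : Grid B)
    (hf : f.val.support ⊆ Set.range e) : ∃ g : Grid A, e.mapGrid g = f := by
  have hgrid : IsGrid (Function.support fun a : A => f.val.coeff (e a)) := by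
    refine IsGrid.of_image e (f.isGrid.subset ?_)
    rintro _ ⟨a, ha, rfl⟩
    exact ha
  let t : HahnSeries A ℝ := ⟨fun a => f.val.coeff (e a), hgrid.isPWO⟩
  refine ⟨Grid.mk t hgrid, Grid.ext ?_⟩
  ext b
  show (e.mapAlg t).coeff b = _
  by_cases hb : b ∈ Set.range e
  · obtain ⟨a, rfl⟩ := hb
    exact e.mapAlg_coeff t a
  · rw [e.mapAlg_coeff_of_notMem t hb]
    by_contra h
    exact hb (hf (Ne.symm h))

end Restrict

/-! ### Finitely generated groups that are stable under differentiation -/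

section Closed

variable {A : OrdGroup}

theorem support_subset_of_mem_closure {B : OrdGroup} (δ : A →+ Grid B) {F : Set A} {S : Set B}
    (hF : ∀ h ∈ F, (δ h).val.support ⊆ S) {m : A} (hm : m ∈ AddSubgroup.closure F) :
    (δ m).val.support ⊆ S := by
  induction hm using AddSubgroup.closure_induction with
  | mem h hh => exact hF h hh
  | zero => simp
  | add a b _ _ ha hb =>
    rw [map_add, Grid.val_add]
    exact (support_add_subset _ _).trans (Set.union_subset ha hb)
  | neg a _ ha => rwa [map_neg, Grid.val_neg, support_neg]

/-- Each finite set of transmonomials is contained in a finite set whose logarithmic derivatives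
have their transmonomials in the group generated by it. -/
def DlogClosable (δ : A →+ Grid A) : Prop :=
  ∀ F : Finset A, ∃ F' : Finset A, F ⊆ F' ∧
    ∀ h ∈ F', (δ h).val.support ⊆ AddSubgroup.closure (F' : Set A)

theorem dlogClosable_base : DlogClosable dlogBase := fun F => by
  classical
  refine ⟨insert (-baseX) F, Finset.subset_insert _ _, fun h _ => ?_⟩
  have h1 : (dlogBase h).val = -(baseVal h • single (-baseX) (1 : ℝ)) := rfl
  rw [h1, support_neg]
  refine ((support_smul_subset _ _).trans support_single_subset).trans ?_
  rw [Set.singleton_subset_iff]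
  exact AddSubgroup.subset_closure (by simp)

theorem mem_closure_image (e : A →+ A.exp) {F : Finset A} {F' : Finset A.exp}
    (hF : ∀ a ∈ F, e a ∈ F') {a : A} (ha : a ∈ AddSubgroup.closure (F : Set A)) :
    e a ∈ AddSubgroup.closure (F' : Set A.exp) := by
  have h : AddSubgroup.closure (F : Set A) ≤ (AddSubgroup.closure (F' : Set A.exp)).comap e :=
    (AddSubgroup.closure_le _).2 fun a ha => AddSubgroup.subset_closure (hF a ha)
  exact h ha

/-- The logarithmic derivative of `x^{-σ} e^{-L}` involves only `1/x` and `L'`. It suffices to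
close, one level lower, the set formed by `x` and finitely many generators for the supports of the
exponents `L`; the elements that come from the lower level are then closed by themselves. -/
theorem DlogClosable.step {x : A} {δ : A →+ Grid A} {i : Emb A A.exp} (hδ : DlogClosable δ)
    (hx : i x = expX A) (hi : ∀ a, dlogStep i δ (i a) = i.mapGrid (δ a)) :
    DlogClosable (dlogStep i δ) := fun F => by
  classical
  choose c hc using fun m : A.exp => (largeToGrid (lpart m)).exists_subset_closure
  obtain ⟨F₁, hF₁, hcl⟩ := hδ (insert x (F.biUnion c))
  have himg : ∀ a ∈ F₁, i.toAddMonoidHom a ∈ F ∪ F₁.image i := fun a ha =>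
    Finset.mem_union_right _ (Finset.mem_image_of_mem i ha)
  have hmap : ∀ f : Grid A, f.val.support ⊆ AddSubgroup.closure (F₁ : Set A) →
      (i.mapGrid f).val.support ⊆
        AddSubgroup.closure ((F ∪ F₁.image i : Finset A.exp) : Set A.exp) := by
    intro f hf γ hγ
    obtain ⟨a, ha, rfl⟩ := i.support_mapAlg_subset _ hγ
    exact mem_closure_image i.toAddMonoidHom himg (hf ha)
  refine ⟨F ∪ F₁.image i, Finset.subset_union_left, fun h hh => ?_⟩
  rcases Finset.mem_union.1 hh with hh | hh
  · rw [dlogStep_val, support_neg]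
    refine (support_add_subset _ _).trans (Set.union_subset ?_
      (hmap (deriv δ (largeToGrid (lpart h))) ?_))
    · refine ((support_smul_subset _ _).trans support_single_subset).trans ?_
      rw [Set.singleton_subset_iff, ← hx]
      refine AddSubgroup.neg_mem _ (AddSubgroup.subset_closure ?_)
      exact himg x (hF₁ (Finset.mem_insert_self _ _))
    · intro τ hτ
      obtain ⟨m, hm, hτm⟩ := support_deriv hτ
      have h1 : m ∈ AddSubgroup.closure (F₁ : Set A) := by
        refine AddSubgroup.closure_mono (fun a ha => hF₁ ?_) (hc h hm)
        exact Finset.mem_insert_of_mem (Finset.mem_biUnion.2 ⟨h, hh, ha⟩)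
      rw [← sub_add_cancel τ m]
      exact AddSubgroup.add_mem _ (support_subset_of_mem_closure δ hcl h1 hτm) h1
  · obtain ⟨a, ha, rfl⟩ := Finset.mem_image.1 hh
    rw [hi]
    exact hmap _ (hcl a ha)

theorem dlogClosable : ∀ n, DlogClosable (dlog n)
  | 0 => dlogClosable_base
  | n + 1 => (dlogClosable n).step (incl_xMon n) (dlog_incl n)

/-- The derivation multiplied by a transmonomial. -/
def monomialMul (x : A) (δ : A →+ Grid A) : A →+ Grid A :=
  (AddMonoidHom.mulLeft (monomial x)).comp δ

theorem monomialMul_apply (x : A) (δ : A →+ Grid A) (m : A) :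
    monomialMul x δ m = monomial x * δ m := rfl

theorem deriv_monomialMul (x : A) (δ : A →+ Grid A) (f : Grid A) :
    deriv (monomialMul x δ) f = monomial x * deriv δ f := by
  apply Grid.ext
  ext τ
  rw [deriv_coeff, coeff_monomial_mul, deriv_coeff]
  refine finsum_congr fun m => ?_
  rw [monomialMul_apply, coeff_monomial_mul, sub_right_comm]

theorem DlogClosable.monomialMul {δ : A →+ Grid A} (hδ : DlogClosable δ) (x : A) :
    DlogClosable (monomialMul x δ) := fun F => by
  classical
  obtain ⟨F', hF, hcl⟩ := hδ (insert x F)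
  refine ⟨F', (Finset.subset_insert _ _).trans hF, fun h hh γ hγ => ?_⟩
  rw [monomialMul_apply, support_monomial_mul] at hγ
  rw [← sub_add_cancel γ x]
  exact AddSubgroup.add_mem _ (hcl h hh hγ)
    (AddSubgroup.subset_closure (hF (Finset.mem_insert_self _ _)))

/-- The dominant exponents of the logarithmic derivatives of a finitely generated group are
finitely many. -/
theorem finite_dord (δ : A →+ Grid A) (F : Finset A) (hne : ∀ m, m ≠ 0 → (δ m).val ≠ 0) :
    {v | ∃ m ∈ AddSubgroup.closure (F : Set A), m ≠ 0 ∧ dord δ m = v}.Finite := by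
  classical
  refine (finite_orders_span (F.image fun h => (δ h).val)).subset ?_
  rintro v ⟨m, hm, hm0, rfl⟩
  -- By additivity `δ m` is an integer combination of the `δ h`, `h ∈ F`, so it lies in a
  -- finite-dimensional space.
  refine ⟨(δ m).val, ?_, hne m hm0, rfl⟩
  clear hm0
  induction hm using AddSubgroup.closure_induction with
  | mem h hh => exact Submodule.subset_span (Finset.mem_coe.2 (Finset.mem_image_of_mem _ hh))
  | zero =>
    rw [map_zero]
    exact Submodule.zero_mem _
  | add a b _ _ ha hb =>
    rw [map_add]
    exact Submodule.add_mem _ ha hb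
  | neg a _ ha =>
    rw [map_neg]
    exact Submodule.neg_mem _ ha

end Closed

/-! ### Integration -/

section Integral

variable {A : OrdGroup}

theorem deriv_monomial_mul_coeff (δ : A →+ Grid A) (v : A) (f : Grid A) (τ : A) :
    (Function.support fun m =>
      f.val.coeff m * (δ (m - v)).val.coeff (τ - (m - v))).Finite ∧
    (deriv δ (monomial (-v) * f)).val.coeff τ =
      ∑ᶠ m, f.val.coeff m * (δ (m - v)).val.coeff (τ - (m - v)) := by
  have h : ∀ m, (monomial (-v) * f).val.coeff (m - v) = f.val.coeff m := fun m => by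
    rw [coeff_monomial_mul]
    congr 1
    abel
  constructor
  · refine ((deriv_coeff_finite δ (monomial (-v) * f) τ).preimage
      (sub_left_injective (b := v)).injOn).subset fun m hm => ?_
    show (monomial (-v) * f).val.coeff (m - v) * (δ (m - v)).val.coeff (τ - (m - v)) ≠ 0
    rw [h]
    exact hm
  · rw [deriv_coeff, ← finsum_comp_equiv (Equiv.subRight v)]
    refine finsum_congr fun m => ?_
    rw [Equiv.subRight_apply, h]

/-- Up to a constant, each series has a primitive for a derivation for which all logarithmic
derivatives are `≽ 1`. -/
theorem exists_primitive_add_const {δ : A →+ Grid A} (hne : ∀ m, m ≠ 0 → (δ m).val ≠ 0)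
    (hle : ∀ m, m ≠ 0 → dord δ m ≤ 0) (hlt : ∀ d, d < 0 → d < dord δ d) (hδ : DlogClosable δ)
    (f : Grid A) : ∃ (g : Grid A) (c : ℝ), deriv δ g = f + algebraMap ℝ (Grid A) c := by
  classical
  obtain ⟨F₀, hF₀⟩ := f.exists_subset_closure
  obtain ⟨F, hF, hcl⟩ := hδ F₀
  set Λ := AddSubgroup.closure (F : Set A) with hΛ
  have hfΛ : f.val.support ⊆ Λ := hF₀.trans (AddSubgroup.closure_mono hF)
  let S₀ : Set A := ⋃ h ∈ F, (δ h).val.support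
  have hS₀ : IsGrid S₀ := IsGrid.biUnion F fun h => (δ h).isGrid
  have hS₀Λ : S₀ ⊆ Λ := Set.iUnion₂_subset hcl
  have hsupp : ∀ m ∈ Λ, (δ m).val.support ⊆ S₀ := fun m hm =>
    support_subset_of_mem_closure δ (fun h hh =>
      Set.subset_biUnion_of_mem (u := fun h => (δ h).val.support) (Finset.mem_coe.1 hh)) hm
  have hVfin := finite_dord δ F hne
  set V := hVfin.toFinset with hV
  have hVmem : ∀ {m}, m ∈ Λ → m ≠ 0 → dord δ m ∈ V := fun hm h0 =>
    hVfin.mem_toFinset.2 ⟨_, hm, h0, rfl⟩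
  have hVΛ : ∀ v ∈ V, v ∈ Λ ∧ v ≤ 0 := fun v hv => by
    obtain ⟨m, hm, h0, rfl⟩ := hVfin.mem_toFinset.1 hv
    exact ⟨hS₀Λ (hsupp m hm (coeff_order_eq_zero.not.2 (hne m h0))), hle m h0⟩
  -- This makes the division by `v` harmless: in `(m/v)' = (m/v)(δ m - δ v)` the part `δ v` is
  -- smaller than `v`, so the dominant term is that of `(m/v) δ m`.
  have hVlt : ∀ v ∈ V, ∀ γ ∈ (δ v).val.support, v < γ := fun v hv γ hγ => by
    rcases (hVΛ v hv).2.eq_or_lt with rfl | h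
    · simp at hγ
    · exact (hlt v h).trans_le (order_le_of_coeff_ne_zero hγ)
  -- `E` contains every exponent gain `τ - m` that a correction can produce. It is a grid because
  -- `V` is finite and one grid `S₀` contains the supports of all `δ m` with `m ∈ Λ`.
  let E : Set A := ⋃ v ∈ V, {γ | γ - -v ∈ S₀ ∧ 0 < γ}
  have hE : IsGrid E := IsGrid.biUnion V fun v => (hS₀.translate (-v)).subset fun γ hγ => hγ.1
  have hEΛ : E ⊆ Λ := Set.iUnion₂_subset fun v hv γ hγ => by
    have := Λ.sub_mem (hS₀Λ hγ.1) (hVΛ v hv).1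
    rwa [sub_neg_eq_add, add_sub_cancel_right] at this
  have hEpos : ∀ γ ∈ E, 0 < γ := fun γ hγ => by
    obtain ⟨v, -, h⟩ := Set.mem_iUnion₂.1 hγ
    exact h.2
  obtain ⟨G, hGΛ, hG, hEG⟩ := hE.exists_pos_generators hEΛ hEpos
  let S : Set A := {τ | ∃ s ∈ f.val.support, τ - s ∈ AddSubmonoid.closure (G : Set A)}
  have hS : IsGrid S := (f.isGrid.add (isGrid_closure hG)).subset fun τ hτ => by
    obtain ⟨s, hs, h⟩ := hτ
    exact ⟨s, hs, τ - s, h, add_sub_cancel _ _⟩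
  have hSΛ : S ⊆ Λ := fun τ hτ => by
    obtain ⟨s, hs, h⟩ := hτ
    rw [← sub_add_cancel τ s]
    exact Λ.add_mem ((AddSubmonoid.closure_le (S := Λ.toAddSubmonoid)).2 hGΛ h) (hfΛ hs)
  have hfS : ∀ τ, τ ∉ S → f.val.coeff τ = 0 := fun τ hτ => by
    by_contra h
    exact hτ ⟨τ, h, by rw [sub_self]; exact AddSubmonoid.zero_mem _⟩
  -- `k m τ` is the coefficient at `τ` of the error `m - (m/(c v))'`, where `c v` is the dominant
  -- term of `δ m`. The monomial `m = 0` has no approximate primitive and is skipped, whence the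
  -- constant in the conclusion.
  let k : A → A → ℝ := fun m τ => if m = 0 then 0 else (if m = τ then 1 else 0) -
    (δ m).val.leadingCoeff⁻¹ * (δ (m - dord δ m)).val.coeff (τ - (m - dord δ m))
  have hk : ∀ m ∈ S, ∀ τ, k m τ ≠ 0 → m < τ ∧ τ ∈ S := by
    intro m hm τ hτ
    have hm0 : m ≠ 0 := fun h => hτ (if_pos h)
    simp only [k, if_neg hm0] at hτ
    have hv := hVmem (hSΛ hm) hm0
    set v := dord δ m with hvdef
    have hshift : τ - (m - v) = τ - m + v := by abel
    rw [map_sub, Grid.val_sub, coeff_sub, hshift] at hτ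
    have hmτ : m ≠ τ := by
      rintro rfl
      rw [if_pos rfl, sub_self, zero_add] at hτ
      have h1 : (δ v).val.coeff v = 0 := by
        by_contra h
        exact lt_irrefl _ (hVlt v hv v h)
      have h2 : (δ m).val.coeff v = (δ m).val.leadingCoeff := leadingCoeff_eq.symm
      rw [h1, sub_zero, h2, inv_mul_cancel₀ (leadingCoeff_ne_zero.2 (hne m hm0)), sub_self] at hτ
      exact hτ rfl
    rw [if_neg hmτ, zero_sub, neg_ne_zero] at hτ
    have h3 := right_ne_zero_of_mul hτ
    have h4 : τ - m + v ∈ S₀ ∧ v ≤ τ - m + v := by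
      by_cases h5 : (δ m).val.coeff (τ - m + v) = 0
      · rw [h5, zero_sub, neg_ne_zero] at h3
        exact ⟨hsupp v (hVΛ v hv).1 h3, (hVlt v hv _ h3).le⟩
      · exact ⟨hsupp m (hSΛ hm) h5, order_le_of_coeff_ne_zero h5⟩
    have h6 : 0 < τ - m :=
      lt_of_le_of_ne (le_add_iff_nonneg_left v |>.1 h4.2) fun h => hmτ (sub_eq_zero.1 h.symm).symm
    refine ⟨sub_pos.1 h6, ?_⟩
    obtain ⟨s, hs, hms⟩ := hm
    refine ⟨s, hs, ?_⟩
    rw [← sub_add_sub_cancel τ m s]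
    refine AddSubmonoid.add_mem _ (hEG ?_) hms
    refine Set.mem_iUnion₂.2 ⟨v, hv, ?_, h6⟩
    rw [sub_neg_eq_add]
    exact h4.1
  obtain ⟨h, hS0, hfix⟩ := exists_kernel_fixpoint hS.isPWO f.val.coeff hfS k hk
  -- The primitive is the sum of the `h m * m/(c v)`. Sorting the terms by `v` writes it as a finite
  -- sum of monomials times series supported in `S`, so it is visibly grid-based.
  let φ : A → A → ℝ := fun v m =>
    if m ≠ 0 ∧ dord δ m = v then h m * (δ m).val.leadingCoeff⁻¹ else 0
  have hφ : ∀ v, IsGrid (Function.support (φ v)) := fun v => hS.subset fun m hm => by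
    by_contra hc
    refine hm ?_
    simp only [φ, hS0 m hc, zero_mul, ite_self]
  let Φ : A → Grid A := fun v => Grid.mk ⟨φ v, (hφ v).isPWO⟩ (hφ v)
  let g : Grid A := ∑ v ∈ V, monomial (-v) * Φ v
  let t : A → A → A → ℝ := fun τ m v => φ v m * (δ (m - v)).val.coeff (τ - (m - v))
  have hval : ∀ (s : Finset A) (u : A → Grid A) (τ : A),
      (∑ v ∈ s, u v).val.coeff τ = ∑ v ∈ s, (u v).val.coeff τ := by
    intro s u τ
    induction s using Finset.induction_on with
    | empty => rfl
    | insert a s ha ih => rw [Finset.sum_insert ha, Finset.sum_insert ha, Grid.val_add, coeff_add, ih]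
  have hg : ∀ τ, (deriv δ g).val.coeff τ = ∑ᶠ m, ∑ v ∈ V, t τ m v := by
    intro τ
    rw [map_sum, hval, finsum_sum_comm V (t τ)
      fun v _ => (deriv_monomial_mul_coeff δ v (Φ v) τ).1]
    exact Finset.sum_congr rfl fun v _ => (deriv_monomial_mul_coeff δ v (Φ v) τ).2
  have hterm : ∀ τ m, h m * k m τ =
      (if m = τ ∧ τ ≠ 0 then h τ else 0) - ∑ v ∈ V, t τ m v := by
    intro τ m
    by_cases hm0 : m = 0
    · have h1 : ∑ v ∈ V, t τ m v = 0 := Finset.sum_eq_zero fun v _ => by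
        simp only [t, φ, hm0, ne_eq, not_true_eq_false, false_and, if_false, zero_mul]
      have h2 : ¬ (m = τ ∧ τ ≠ 0) := fun h3 => h3.2 (h3.1 ▸ hm0)
      rw [h1, if_neg h2, sub_zero]
      simp only [k, if_pos hm0, mul_zero]
    by_cases hmS : m ∈ S
    · have h1 : ∑ v ∈ V, t τ m v = t τ m (dord δ m) := by
        refine Finset.sum_eq_single_of_mem _ (hVmem (hSΛ hmS) hm0) fun v _ hv => ?_
        simp only [t, φ, hv.symm, and_false, if_false, zero_mul]
      rw [h1]
      simp only [k, t, φ, if_neg hm0, ne_eq, hm0, not_false_eq_true, and_self, if_true]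
      by_cases hmτ : m = τ
      · subst hmτ
        simp only [hm0, not_false_eq_true, and_self, if_true]
        ring
      · simp only [hmτ, false_and, if_false]
        ring
    · have h1 : ∑ v ∈ V, t τ m v = 0 := Finset.sum_eq_zero fun v _ => by
        simp only [t, φ, hS0 m hmS, zero_mul, ite_self]
      rw [h1, hS0 m hmS, zero_mul, sub_zero]
      split_ifs with h2
      · rw [← h2.1, hS0 m hmS]
      · rfl
  -- Summing the errors gives `h` without its constant coefficient, minus `g'`. At `τ ≠ 0` the
  -- values of `h` cancel and leave `g' = f`; at `τ = 0` the discrepancy becomes the constant.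
  have hdecomp : ∀ τ, h τ = f.val.coeff τ +
      ((if τ ≠ 0 then h τ else 0) - (deriv δ g).val.coeff τ) := by
    intro τ
    conv_lhs => rw [hfix τ]
    rw [finsum_congr (hterm τ), finsum_sub_distrib, ← hg, finsum_eq_single _ τ]
    · simp only [true_and]
    · intro m hm
      rw [if_neg fun h1 => hm h1.1]
    · refine (Set.finite_singleton τ).subset fun m hm => ?_
      by_contra hc
      exact hm (if_neg fun h1 => hc h1.1)
    · refine (V.finite_toSet.biUnion fun v _ =>
        (deriv_monomial_mul_coeff δ v (Φ v) τ).1).subset fun m hm => ?_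
      obtain ⟨v, hv, h1⟩ := Finset.exists_ne_zero_of_sum_ne_zero hm
      exact Set.mem_biUnion (Finset.mem_coe.2 hv) h1
  refine ⟨g, (deriv δ g).val.coeff 0 - f.val.coeff 0, Grid.ext ?_⟩
  ext τ
  rw [Grid.val_add, coeff_add, Grid.val_algebraMap, coeff_single]
  split_ifs with h0
  · rw [h0]
    ring
  · have h1 := hdecomp τ
    rw [if_pos h0] at h1
    linarith

end Integral

/-! ### Surjectivity of differentiation on all transseries -/

/-- Integrating `f` is the same as integrating `x f` for the derivation `x d/dx`. The bounds in
`LevelAsym` translate into the hypotheses of `exists_primitive_add_const`, and its constant becomes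
a multiple of `1/x`. -/
theorem exists_level_primitive (n : ℕ) (f : Grid (Mon n)) :
    ∃ (g : Grid (Mon n)) (c : ℝ), levelD n g = f + c • monomial (-xMon n) := by
  have hL := levelAsym n
  have hne : ∀ m, m ≠ 0 → dlog n m ≠ 0 := fun m hm =>
    Grid.val_ne_zero.1 (hL.isAsym.val_ne_zero hm)
  have hord : ∀ m, m ≠ 0 → dord (monomialMul (xMon n) (dlog n)) m = xMon n + dord (dlog n) m :=
    fun m hm => order_monomial_mul _ (hne m hm)
  obtain ⟨g, c, h⟩ := exists_primitive_add_const (δ := monomialMul (xMon n) (dlog n))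
    (fun m hm => by
      rw [← leadingCoeff_ne_zero, monomialMul_apply, leadingCoeff_monomial_mul]
      exact leadingCoeff_ne_zero.2 (hL.isAsym.val_ne_zero hm))
    (fun m hm => by
      rw [hord m hm, add_comm, ← le_neg_iff_add_nonpos_right]
      exact hL.dord_le m hm)
    (fun d hd => by
      rw [hord d hd.ne]
      exact sub_lt_iff_lt_add'.1 (hL.dord_dord hd))
    ((dlogClosable n).monomialMul (xMon n)) (monomial (xMon n) * f)
  refine ⟨g, c, ?_⟩
  rw [deriv_monomialMul] at h
  have h1 : monomial (-xMon n) * monomial (xMon n) = 1 := by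
    rw [← monomial_add, neg_add_cancel, monomial_zero]
  have h2 := congrArg (monomial (-xMon n) * ·) h
  simp only [mul_add, ← mul_assoc, h1, one_mul] at h2
  rw [levelD, h2, Algebra.algebraMap_eq_smul_one, mul_smul_comm, mul_one]

/-- The chain rule factor `L_0 ⋯ L_{k-1}` is itself some `q ∘ L_k` with `q` log-free, so it can be
absorbed into the integrand before composition with `L_k`. -/
theorem exists_compLog_eq_sum (k : ℕ) :
    ∃ q : LogFree, compLog k q = ∑ j ∈ Finset.range k, logMon j := by
  induction k with
  | zero => exact ⟨0, map_zero _⟩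
  | succ k ih =>
    obtain ⟨q, hq⟩ := ih
    refine ⟨logFreeUp (q + logFreeX), ?_⟩
    rw [compLog_succ, map_add, hq, Finset.sum_range_succ, logMon]

theorem D_mapGrid_levelEmb (k n : ℕ) (f : Grid (Mon n)) : D ((levelEmb k n).mapGrid f) =
    monomial (-∑ j ∈ Finset.range k, logMon j) * (levelEmb k n).mapGrid (levelD n f) :=
  deriv_mapGrid (levelEmb k n) (dlog n) dlogMon _ (dlogMon_levelEmb k n) f

theorem levelEmb_xMon (k n : ℕ) : levelEmb k n (xMon n) = logMon k := by
  rw [levelEmb, Emb.comp_apply, ofLevel_xMon, logMon]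

theorem D_logMon (k : ℕ) :
    D (monomial (logMon k)) = monomial (-∑ j ∈ Finset.range k, logMon j) := by
  have h1 : dlogMon (logMon k) = monomial (-∑ j ∈ Finset.range k, logMon j) *
      monomial (-logMon k) := by
    rw [← levelEmb_xMon k 0, dlogMon_levelEmb, dlog_xMon, Emb.mapGrid_monomial, map_neg]
  rw [D, deriv_monomial, h1, mul_left_comm, ← monomial_add, add_neg_cancel, monomial_zero, mul_one]

theorem exists_D_eq (T : TSeries) : ∃ Y, D Y = T := by
  obtain ⟨k, t, rfl⟩ :=
    exists_mapGrid_toSeqLim (A := fun _ => LogFree) (fun _ => logFreeUp) T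
  obtain ⟨q, hq⟩ := exists_compLog_eq_sum k
  obtain ⟨n, f, hf⟩ := exists_mapGrid_toSeqLim incl (t * monomial q)
  obtain ⟨g, c, hg⟩ := exists_level_primitive n f
  have h1 : (levelEmb k n).mapGrid f =
      (compLog k).mapGrid t * monomial (∑ j ∈ Finset.range k, logMon j) := by
    rw [← hq, ← Emb.mapGrid_monomial, ← map_mul, levelEmb, Emb.mapGrid_comp]
    exact congrArg (compLog k).mapGrid hf.symm
  -- The leftover `c/x`, composed with `L_k` and multiplied by the chain rule factor, is `c/(L_0 ⋯
  -- L_k)`, which is the derivative of `c L_{k+1}`.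
  refine ⟨(levelEmb k n).mapGrid g - c • monomial (logMon (k + 1)), ?_⟩
  rw [map_sub, map_smul, D_mapGrid_levelEmb, hg, D_logMon, map_add, map_smul,
    Emb.mapGrid_monomial, map_neg, levelEmb_xMon, h1, mul_add, mul_smul_comm, ← monomial_add,
    Finset.sum_range_succ, neg_add, add_sub_cancel_right, mul_left_comm, ← monomial_add,
    neg_add_cancel, monomial_zero, mul_one]
  rfl

/-! ### The primitive without constant term -/

theorem D_mul (S T : TSeries) : D (S * T) = D S * T + S * D T := deriv_mul dlogMon S T

theorem NoConst.sub {S T : TSeries} (hS : NoConst S) (hT : NoConst T) : NoConst (S - T) := by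
  rw [noConst_iff] at *
  rw [Grid.val_sub, coeff_sub, hS, hT, sub_zero]

theorem NoConst.add {S T : TSeries} (hS : NoConst S) (hT : NoConst T) : NoConst (S + T) := by
  rw [noConst_iff] at *
  rw [Grid.val_add, coeff_add, hS, hT, add_zero]

theorem NoConst.smul {T : TSeries} (hT : NoConst T) (r : ℝ) : NoConst (r • T) := by
  rw [noConst_iff] at *
  rw [Grid.val_smul, coeff_smul, hT, smul_zero]

/-- A nonzero series without constant term has nonzero derivative. This also makes `primitive`
linear although it is defined by choice. -/
theorem NoConst.eq_of_D_eq {S T : TSeries} (hS : NoConst S) (hT : NoConst T) (h : D S = D T) :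
    S = T := by
  by_contra hne
  refine isAsym_dlogMon.deriv_ne_zero (sub_ne_zero.2 hne) (noConst_iff.1 (hS.sub hT)) ?_
  rw [map_sub]
  exact sub_eq_zero.2 h

theorem exists_noConst_D_eq (T : TSeries) : ∃ Y, NoConst Y ∧ D Y = T := by
  obtain ⟨Y, hY⟩ := exists_D_eq T
  exact ⟨dropConst Y, noConst_dropConst Y, (D_dropConst Y).trans hY⟩

/-- The primitive without constant term. -/
def primitive : TSeries →ₗ[ℝ] TSeries where
  toFun T := (exists_noConst_D_eq T).choose
  map_add' S T := by
    have hS := (exists_noConst_D_eq S).choose_spec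
    have hT := (exists_noConst_D_eq T).choose_spec
    have h := (exists_noConst_D_eq (S + T)).choose_spec
    refine h.1.eq_of_D_eq (hS.1.add hT.1) ?_
    rw [h.2, map_add, hS.2, hT.2]
  map_smul' r T := by
    have hT := (exists_noConst_D_eq T).choose_spec
    have h := (exists_noConst_D_eq (r • T)).choose_spec
    refine h.1.eq_of_D_eq (hT.1.smul r) ?_
    rw [h.2, RingHom.id_apply, map_smul, hT.2]

theorem noConst_primitive (T : TSeries) : NoConst (primitive T) :=
  (exists_noConst_D_eq T).choose_spec.1

@[simp] theorem D_primitive (T : TSeries) : D (primitive T) = T :=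
  (exists_noConst_D_eq T).choose_spec.2

theorem primitive_eq {S T : TSeries} (hS : NoConst S) (h : D S = T) : primitive T = S :=
  (noConst_primitive T).eq_of_D_eq hS ((D_primitive T).trans h.symm)

theorem primitive_D (T : TSeries) : primitive (D T) = dropConst T :=
  primitive_eq (noConst_dropConst T) (D_dropConst T)

/-- Integration by parts: `primitive_D` applied to the Leibniz rule. -/
theorem primitive_mul_D (S T : TSeries) :
    primitive (S * D T) = dropConst (S * T) - primitive (D S * T) := by
  rw [eq_sub_iff_add_eq, ← map_add, ← primitive_D, D_mul, add_comm]

/-! ### Order and sign of the primitive -/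

theorem primitive_ne_zero {T : TSeries} (hT : T ≠ 0) : primitive T ≠ 0 := fun h =>
  hT (by rw [← D_primitive T, h, map_zero])

theorem order_eq_primitive {T : TSeries} (hT : T ≠ 0) : T.val.order =
    (primitive T).val.order + dord dlogMon (primitive T).val.order := by
  conv_lhs => rw [← D_primitive T]
  exact isAsym_dlogMon.order_deriv (primitive_ne_zero hT) (noConst_iff.1 (noConst_primitive T))

theorem leadingCoeff_eq_primitive {T : TSeries} (hT : T ≠ 0) : T.val.leadingCoeff =
    (primitive T).val.leadingCoeff * (dlogMon (primitive T).val.order).val.leadingCoeff := by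
  conv_lhs => rw [← D_primitive T]
  exact isAsym_dlogMon.leadingCoeff_deriv (primitive_ne_zero hT)
    (noConst_iff.1 (noConst_primitive T))

theorem order_primitive_ne_zero {T : TSeries} (hT : T ≠ 0) : (primitive T).val.order ≠ 0 :=
  IsAsym.order_ne_zero (primitive_ne_zero hT) (noConst_iff.1 (noConst_primitive T))

theorem dominates_iff {S T : TSeries} (hS : S ≠ 0) (hT : T ≠ 0) :
    Dominates S T ↔ S.val.order < T.val.order := by
  rw [Dominates, ← order_eq_orderTop_of_ne_zero (Grid.val_ne_zero.2 hS),
    ← order_eq_orderTop_of_ne_zero (Grid.val_ne_zero.2 hT), WithTop.coe_lt_coe]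

theorem Dominates.ne_zero {S T : TSeries} (h : Dominates S T) : S ≠ 0 := by
  rintro rfl
  rw [Dominates, Grid.val_zero, orderTop_zero] at h
  exact not_top_lt h

theorem Pos.ne_zero {T : TSeries} (h : Pos T) : T ≠ 0 := by
  rintro rfl
  rw [Pos, Grid.val_zero, leadingCoeff_zero] at h
  exact lt_irrefl _ h

/-- The orders of `S` and `T` are the images of the orders of their primitives under the increasing
map `m ↦ m + ψ m`, so the comparison is reflected. -/
theorem Dominates.primitive {S T : TSeries} (h : Dominates S T) :
    Dominates (primitive S) (primitive T) := by
  have hS := h.ne_zero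
  by_cases hT : T = 0
  · rw [hT, map_zero, Dominates, Grid.val_zero, orderTop_zero, orderTop_lt_top]
    exact Grid.val_ne_zero.2 (primitive_ne_zero hS)
  · rw [dominates_iff hS hT, order_eq_primitive hS, order_eq_primitive hT,
      isAsym_dlogMon.add_dord_lt_iff (order_primitive_ne_zero hS) (order_primitive_ne_zero hT)] at h
    exact (dominates_iff (primitive_ne_zero hS) (primitive_ne_zero hT)).2 h

theorem Pos.primitive_of_order_neg {T : TSeries} (hT : Pos T)
    (h : (primitive T).val.order < 0) : Pos (primitive T) := by
  have h1 := leadingCoeff_eq_primitive hT.ne_zero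
  rw [Pos] at hT ⊢
  rw [h1] at hT
  exact pos_of_mul_pos_left hT (isAsym_dlogMon.leadingCoeff_pos h).le

theorem Pos.primitive_of_large {T : TSeries} (hT : Pos T) (h : Dominates (primitive T) 1) :
    Pos (primitive T) := by
  refine hT.primitive_of_order_neg ?_
  rwa [dominates_iff h.ne_zero (Grid.val_ne_zero.1 one_ne_zero), Grid.val_one, order_one] at h

theorem Pos.neg_primitive_of_small {T : TSeries} (hT : Pos T) (h : Dominates 1 (primitive T)) :
    Pos (-primitive T) := by
  rw [dominates_iff h.ne_zero (primitive_ne_zero hT.ne_zero), Grid.val_one, order_one] at h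
  have h1 := leadingCoeff_eq_primitive hT.ne_zero
  have h2 := isAsym_dlogMon.leadingCoeff_neg _ h
  rw [Pos] at hT ⊢
  rw [h1] at hT
  rw [Grid.val_neg, leadingCoeff_neg, neg_pos]
  exact neg_of_mul_pos_left hT h2.le

theorem logMon_neg (k : ℕ) : logMon k < 0 := by
  rw [← levelEmb_xMon k 0, ← map_zero (levelEmb k 0)]
  exact (levelEmb k 0).strictMono (xMon_neg 0)

/-- This is `1/x = (log x)'` read on exponents. It exhibits `1/x` as the value of `m ↦ m + ψ m` at a
large monomial, which makes the primitive of anything not `≪ 1/x` large. -/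
theorem neg_logMon_zero_eq : -logMon 0 = logMon 1 + dord dlogMon (logMon 1) := by
  have h : (monomial (logMon 1) : TSeries).val.order = logMon 1 := order_single one_ne_zero
  have h1 := isAsym_dlogMon.order_deriv (f := monomial (logMon 1))
    (Grid.val_ne_zero.1 (single_ne_zero one_ne_zero))
    (coeff_single_of_ne (logMon_neg 1).ne')
  rw [h] at h1
  rw [← h1]
  show _ = (D (monomial (logMon 1))).val.order
  rw [D_logMon, Finset.sum_range_one]
  exact (order_single one_ne_zero).symm

theorem Pos.primitive_of_not_dominates {T : TSeries} (hT : Pos T) (h : ¬ Dominates xInv T) :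
    Pos (primitive T) := by
  have hx : xInv ≠ 0 := Grid.val_ne_zero.1 (single_ne_zero one_ne_zero)
  have hxo : xInv.val.order = -logMon 0 := order_single one_ne_zero
  refine hT.primitive_of_order_neg ?_
  rw [dominates_iff hx hT.ne_zero, hxo, neg_logMon_zero_eq, order_eq_primitive hT.ne_zero,
    isAsym_dlogMon.add_dord_lt_iff (logMon_neg 1).ne (order_primitive_ne_zero hT.ne_zero)] at h
  exact (not_lt.1 h).trans_lt (logMon_neg 1)

/-! ### Dominance of the transmonomials of exact level -/

/-- Not all monomials of `L` come from level `n`, since otherwise `L` would. One that does not is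
large, hence beyond level `n`, and the dominant one is at least as large. The hypothesis `h` is the
conclusion of `lt_incl` for `n`, kept as an assumption so that this can be used inside its
induction. -/
theorem order_lt_incl {n : ℕ}
    (h : ∀ m : Mon (n + 1), m < 0 → m ∉ Set.range (incl n) → ∀ c, m < incl n c)
    {L : Large (Mon (n + 1))} (hL : L ∉ Set.range (incl n).mapLarge) (c : Mon n) :
    (largeToGrid L).val.order < incl n c := by
  obtain ⟨γ, hγ, hr⟩ : ∃ γ ∈ (largeToGrid L).val.support, γ ∉ Set.range (incl n) := by
    by_contra! hsub
    obtain ⟨g, hg⟩ := exists_mapGrid_of_support_subset (incl n) (largeToGrid L) hsub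
    have hval : (incl n).mapAlg g.val = ofLex L.1 := congrArg Grid.val hg
    refine hL ⟨⟨toLex g.val, g.isGrid, fun γ hγ => ?_⟩, Subtype.ext hval⟩
    have h1 : incl n γ < 0 := L.2.2 _ (by
      rw [← hval, mem_support, Emb.mapAlg_coeff]
      exact hγ)
    rwa [← map_zero (incl n), (incl n).strictMono.lt_iff_lt] at h1
  exact (order_le_of_coeff_ne_zero hγ).trans_lt (h γ (L.2.2 γ hγ) hr c)

theorem lt_of_lpart_lt {A : OrdGroup} {a b : A.exp} (h : 0 < lpart b - lpart a) : a < b := by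
  rw [← sub_pos]
  refine exp_pos_iff.2 (Or.inl ?_)
  rwa [map_sub]

theorem neg_lpart_pos {A : OrdGroup} {m : A.exp} (hm : m < 0) (h0 : lpart m ≠ 0) :
    0 < -lpart m := by
  rcases exp_pos_iff.1 (neg_pos.2 hm) with h | ⟨h, -⟩
  · rwa [map_neg] at h
  · rw [map_neg, neg_eq_zero] at h
    exact absurd h h0

/-- A large monomial of exact level `n + 1` exceeds every monomial of level `n`. Passing to
exponents reduces this to the dominance of large series, which is `order_lt_incl` one level lower;
at the bottom, an exponential beats all powers of `x`. -/
theorem lt_incl : ∀ (n : ℕ) (m : Mon (n + 1)), m < 0 → m ∉ Set.range (incl n) →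
    ∀ c, m < incl n c := by
  intro n
  induction n with
  | zero =>
    intro m hm hr c
    have hL : lpart m ≠ 0 := fun h => hr ⟨spart m, by
      show expMk 0 (spart m) = m
      rw [← h]
      rfl⟩
    refine lt_of_lpart_lt (A := Mon 0) ?_
    have h1 : lpart (incl 0 c) = 0 := rfl
    rw [h1, zero_sub]
    exact neg_lpart_pos hm hL
  | succ n ih =>
    intro m hm hr c
    have hL : lpart m ∉ Set.range (incl n).mapLarge := by
      rintro ⟨K, hK⟩
      refine hr ⟨expMk K (spart m), ?_⟩
      show expMk ((incl n).mapLarge K) (spart m) = m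
      rw [hK]
      rfl
    have hL0 : lpart m ≠ 0 := fun h => hL ⟨0, by rw [map_zero, h]⟩
    have hpos : 0 < -lpart m := neg_lpart_pos hm hL0
    refine lt_of_lpart_lt (A := Mon (n + 1)) ?_
    have h1 : lpart (incl (n + 1) c) = (incl n).mapLarge (lpart c) := rfl
    rw [h1, sub_eq_add_neg, Large.pos_iff, map_add, Grid.val_add,
      leadingCoeff_add_eq_right]
    · exact Large.pos_iff.1 hpos
    · rw [map_neg, Grid.val_neg, orderTop_neg,
        ← order_eq_orderTop_of_ne_zero (Grid.val_ne_zero.2 (largeToGrid_ne_zero hL0))]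
      by_cases hK : lpart c = 0
      · rw [hK, map_zero, map_zero, Grid.val_zero, orderTop_zero]
        exact WithTop.coe_lt_top _
      · have hKv := Grid.val_ne_zero.2 (largeToGrid_ne_zero hK)
        rw [Emb.toGrid_mapLarge, Emb.val_mapGrid,
          ← order_eq_orderTop_of_ne_zero ((incl n).mapAlg_ne_zero hKv), (incl n).order_mapAlg hKv,
          WithTop.coe_lt_coe]
        exact order_lt_incl ih hL _

/-- The logarithmic derivative of `x^{-σ} e^{-K}` is built from `1/x` and `K'`, both of level `n`.
-/
theorem exists_dord_eq_incl {n : ℕ} {b : Mon (n + 1)} (hb : b ≠ 0) :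
    ∃ c, dord (dlog (n + 1)) b = incl n c := by
  by_cases h : lpart b = 0
  · refine ⟨-xMon n, ?_⟩
    rw [map_neg, incl_xMon]
    exact dord_dlogStep_of_lpart_eq_zero h hb
  · exact ⟨_, dord_dlogStep (levelAsym n) (incl_xMon n) h⟩

/-- The derivative of a large series of exact level `n + 1` dominates the logarithmic derivatives
of all transmonomials of that level. -/
theorem order_levelD_lt_dord {n : ℕ} {L : Large (Mon (n + 1))}
    (hL : L ∉ Set.range (incl n).mapLarge) {b : Mon (n + 1)} (hb : b ≠ 0) :
    (levelD (n + 1) (largeToGrid L)).val.order < dord (dlog (n + 1)) b := by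
  have hL0 : L ≠ 0 := fun h => hL ⟨0, by rw [map_zero, h]⟩
  obtain ⟨c, hc⟩ := exists_dord_eq_incl hb
  obtain ⟨d, hd⟩ := exists_dord_eq_incl (Large.order_neg hL0).ne
  -- The order of `L'` is that of `L` plus a value of `ψ`. Both values of `ψ` come from level `n`,
  -- so the claim reduces to the order of `L` being beyond level `n`.
  rw [levelD, (levelAsym (n + 1)).isAsym.order_deriv (largeToGrid_ne_zero hL0)
    (Large.coeff_zero L), hd, hc, ← lt_sub_iff_add_lt, ← map_sub]
  exact order_lt_incl (lt_incl n) hL _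

/-! ### Contractive operators -/

section Contractive

variable {A : OrdGroup}

/-- The operator `f ↦ w f' - u f`. -/
def firstOrderOp (δ : A →+ Grid A) (w u : Grid A) : Grid A →ₗ[ℝ] Grid A :=
  (LinearMap.mulLeft ℝ w).comp (deriv δ) - (LinearMap.mulLeft ℝ u).comp LinearMap.id

theorem firstOrderOp_apply (δ : A →+ Grid A) (w u f : Grid A) :
    firstOrderOp δ w u f = w * deriv δ f - u * f := rfl

theorem isTermwise_firstOrderOp (δ : A →+ Grid A) (w u : Grid A) :
    IsTermwise (firstOrderOp δ w u) :=
  ((isTermwise_deriv δ).mul_left w).sub (isTermwise_id.mul_left u)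

variable {δ : A →+ Grid A} {w u : Grid A}

theorem support_firstOrderOp_monomial {m γ : A}
    (h : γ ∈ (firstOrderOp δ w u (monomial m)).val.support) :
    γ - m ∈ (w * δ m).val.support ∪ u.val.support := by
  have h1 : firstOrderOp δ w u (monomial m) = monomial m * (w * δ m - u) := by
    rw [firstOrderOp_apply, deriv_monomial]
    ring
  rw [h1, support_monomial_mul] at h
  exact support_sub_subset _ _ h

theorem lt_of_mem_support_firstOrderOp (hw : ∀ b, ∀ γ ∈ (w * δ b).val.support, 0 < γ)
    (hu : ∀ γ ∈ u.val.support, 0 < γ) {m γ : A}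
    (h : γ ∈ (firstOrderOp δ w u (monomial m)).val.support) : m < γ := by
  rcases support_firstOrderOp_monomial h with h | h
  · exact sub_pos.1 (hw m _ h)
  · exact sub_pos.1 (hu _ h)

/-- On a monomial the operator is multiplication by `w δ m - u`. For `m` in a `Λ` closed under
logarithmic differentiation, the supports of all these multipliers lie in the grid `E` of small
exponents. Taking `G` inside `Λ` matters: products of its elements then remain monomials to which
the bound applies. -/
theorem exists_contractive_generators (hδ : DlogClosable δ)
    (hw : ∀ b, ∀ γ ∈ (w * δ b).val.support, 0 < γ) (hu : ∀ γ ∈ u.val.support, 0 < γ)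
    (F : Finset A) : ∃ (Λ : AddSubgroup A) (G : Finset A), (F : Set A) ⊆ Λ ∧ (G : Set A) ⊆ Λ ∧
      (∀ g ∈ G, 0 < g) ∧ u.val.support ⊆ AddSubmonoid.closure (G : Set A) ∧
      ∀ m ∈ Λ, ∀ γ ∈ (firstOrderOp δ w u (monomial m)).val.support,
        γ - m ∈ AddSubmonoid.closure (G : Set A) := by
  classical
  obtain ⟨W, hW⟩ := w.exists_subset_closure
  obtain ⟨U, hU⟩ := u.exists_subset_closure
  obtain ⟨F', hF', hcl⟩ := hδ (F ∪ (W ∪ U))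
  set Λ := AddSubgroup.closure (F' : Set A) with hΛ
  have hsub : ∀ X : Finset A, X ⊆ F ∪ (W ∪ U) →
      (AddSubgroup.closure (X : Set A) : Set A) ⊆ Λ := fun X hX =>
    AddSubgroup.closure_mono (Finset.coe_subset.2 (hX.trans hF'))
  have hWΛ : w.val.support ⊆ Λ := hW.trans (hsub W fun a ha => by simp [ha])
  have hUΛ : u.val.support ⊆ Λ := hU.trans (hsub U fun a ha => by simp [ha])
  have hFΛ : (F : Set A) ⊆ Λ :=
    AddSubgroup.subset_closure.trans (hsub F Finset.subset_union_left)
  let E : Set A := (⋃ h ∈ F', (w * δ h).val.support) ∪ u.val.support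
  have hE : IsGrid E := (IsGrid.biUnion F' fun h => (w * δ h).isGrid).union u.isGrid
  have hEΛ : E ⊆ Λ := by
    refine Set.union_subset (Set.iUnion₂_subset fun h hh γ hγ => ?_) hUΛ
    obtain ⟨a, ha, b, hb, rfl⟩ := support_mul_subset hγ
    exact Λ.add_mem (hWΛ ha) (hcl h hh hb)
  have hEpos : ∀ γ ∈ E, 0 < γ := by
    rintro γ (hγ | hγ)
    · obtain ⟨h, -, hγ⟩ := Set.mem_iUnion₂.1 hγ
      exact hw h γ hγ
    · exact hu γ hγ
  obtain ⟨G, hGΛ, hG, hEG⟩ := hE.exists_pos_generators hEΛ hEpos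
  refine ⟨Λ, G, hFΛ, hGΛ, hG, Set.subset_union_right.trans hEG, fun m hm γ hγ => hEG ?_⟩
  rcases support_firstOrderOp_monomial hγ with h | h
  · refine Or.inl (support_subset_of_mem_closure ((AddMonoidHom.mulLeft w).comp δ)
      (fun h hh => ?_) hm h)
    exact Set.subset_biUnion_of_mem (u := fun h => (w * δ h).val.support) (Finset.mem_coe.1 hh)
  · exact Or.inr h

theorem isContractive_firstOrderOp (hδ : DlogClosable δ)
    (hw : ∀ b, ∀ γ ∈ (w * δ b).val.support, 0 < γ) (hu : ∀ γ ∈ u.val.support, 0 < γ) :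
    IsContractive (firstOrderOp δ w u) := by
  classical
  refine ⟨fun N ν hν => ?_, (isTermwise_firstOrderOp δ w u).coeff⟩
  obtain ⟨Λ, G, hFΛ, hGΛ, hG, -, hJ⟩ :=
    exists_contractive_generators hδ hw hu (Finset.univ.image ν)
  -- The completed family consists of the given monomials and `G`. All its products lie in `Λ`, and
  -- each gain is an `ℕ`-combination of `G`, nonzero because exponents strictly increase.
  let T : Finset A := Finset.univ.image ν ∪ G
  let μ : Fin T.card → A := fun i => (T.equivFin.symm i).1
  have hμT : ∀ i, μ i ∈ T := fun i => (T.equivFin.symm i).2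
  have hrange : ∀ a ∈ T, a ∈ Set.range μ := fun a ha =>
    ⟨T.equivFin ⟨a, ha⟩, by simp [μ]⟩
  refine ⟨T.card, μ, fun i => ?_, ?_, fun j γ hγ => ?_⟩
  · rcases Finset.mem_union.1 (hμT i) with h | h
    · obtain ⟨i', -, h⟩ := Finset.mem_image.1 h
      rw [← h]
      exact hν i'
    · exact hG _ h
  · rintro _ ⟨i, rfl⟩
    exact hrange _ (Finset.mem_union_left _ (Finset.mem_image_of_mem _ (Finset.mem_univ i)))
  · have hm : ∑ i, j i • μ i ∈ Λ := AddSubgroup.sum_mem _ fun i _ => AddSubgroup.zsmul_mem _ (by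
      rcases Finset.mem_union.1 (hμT i) with h | h
      exacts [hFΛ h, hGΛ h]) _
    have h1 := AddSubmonoid.closure_mono
      (fun a ha => hrange a (Finset.mem_union_right _ ha)) (hJ _ hm γ hγ)
    obtain ⟨p, hp⟩ := AddSubmonoid.exists_of_mem_closure_range μ _ h1
    refine ⟨p, ?_, ?_⟩
    · rintro rfl
      have h2 := lt_of_mem_support_firstOrderOp hw hu hγ
      rw [← sub_pos, hp] at h2
      simp at h2
    · rw [← sub_add_cancel γ (∑ i, j i • μ i), hp, ← Finset.sum_add_distrib]
      refine Finset.sum_congr rfl fun i _ => ?_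
      rw [add_smul, natCast_zsmul, add_comm]

theorem exists_fixpoint_firstOrderOp (hδ : DlogClosable δ)
    (hw : ∀ b, ∀ γ ∈ (w * δ b).val.support, 0 < γ) (hu : ∀ γ ∈ u.val.support, 0 < γ) :
    ∃ Δ : Grid A, (∀ γ ∈ Δ.val.support, 0 < γ) ∧ ∀ f, f = -u + firstOrderOp δ w u f ↔ f = Δ := by
  obtain ⟨Λ, G, -, hGΛ, hG, huG, hJ⟩ := exists_contractive_generators hδ hw hu ∅
  -- Excluding `0` from `S` makes the solution small.
  let S : Set A := {s | s ∈ AddSubmonoid.closure (G : Set A) ∧ 0 < s}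
  have hS : IsGrid S := (isGrid_closure hG).subset fun s hs => hs.1
  have hlt : ∀ m γ, (firstOrderOp δ w u (monomial m)).val.coeff γ ≠ 0 → m < γ := fun m γ h =>
    lt_of_mem_support_firstOrderOp hw hu h
  obtain ⟨h, hS0, hfix⟩ := exists_kernel_fixpoint hS.isPWO (fun τ => (-u).val.coeff τ)
    (fun τ hτ => by
      by_contra hc
      rw [Grid.val_neg, coeff_neg, neg_eq_zero] at hc
      exact hτ ⟨huG hc, hu τ hc⟩)
    (fun m τ => (firstOrderOp δ w u (monomial m)).val.coeff τ)
    (fun m hm τ hτ => by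
      have h1 := hlt m τ hτ
      refine ⟨h1, ?_, hm.2.trans h1⟩
      have h2 : m ∈ Λ := (AddSubmonoid.closure_le (S := Λ.toAddSubmonoid)).2 hGΛ hm.1
      rw [← sub_add_cancel τ m]
      exact AddSubmonoid.add_mem _ (hJ m h2 τ hτ) hm.1)
  have hgrid : IsGrid (Function.support h) := hS.subset fun τ hτ => by
    by_contra hc
    exact hτ (hS0 τ hc)
  let Δ : Grid A := Grid.mk ⟨h, hgrid.isPWO⟩ hgrid
  have hΔ : Δ = -u + firstOrderOp δ w u Δ := by
    apply Grid.ext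
    ext τ
    rw [Grid.val_add, coeff_add, ((isTermwise_firstOrderOp δ w u).coeff Δ τ).2]
    exact hfix τ
  refine ⟨Δ, fun γ hγ => ?_, fun f => ⟨fun hf => ?_, fun hf => by rw [hf]; exact hΔ⟩⟩
  · by_contra hc
    exact hγ (hS0 γ fun h => hc h.2)
  · have hd : f - Δ = firstOrderOp δ w u (f - Δ) := by
      rw [map_sub]
      conv_lhs => rw [hf, hΔ]
      abel
    by_contra hne
    have h0 : (f - Δ).val.coeff (f - Δ).val.order ≠ 0 :=
      coeff_order_eq_zero.not.2 (Grid.val_ne_zero.2 (sub_ne_zero.2 hne))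
    refine h0 ?_
    conv_lhs => rw [hd]
    rw [((isTermwise_firstOrderOp δ w u).coeff _ _).2]
    refine finsum_eq_zero_of_forall_eq_zero fun m => ?_
    by_contra hm
    rw [← hd] at hm
    exact absurd (hlt m _ (right_ne_zero_of_mul hm))
      (not_lt.2 (order_le_of_coeff_ne_zero (left_ne_zero_of_mul hm)))

end Contractive

/-! ### Primitives of exponentials -/

section ExpNeg

variable {n : ℕ} {L : Large (Mon (n + 1))} {w : Grid (Mon (n + 1))}

theorem le_of_mem_support_inv (hw : levelD (n + 1) (largeToGrid L) * w = 1)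
    {γ : Mon (n + 1)} (hγ : γ ∈ w.val.support) :
    -(levelD (n + 1) (largeToGrid L)).val.order ≤ γ := by
  have h1 : (levelD (n + 1) (largeToGrid L)).val * w.val = 1 := congrArg Grid.val hw
  have h2 := congrArg HahnSeries.order h1
  rw [order_mul (left_ne_zero_of_mul (h1.trans_ne one_ne_zero))
    (right_ne_zero_of_mul (h1.trans_ne one_ne_zero)), order_one] at h2
  rw [neg_eq_of_add_eq_zero_right h2]
  exact order_le_of_coeff_ne_zero hγ

theorem pos_of_mem_support_inv_mul_dlog (hL : L ∉ Set.range (incl n).mapLarge)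
    (hw : levelD (n + 1) (largeToGrid L) * w = 1) (b γ : Mon (n + 1))
    (hγ : γ ∈ (w * dlog (n + 1) b).val.support) : 0 < γ := by
  obtain ⟨p, hp, q, hq, rfl⟩ := support_mul_subset hγ
  have hb : b ≠ 0 := by
    rintro rfl
    rw [map_zero] at hq
    exact hq rfl
  have h1 := le_of_mem_support_inv hw hp
  have h2 := (order_levelD_lt_dord hL hb).trans_le (order_le_of_coeff_ne_zero hq)
  have := add_lt_add_of_le_of_lt h1 h2
  rwa [neg_add_cancel] at this

/-- Let `o` be the order of `L'`. Each monomial of `L''` is one of `L'`, with exponent at least `o`,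
times one from its logarithmic derivative, with exponent greater than `o`. Hence `L'' ≪ (L')²`. -/
theorem pos_of_mem_support_levelD_levelD (hL : L ∉ Set.range (incl n).mapLarge)
    (hw : levelD (n + 1) (largeToGrid L) * w = 1) (γ : Mon (n + 1))
    (hγ : γ ∈ (levelD (n + 1) (levelD (n + 1) (largeToGrid L)) * w ^ 2).val.support) :
    0 < γ := by
  rw [pow_two] at hγ
  obtain ⟨p, hp, q, hq, rfl⟩ := support_mul_subset hγ
  obtain ⟨a, ha, b, hb, rfl⟩ := support_mul_subset hq
  obtain ⟨m, hm, hpm⟩ := support_deriv hp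
  have hm0 : m ≠ 0 := by
    rintro rfl
    simp at hpm
  have h1 := (order_levelD_lt_dord hL hm0).trans_le (order_le_of_coeff_ne_zero hpm)
  have h2 := order_le_of_coeff_ne_zero hm
  have h3 := add_lt_add_of_lt_of_le h1 h2
  rw [sub_add_cancel] at h3
  have h4 := add_lt_add_of_lt_of_le h3
    (add_le_add (le_of_mem_support_inv hw ha) (le_of_mem_support_inv hw hb))
  have h5 : ∀ o : Mon (n + 1), o + o + (-o + -o) = 0 := fun o => by abel
  rwa [h5] at h4

theorem D_expNeg (n : ℕ) (L : Large (Mon n)) : D (expNeg n L) =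
    -(ofLevelSeries n (levelD n (largeToGrid L)) * expNeg n L) := by
  have h0 : ∀ m : Mon (n + 1), dlogMon (levelEmb 0 (n + 1) m) =
      (levelEmb 0 (n + 1)).mapGrid (dlog (n + 1) m) := fun m => by
    rw [dlogMon_levelEmb, Finset.sum_range_zero, neg_zero, monomial_zero, one_mul]
  have h1 : (levelEmb 0 (n + 1)).comp (incl n) = (compLog 0).comp (ofLevel n) :=
    DFunLike.ext _ _ fun m => congrArg (compLog 0) (ofLevel_succ n m)
  have h : dlogMon (levelEmb 0 (n + 1) (expMk L 0 : (Mon n).exp)) =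
      -ofLevelSeries n (levelD n (largeToGrid L)) := by
    have h3 : dlogStep (incl n) (dlog n) (expMk L 0) =
        -(incl n).mapGrid (levelD n (largeToGrid L)) := by
      refine (dlogStep_apply (A := Mon n) (incl n) (dlog n) (expMk L 0)).trans ?_
      rw [spart_mk, zero_smul, zero_add]
      rfl
    refine ((h0 _).trans (congrArg (levelEmb 0 (n + 1)).mapGrid h3)).trans ?_
    rw [map_neg, ← Emb.mapGrid_comp, h1]
    rfl
  have h2 : expNeg n L = monomial (levelEmb 0 (n + 1) (expMk L 0 : (Mon n).exp)) := rfl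
  rw [h2, D, deriv_monomial, h, mul_neg, mul_comm]

/-- The constant coefficient of `e^{-L} z` is the coefficient of `e^{L}` in `z`. It vanishes because
`e^{L}` is of level `n + 1` only if `L` is of level `n`. -/
theorem noConst_expNeg_mul (hL : L ∉ Set.range (incl n).mapLarge) (z : Grid (Mon (n + 1))) :
    NoConst (expNeg (n + 1) L * ofLevelSeries (n + 1) z) := by
  rw [noConst_iff, expNeg, coeff_monomial_mul]
  refine Emb.mapAlg_coeff_of_notMem ((compLog 0).comp (ofLevel (n + 1))) z.val ?_
  rintro ⟨b, hb⟩
  have hb' : levelEmb 0 (n + 1) b = levelEmb 0 (n + 2) (-(expMk L 0 : (Mon (n + 1)).exp)) :=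
    (hb.trans (zero_sub _)).trans (map_neg (levelEmb 0 (n + 2)) _).symm
  have h1 : ofLevel (n + 1) b = ofLevel (n + 2) (-(expMk L 0 : (Mon (n + 1)).exp)) :=
    (compLog 0).strictMono.injective hb'
  rw [← ofLevel_succ] at h1
  have h2 := (ofLevel (n + 2)).strictMono.injective h1
  have h3 : (incl n).mapLarge (lpart b) = -L := congrArg lpart h2
  exact hL ⟨-lpart b, by rw [map_neg, h3, neg_neg]⟩

theorem exists_primitive_expNeg (hL : L ∉ Set.range (incl n).mapLarge) :
    ∃ (J : Grid (Mon (n + 1)) →ₗ[ℝ] Grid (Mon (n + 1))) (Δ₀ Δ : Grid (Mon (n + 1))),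
      (∀ f, (levelD (n + 1) (largeToGrid L)) ^ 2 * J f =
        levelD (n + 1) (largeToGrid L) * levelD (n + 1) f
          - levelD (n + 1) (levelD (n + 1) (largeToGrid L)) * f) ∧
      (levelD (n + 1) (largeToGrid L)) ^ 2 * Δ₀ =
        - levelD (n + 1) (levelD (n + 1) (largeToGrid L)) ∧
      IsContractive J ∧
      (∀ f, f = Δ₀ + J f ↔ f = Δ) ∧
      Dominates 1 (ofLevelSeries (n + 1) Δ) ∧
      D (ofLevelSeries (n + 1) (largeToGrid L)) * primitive (expNeg (n + 1) L) =
        - (expNeg (n + 1) L * (1 + ofLevelSeries (n + 1) Δ)) := by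
  have hL0 : L ≠ 0 := fun h => hL ⟨0, by rw [map_zero, h]⟩
  have hL' : levelD (n + 1) (largeToGrid L) ≠ 0 :=
    (levelAsym (n + 1)).isAsym.deriv_ne_zero (largeToGrid_ne_zero hL0) (Large.coeff_zero L)
  obtain ⟨w, hw, -⟩ := Grid.exists_inv hL' (Λ := ⊤) (Set.subset_univ _)
  have hw1 := pos_of_mem_support_inv_mul_dlog hL hw
  have hu1 := pos_of_mem_support_levelD_levelD hL hw
  set l := levelD (n + 1) (largeToGrid L) with hl
  set u := levelD (n + 1) l * w ^ 2 with hu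
  obtain ⟨Δ, hΔpos, hΔ⟩ := exists_fixpoint_firstOrderOp (dlogClosable (n + 1)) hw1 hu1
  have hΔeq := (hΔ Δ).2 rfl
  rw [firstOrderOp_apply] at hΔeq
  have hJ : ∀ f, firstOrderOp (dlog (n + 1)) w u f = w * levelD (n + 1) f - u * f := fun _ => rfl
  refine ⟨firstOrderOp (dlog (n + 1)) w u, -u, Δ, fun f => ?_, ?_,
    isContractive_firstOrderOp (dlogClosable (n + 1)) hw1 hu1, hΔ, ?_, ?_⟩
  · rw [hJ, hu]
    linear_combination (l * levelD (n + 1) f - levelD (n + 1) l * f * (l * w + 1)) * hw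
  · rw [hu]
    linear_combination (-levelD (n + 1) l * (l * w + 1)) * hw
  · rw [Dominates, Grid.val_one, orderTop_one]
    by_cases h0 : (ofLevelSeries (n + 1) Δ).val = 0
    · rw [h0, orderTop_zero]
      exact WithTop.coe_lt_top _
    · apply zero_lt_orderTop_of_order
      obtain ⟨a, ha, h⟩ := Emb.support_mapAlg_subset _ _ (coeff_order_eq_zero.not.2 h0)
      exact h ▸ (Emb.pos_iff _).2 (hΔpos a ha)
  · have hdw : levelD (n + 1) w = -u := by
      have h1 := deriv_mul (dlog (n + 1)) l w
      rw [hw, deriv_one] at h1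
      have h2 : 0 = levelD (n + 1) l * w + l * levelD (n + 1) w := h1
      rw [hu]
      linear_combination (-levelD (n + 1) w) * hw - w * h2
    obtain ⟨z, hz⟩ : ∃ z, z = w * (1 + Δ) := ⟨_, rfl⟩
    -- With `z = (1 + Δ)/L'`, the fixed point equation says `z' = Δ`, and `Δ = L' z - 1`. This is
    -- exactly the condition `(-e^{-L} z)' = e^{-L}`.
    have hdz : levelD (n + 1) z = l * z - 1 := by
      have h1 : levelD (n + 1) z = levelD (n + 1) w * (1 + Δ) + w * levelD (n + 1) (1 + Δ) := by
        rw [hz]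
        exact deriv_mul (dlog (n + 1)) w (1 + Δ)
      have h2 : levelD (n + 1) (1 + Δ) = levelD (n + 1) Δ := by
        rw [map_add]
        exact (congrArg (· + levelD (n + 1) Δ) (deriv_one (dlog (n + 1)))).trans (zero_add _)
      have h3 : Δ = -u + (w * levelD (n + 1) Δ - u * Δ) := hΔeq
      rw [h1, h2, hdw, hz]
      linear_combination (-1 - Δ) * hw - h3
    have hP : primitive (expNeg (n + 1) L) = -(expNeg (n + 1) L * ofLevelSeries (n + 1) z) := by
      refine primitive_eq ?_ ?_
      · have := noConst_expNeg_mul hL (-z)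
        rwa [map_neg, mul_neg] at this
      · rw [map_neg, D_mul, D_expNeg, D_ofLevelSeries, hdz, map_sub, map_mul, map_one, ← hl]
        ring
    have hlz : ofLevelSeries (n + 1) l * ofLevelSeries (n + 1) z =
        1 + ofLevelSeries (n + 1) Δ := by
      rw [← map_mul, hz, ← mul_assoc, hw, one_mul, map_add, map_one]
    rw [hP, D_ofLevelSeries, ← hl, ← hlz]
    ring

end ExpNeg

end Transseries

end

open Transseries in
theorem mainTheorem7 :
    ∃ P : TSeries →ₗ[ℝ] TSeries,
      (∀ T, D (P T) = T) ∧
      (∀ T, NoConst (P T)) ∧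
      (∀ Q : TSeries → TSeries, (∀ T, D (Q T) = T) → (∀ T, NoConst (Q T)) → Q = P) ∧
      (∀ T, P (D T) = dropConst T) ∧
      (∀ S T, P (S * D T) = dropConst (S * T) - P (D S * T)) ∧
      (∀ S T, Dominates S T → Dominates (P S) (P T)) ∧
      (∀ T, Pos T → Dominates (P T) 1 → Pos (P T)) ∧
      (∀ T, Pos T → Dominates 1 (P T) → Pos (-P T)) ∧
      (∀ T, Pos T → ¬ Dominates xInv T → Pos (P T)) ∧
      (∀ (n : ℕ) (L : Large (Mon (n + 1))), L ∉ Set.range (incl n).mapLarge →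
        ∃ (J : Grid (Mon (n + 1)) →ₗ[ℝ] Grid (Mon (n + 1))) (Δ₀ Δ : Grid (Mon (n + 1))),
          (∀ f, (levelD (n + 1) (largeToGrid L)) ^ 2 * J f =
            levelD (n + 1) (largeToGrid L) * levelD (n + 1) f
              - levelD (n + 1) (levelD (n + 1) (largeToGrid L)) * f) ∧
          (levelD (n + 1) (largeToGrid L)) ^ 2 * Δ₀ =
            - levelD (n + 1) (levelD (n + 1) (largeToGrid L)) ∧
          IsContractive J ∧
          (∀ f, f = Δ₀ + J f ↔ f = Δ) ∧
          Dominates 1 (ofLevelSeries (n + 1) Δ) ∧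
          D (ofLevelSeries (n + 1) (largeToGrid L)) * P (expNeg (n + 1) L) =
            - (expNeg (n + 1) L * (1 + ofLevelSeries (n + 1) Δ))) := by
  exact ⟨primitive, D_primitive, noConst_primitive,
    fun _ hD hN => funext fun T => (primitive_eq (hN T) (hD T)).symm, primitive_D, primitive_mul_D,
    fun _ _ h => h.primitive, fun _ h => h.primitive_of_large, fun _ h => h.neg_primitive_of_small,
    fun _ h => h.primitive_of_not_dominates, fun _ _ hL => exists_primitive_expNeg hL⟩
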